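/- **Setting.** Let $n$ be a security parameter, $k$ a number of players, $I_{\mathcal A}\subsetneq[k]$ a set of corrupted players, and $C$ a quantum circuit on $W$ wires consisting of Clifford$+\mathsf T$ gates, possibly classically controlled on earlier measurement outcomes, and destructive computational-basis measurements. The wires are partitioned into the players' input registers $R_j^{\mathsf{in}}$ and ancillas, and also into the players' output registers $R_j^{\mathsf{out}}$ and discarded wires. Let $\mathscr C_{m}$ be the $m$-qubit Clifford group modulo global phases. *Ideal functionality $\mathfrak I^{C}$ (without decoding).* The players send their inputs to a trusted third party, which sets the ancillas to $|0\rangle$, applies $C$, and for every unmeasured output wire $v$ of a player $j$ samples $E_v\in\mathscr C_{n+1}$ uniformly and sends $E_v(\cdot\otimes|0^n\rangle\langle0^n|)E_v^\dagger$ to player $j$. Each corrupted player then sends an abort bit. If all of them are $0$, all keys $E_v$ and all measurement outcomes are stored in a classical state register $S$; otherwise $S:=\bot$. *Measurement protocol $\Pi^{\mathsf{meas}}$ for a wire $w$ held by player $i$.* A classical trusted party (MPC) that holds $S$, containing the key $E$ of $w$, samples uniform $r,s\in\{0,1\}^{n+1}$, $c\in\{0,1\}^n$ and gives player $i$ the classical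 description of the Clifford $V=\mathsf X^r\mathsf Z^s\,\mathsf{CNOT}_{1,c}\,E^\dagger$, where $\mathsf{CNOT}_{1,c}=\prod_j\mathsf{CNOT}_{1,j}^{c_j}$ has the data qubit as control and the $j$-th trap as target. Player $i$ applies $V$ to the encoding of $w$, measures all $n+1$ qubits in the computational basis, and reports the result $r'$. If $r'=r\oplus(m,m\cdot c)$ for some $m\in\{0,1\}$ and no corrupted player aborts, then in $S$ the key $E$ is replaced by the outcome $m$; otherwise $S:=\bot$. If $S$ was already $\bot$, it remains $\bot$; no $V$ is handed out, and an honest player $i$ discards the encoding. *Parties.* An adversary $\mathcal A$ performs all interactions of the players in $I_{\mathcal A}$; it receives their inputs and a side-information register and finally outputs a register. Each of its rounds is a quantum circuit whose elementary operations are arbitrary unitaries on at most three qubits, preparing $|0\rangle$, and discarding a qubit. Its complexity is the number of elementary operations plus the numbers of qubits read and written in each round. A simulator $\mathcal S$ is such a party interacting with an ideal functionality. An environment $\mathcal E$ is computationally unbounded: it prepares an arbitrary joint state of all inputs (of honest players and of $\mathcal A$ or $\mathcal S$) and a private memory, and at the end it applies an arbitrary two-outcome measurement to the output of $\mathcal A$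 or $\mathcal S$, the encoded outputs of the honest players, the register $S$ and its memory, which gives its output bit. **Lemma.** There are a negligible function $\varepsilon:\mathbb N\to\mathbb R$ and a polynomial $p$ such that the following holds for all $n$, $k$, $W$, partitions, circuits $C$ and sets $I_{\mathcal A}\subsetneq[k]$ as above. Let $w$ be a wire that $C$ leaves unmeasured and that belongs to the output register of a player $i$. Write $\Pi^{\mathsf{meas}}\diamond\mathfrak I^{C}$ for $\mathfrak I^C$ followed by the measurement protocol on $w$, and $\mathsf{meas}\circ C$ for the circuit $C$ followed by a measurement of $w$. For every adversary $\mathcal A$ for the players in $I_{\mathcal A}$ there is a simulator $\mathcal S$, of complexity at most $p(n+\text{complexity of }\mathcal A)$, such that for all environments $\mathcal E$, $$\left|\Pr[1\leftarrow(\mathcal E\leftrightarrows(\Pi^{\mathsf{meas}}\diamond\mathfrak I^{C})_{\mathcal A})]-\Pr[1\leftarrow(\mathcal E\leftrightarrows\mathfrak I^{\mathsf{meas}\circ C}_{\mathcal S})]\right|\le\varepsilon(n).$$ -/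

import Mathlib

noncomputable section

namespace MPQC

/-! ### Qubit registers, operators, Pauli and Clifford group -/

/-- Computational basis labels of a register whose qubits are indexed by `ι`. -/
abbrev Reg (ι : Type) : Type := ι → ZMod 2

/-- Operators on the Hilbert space with orthonormal basis `α`. -/
abbrev Op (α : Type) : Type := Matrix α α ℂ

/-- The Pauli operator `X^a Z^b`, i.e. `|x⟩ ↦ (-1)^{b·x} |x + a⟩`. -/
def pauli {ι : Type} [Fintype ι] [DecidableEq ι] (a b : Reg ι) : Op (Reg ι) :=
  Matrix.of fun y x => if y = x + a then (-1 : ℂ) ^ (∑ j, (b j * x j).val) else 0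

/-- The Hermitian representative `i^{|a ∧ b|} X^a Z^b` (a tensor product of `1, X, Y, Z`). -/
def hermPauli {ι : Type} [Fintype ι] [DecidableEq ι] (a b : Reg ι) : Op (Reg ι) :=
  Complex.I ^ (∑ j, (a j * b j).val) • pauli a b

/-- A unitary is Clifford if conjugation by it maps Paulis to Paulis, up to scalars. -/
def IsClifford {ι : Type} [Fintype ι] [DecidableEq ι] (U : Op (Reg ι)) : Prop :=
  U ∈ Matrix.unitaryGroup (Reg ι) ℂ ∧
    ∀ a b : Reg ι, ∃ (a' b' : Reg ι) (φ : ℂ), U * pauli a b * U.conjTranspose = φ • pauli a' b'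

/-- The generators `X_j` (left) and `Z_j` (right) of the Pauli group. -/
def pauliGen {ι : Type} [Fintype ι] [DecidableEq ι] : ι ⊕ ι → Op (Reg ι)
  | .inl j => pauli (Pi.single j 1) 0
  | .inr j => pauli 0 (Pi.single j 1)

/-- Positions of the bits of a tableau: for every generator, the `X` part, the `Z` part and the
sign of its image. -/
abbrev TabIdx (ι : Type) : Type := (ι ⊕ ι) × (ι ⊕ (ι ⊕ Unit))

/-- The bit string `t` is the tableau of `U`: it lists the images of the Pauli generators under
conjugation by `U`. This determines a Clifford `U` up to a global phase. -/
def Describes {ι : Type} [Fintype ι] [DecidableEq ι] (t : Reg (TabIdx ι)) (U : Op (Reg ι)) :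
    Prop :=
  ∀ g : ι ⊕ ι, U * pauliGen g * U.conjTranspose =
    (-1 : ℂ) ^ (t (g, .inr (.inr ()))).val •
      hermPauli (fun j => t (g, .inl j)) (fun j => t (g, .inr (.inl j)))

/-- The Clifford group modulo global phases, as a finite set: its elements are represented by
their classical descriptions (tableaux). -/
def Clifford (ι : Type) [Fintype ι] [DecidableEq ι] : Type :=
  {t : Reg (TabIdx ι) // ∃ U : Op (Reg ι), IsClifford U ∧ Describes t U}

instance (ι : Type) [Fintype ι] [DecidableEq ι] : Finite (Clifford ι) :=
  inferInstanceAs (Finite {t : Reg (TabIdx ι) // ∃ U : Op (Reg ι), IsClifford U ∧ Describes t U})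

instance (ι : Type) [Fintype ι] [DecidableEq ι] : Fintype (Clifford ι) := Fintype.ofFinite _

/-- A unitary representing a Clifford group element (unique up to a global phase). -/
def Clifford.unitary {ι : Type} [Fintype ι] [DecidableEq ι] (E : Clifford ι) : Op (Reg ι) :=
  Classical.choose E.2

open Classical in
/-- The classical description (tableau) of a Clifford unitary. -/
def description {ι : Type} [Fintype ι] [DecidableEq ι] (U : Op (Reg ι)) : Reg (TabIdx ι) :=
  if h : ∃ t, Describes t U then Classical.choose h else 0

/-! ### Quantum circuits as a model of computation, with their size -/

/-- Quantum circuits from a register with qubits `a` to a register with qubits `b`. Elementary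
operations: an arbitrary unitary on at most three qubits, adjoining a qubit in state `|0⟩`,
discarding a qubit. Wires may be renamed freely, so that the elementary operations act on
arbitrarily chosen qubits. -/
inductive QCirc : Type → Type → Type 1
  | relabel {a b : Type} (e : a ≃ b) : QCirc a b
  | gate {a : Type} (j : ℕ) (hj : j ≤ 3) (U : Matrix.unitaryGroup (Reg (Fin j)) ℂ) :
      QCirc (Fin j ⊕ a) (Fin j ⊕ a)
  | alloc {a : Type} : QCirc a (Unit ⊕ a)
  | discard {a : Type} : QCirc (Unit ⊕ a) a
  | seq {a b c : Type} (f : QCirc a b) (g : QCirc b c) : QCirc a c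

/-- The quantum channel computed by a circuit. -/
def QCirc.run : {a b : Type} → QCirc a b → Op (Reg a) → Op (Reg b)
  | _, _, .relabel e, ρ => ρ.submatrix (fun x => x ∘ e) (fun x => x ∘ e)
  | _, _, .gate j _ U, ρ => Matrix.of fun x y =>
      ∑ p : Reg (Fin j), ∑ q : Reg (Fin j),
        (U : Op (Reg (Fin j))) (x ∘ Sum.inl) p *
          ρ (Sum.elim p (x ∘ Sum.inr)) (Sum.elim q (y ∘ Sum.inr)) *
          star ((U : Op (Reg (Fin j))) (y ∘ Sum.inl) q)
  | _, _, .alloc, ρ => Matrix.of fun x y =>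
      if x (.inl ()) = 0 ∧ y (.inl ()) = 0 then ρ (x ∘ Sum.inr) (y ∘ Sum.inr) else 0
  | _, _, .discard, ρ => Matrix.of fun x y =>
      ∑ b : ZMod 2, ρ (Sum.elim (fun _ => b) x) (Sum.elim (fun _ => b) y)
  | _, _, .seq f g, ρ => g.run (f.run ρ)

/-- The number of elementary operations of a circuit. -/
def QCirc.size : {a b : Type} → QCirc a b → ℕ
  | _, _, .relabel _ => 0
  | _, _, .gate _ _ _ => 1
  | _, _, .alloc => 1
  | _, _, .discard => 1
  | _, _, .seq f g => f.size + g.size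

/-- The complexity of a circuit: the number of its elementary operations plus the number of
qubits that it reads and writes. -/
def QCirc.cost {a b : Type} (f : QCirc a b) : ℕ := f.size + Nat.card a + Nat.card b

/-! ### Operations on parts of a joint system -/

/-- `Φ ⊗ id` for a map `Φ` on operators. -/
def onFst {α β γ : Type} (Φ : Op α → Op β) (ρ : Op (α × γ)) : Op (β × γ) :=
  Matrix.of fun x y => Φ (Matrix.of fun a a' => ρ (a, x.2) (a', y.2)) x.1 y.1

/-- `1 ⊗ Φ ⊗ 1` for a map `Φ` on operators. -/
def onMid {α β β' γ : Type} (Φ : Op β → Op β') (ρ : Op (α × (β × γ))) : Op (α × (β' × γ)) :=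
  Matrix.of fun x y =>
    Φ (Matrix.of fun b b' => ρ (x.1, (b, x.2.2)) (y.1, (b', y.2.2))) x.2.1 y.2.1

/-- The CP map `ρ ↦ K ρ K†`. -/
def sandwich {α β : Type} [Fintype α] (K : Matrix β α ℂ) (ρ : Op α) : Op β :=
  K * ρ * K.conjTranspose

/-- The (unnormalized) state after the qubits `α` were measured in the computational basis with
result `b`, and removed. -/
def readOff {α β γ : Type} (b : Reg α) (ρ : Op (Reg (α ⊕ β) × γ)) : Op (Reg β × γ) :=
  ρ.submatrix (fun x => (Sum.elim b x.1, x.2)) (fun x => (Sum.elim b x.1, x.2))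

/-- A classical message `t` is put into a new register `α`. -/
def feed {α β γ : Type} [Fintype α] (t : Reg α) (ρ : Op (Reg β × γ)) :
    Op (Reg (α ⊕ β) × γ) :=
  Matrix.of fun x y =>
    if x.1 ∘ Sum.inl = t ∧ y.1 ∘ Sum.inl = t then
      ρ (x.1 ∘ Sum.inr, x.2) (y.1 ∘ Sum.inr, y.2)
    else 0

/-! ### The circuits to be computed: (classically controlled) Clifford+T gates, measurements -/

/-- Elementary single-qubit gates. -/
inductive Gate1
  | X | Z | H | P | T

/-- The matrix of a single-qubit gate in the computational basis. -/
def Gate1.mat : Gate1 → Op (ZMod 2)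
  | .X => Matrix.of fun y x => if y = x + 1 then 1 else 0
  | .Z => Matrix.diagonal fun x => (-1 : ℂ) ^ x.val
  | .H => Matrix.of fun y x => (-1 : ℂ) ^ (y * x).val / (Real.sqrt 2 : ℂ)
  | .P => Matrix.diagonal fun x => Complex.I ^ x.val
  | .T => Matrix.diagonal fun x => Complex.exp (Complex.I * (Real.pi / 4 : ℝ)) ^ x.val

/-- Gates on `W` wires. A unitary gate may be controlled on the outcome of an earlier measurement,
referred to by the wire that was measured. -/
inductive Gate (W : ℕ)
  | single (g : Gate1) (v : Fin W) (ctrl : Option (Fin W))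
  | cnot (c t : Fin W) (ctrl : Option (Fin W))
  | meas (v : Fin W)

/-- A circuit: its gates in the order of execution. -/
abbrev Circuit (W : ℕ) : Type := List (Gate W)

/-- The wires that a circuit measures. -/
def Circuit.measured {W : ℕ} : Circuit W → Finset (Fin W)
  | [] => ∅
  | .single _ _ _ :: C => Circuit.measured C
  | .cnot _ _ _ :: C => Circuit.measured C
  | .meas v :: C => insert v (Circuit.measured C)

/-- Given the set `M` of wires measured so far: no gate acts on a measured wire (measurements are
destructive), and classical controls refer to wires that have been measured before. -/
def Circuit.WellFormed {W : ℕ} : Finset (Fin W) → Circuit W → Prop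
  | _, [] => True
  | M, .single _ v ctrl :: C => v ∉ M ∧ (∀ l ∈ ctrl, l ∈ M) ∧ Circuit.WellFormed M C
  | M, .cnot c t ctrl :: C =>
      c ≠ t ∧ c ∉ M ∧ t ∉ M ∧ (∀ l ∈ ctrl, l ∈ M) ∧ Circuit.WellFormed M C
  | M, .meas v :: C => v ∉ M ∧ Circuit.WellFormed (insert v M) C

/-- Whether a control is active on the basis state `x`. -/
def active {W : ℕ} (ctrl : Option (Fin W)) (x : Reg (Fin W)) : Prop := ∀ l ∈ ctrl, x l = 1

open Classical in
/-- The channel of a gate. A measured wire is kept as a classical wire: after the measurement it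
is diagonal in the computational basis and holds the outcome. -/
def Gate.apply {W : ℕ} : Gate W → Op (Reg (Fin W)) → Op (Reg (Fin W))
  | .single g v ctrl, ρ => sandwich (Matrix.of fun y x =>
      if ∀ u, u ≠ v → y u = x u then
        (if active ctrl x then g.mat (y v) (x v) else if y v = x v then 1 else 0)
      else 0) ρ
  | .cnot c t ctrl, ρ => sandwich (Matrix.of fun y x =>
      if y = (if active ctrl x then Function.update x t (x t + x c) else x) then 1 else 0) ρ
  | .meas v, ρ => Matrix.of fun y x => if y v = x v then ρ y x else 0

/-- The channel of a circuit. -/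
def Circuit.run {W : ℕ} (C : Circuit W) (ρ : Op (Reg (Fin W))) : Op (Reg (Fin W)) :=
  C.foldl (fun σ g => g.apply σ) ρ

/-! ### Players, registers, and the ideal functionality without decoding -/

/-- The qubits of an encoded wire: `none` is the data qubit `M`, `some j` the `j`-th trap of
`T₁`. -/
abbrev Block (n : ℕ) : Type := Option (Fin n)

/-- The entry of the state register `S` for one wire. -/
inductive WireRecord (n : ℕ)
  | discarded
  | key (E : Clifford (Block n))
  | outcome (m : ZMod 2)

/-- The state register `S`; `none` is the symbol `⊥`. -/
abbrev Store (n W : ℕ) : Type := Option (Fin W → WireRecord n)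

/-- `k` players, a set of corrupted players, and `W` wires, which are partitioned into the players'
inputs and ancillas (`inp v = none`), and into the players' outputs and discarded wires
(`out v = none`). -/
structure Setup where
  k : ℕ
  W : ℕ
  corrupted : Finset (Fin k)
  inp : Fin W → Option (Fin k)
  out : Fin W → Option (Fin k)

namespace Setup

variable (P : Setup)

/-- The corrupted players. -/
abbrev Bad : Type := {j : Fin P.k // j ∈ P.corrupted}

/-- Input wires of the corrupted players. -/
abbrev BadIn : Type := {v : Fin P.W // ∃ j ∈ P.corrupted, P.inp v = some j}

/-- Input wires of the honest players. -/
abbrev GoodIn : Type := {v : Fin P.W // ∃ j ∉ P.corrupted, P.inp v = some j}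

/-- Output wires of the corrupted players, for a circuit that measures the wires `M`. -/
abbrev BadOut (M : Finset (Fin P.W)) : Type :=
  {v : Fin P.W // v ∉ M ∧ ∃ j ∈ P.corrupted, P.out v = some j}

/-- Output wires of the honest players, for a circuit that measures the wires `M`. -/
abbrev GoodOut (M : Finset (Fin P.W)) : Type :=
  {v : Fin P.W // v ∉ M ∧ ∃ j ∉ P.corrupted, P.out v = some j}

/-- Wires that are discarded at the end. -/
abbrev Discard (M : Finset (Fin P.W)) : Type := {v : Fin P.W // v ∉ M ∧ P.out v = none}

instance : Fintype P.Bad := inferInstance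

instance : DecidableEq P.Bad := inferInstance

instance : Fintype P.BadIn := inferInstance

instance : DecidableEq P.BadIn := inferInstance

instance : Fintype P.GoodIn := inferInstance

instance : DecidableEq P.GoodIn := inferInstance

instance (M : Finset (Fin P.W)) : Fintype (P.BadOut M) := inferInstance

instance (M : Finset (Fin P.W)) : DecidableEq (P.BadOut M) := inferInstance

instance (M : Finset (Fin P.W)) : Fintype (P.GoodOut M) := inferInstance

instance (M : Finset (Fin P.W)) : DecidableEq (P.GoodOut M) := inferInstance

instance (M : Finset (Fin P.W)) : Fintype (P.Discard M) := inferInstance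

instance (M : Finset (Fin P.W)) : DecidableEq (P.Discard M) := inferInstance

end Setup

/-- The interactive algorithm that performs all interactions of the corrupted players with the
ideal functionality of a circuit that measures the wires `M`. Given the corrupted inputs and the
side information (`side` qubits), `submit` produces the inputs for the functionality. Given the
encoded corrupted outputs, `respond` produces one abort bit for every corrupted player, and a
final register of `fin` qubits. -/
structure Party (P : Setup) (n : ℕ) (M : Finset (Fin P.W)) (side fin : ℕ) where
  mem : ℕ
  submit : QCirc (P.BadIn ⊕ Fin side) (P.BadIn ⊕ Fin mem)
  respond : QCirc ((P.BadOut M × Block n) ⊕ Fin mem) (P.Bad ⊕ Fin fin)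

/-- The complexity of a party. -/
def Party.cost {P : Setup} {n : ℕ} {M : Finset (Fin P.W)} {side fin : ℕ}
    (A : Party P n M side fin) : ℕ := A.submit.cost + A.respond.cost

open scoped ComplexOrder in
/-- An environment: a joint state of the inputs of the adversary, the inputs of the honest players
and a private memory, and a final two-outcome measurement on the output of the adversary, the
outputs of the honest players, the private memory and the state register `S`; `test s` is the
effect for the output `1` if `S` contains `s`. -/
structure Environment (P : Setup) (n : ℕ) (M : Finset (Fin P.W)) (side fin : ℕ) where
  dim : ℕ
  state : Op (Reg (P.BadIn ⊕ Fin side) × (Reg P.GoodIn × Fin dim))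
  state_pos : state.PosSemidef
  state_trace : state.trace = 1
  test : Store n P.W → Op (Reg (Fin fin) × (Reg (P.GoodOut M × Block n) × Fin dim))
  test_pos : ∀ s, (test s).PosSemidef
  test_le : ∀ s, (1 - test s).PosSemidef

/-- The trusted third party collects the inputs and sets the ancillas to `|0⟩`. -/
def collect {P : Setup} {m d : ℕ}
    (ρ : Op (Reg (P.BadIn ⊕ Fin m) × (Reg P.GoodIn × Fin d))) :
    Op (Reg (Fin P.W) × (Reg (Fin m) × Fin d)) :=
  Matrix.of fun x y =>
    if (∀ v, P.inp v = none → x.1 v = 0) ∧ (∀ v, P.inp v = none → y.1 v = 0) then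
      ρ (Sum.elim (fun v => x.1 v.1) x.2.1, (fun v => x.1 v.1, x.2.2))
        (Sum.elim (fun v => y.1 v.1) y.2.1, (fun v => y.1 v.1, y.2.2))
    else 0

/-- The amplitude of `|u⟩` in the encoding `E (|b⟩ ⊗ |0^n⟩)`. -/
def encAmp {n : ℕ} (E : Clifford (Block n)) (b : ZMod 2) (u : Reg (Block n)) : ℂ :=
  E.unitary u (fun q => q.elim b (fun _ => 0))

/-- The Kraus operator of the output phase of the functionality: the measured wires have the
values `y`, the discarded wires (traced out below) the values `z`, and every output wire `v` is
encoded with the key `E v`. -/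
def encode {P : Setup} {n : ℕ} {M : Finset (Fin P.W)} (E : Fin P.W → Clifford (Block n))
    (y : Reg {v // v ∈ M}) (z : Reg (P.Discard M)) :
    Matrix (Reg (P.BadOut M × Block n) × Reg (P.GoodOut M × Block n)) (Reg (Fin P.W)) ℂ :=
  Matrix.of fun u x =>
    if (∀ v : {v // v ∈ M}, x v.1 = y v) ∧ (∀ v : P.Discard M, x v.1 = z v) then
      (∏ v : P.BadOut M, encAmp (E v.1) (x v.1) (fun q => u.1 (v, q))) *
        ∏ v : P.GoodOut M, encAmp (E v.1) (x v.1) (fun q => u.2 (v, q))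
    else 0

/-- The (unnormalized) joint state after the ideal functionality for `C` was run with the party
`A`, in the branch with keys `E`, measurement outcomes `y` and abort bits `b`. -/
def idealRun {P : Setup} {n : ℕ} (C : Circuit P.W) {side fin d : ℕ}
    (A : Party P n C.measured side fin)
    (ρ : Op (Reg (P.BadIn ⊕ Fin side) × (Reg P.GoodIn × Fin d)))
    (E : Fin P.W → Clifford (Block n)) (y : Reg {v // v ∈ C.measured}) (b : Reg P.Bad) :
    Op (Reg (Fin fin) × (Reg (P.GoodOut C.measured × Block n) × Fin d)) :=
  let computed : Op (Reg (Fin P.W) × (Reg (Fin A.mem) × Fin d)) :=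
    onFst C.run (collect (onFst A.submit.run ρ))
  let sent : Op ((Reg (P.BadOut C.measured × Block n) × Reg (P.GoodOut C.measured × Block n)) ×
      (Reg (Fin A.mem) × Fin d)) :=
    ∑ z : Reg (P.Discard C.measured), onFst (sandwich (encode E y z)) computed
  let received : Op (Reg ((P.BadOut C.measured × Block n) ⊕ Fin A.mem) ×
      (Reg (P.GoodOut C.measured × Block n) × Fin d)) :=
    sent.submatrix
      (fun x => ((x.1 ∘ Sum.inl, x.2.1), (x.1 ∘ Sum.inr, x.2.2)))
      (fun x => ((x.1 ∘ Sum.inl, x.2.1), (x.1 ∘ Sum.inr, x.2.2)))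
  readOff b (onFst A.respond.run received)

/-- The content of `S` after the ideal functionality: the keys of the output wires and the
measurement outcomes, or `⊥` if some corrupted player aborts. -/
def idealStore {P : Setup} {n : ℕ} {M : Finset (Fin P.W)} (E : Fin P.W → Clifford (Block n))
    (y : Reg {v // v ∈ M}) (b : Reg P.Bad) : Store n P.W :=
  if b = 0 then
    some fun v =>
      if h : v ∈ M then .outcome (y ⟨v, h⟩)
      else if P.out v = none then .discarded else .key (E v)
  else none

/-- The probability that the environment outputs `1` when it interacts with the ideal
functionality (without decoding) for `C` and the simulator `A`. -/
def idealProb {P : Setup} {n : ℕ} (C : Circuit P.W) {side fin : ℕ}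
    (A : Party P n C.measured side fin) (Z : Environment P n C.measured side fin) : ℝ :=
  Finset.expect Finset.univ fun E : Fin P.W → Clifford (Block n) =>
    ∑ y : Reg {v // v ∈ C.measured}, ∑ b : Reg P.Bad,
      (Matrix.trace (Z.test (idealStore E y b) * idealRun C A Z.state E y b)).re

/-! ### The measurement protocol -/

/-- `CNOT_{1,c}`: the data qubit controls a bit flip of all traps `j` with `c j = 1`. -/
def cnotTraps {n : ℕ} (c : Reg (Fin n)) : Op (Reg (Block n)) :=
  Matrix.of fun y x => if y = x + (fun q => q.elim 0 fun j => x none * c j) then 1 else 0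

/-- The operator `V` that the classical MPC computes from its state register, for a measurement of
the wire `w`; there is none if the MPC has aborted before. -/
def instruction {n W : ℕ} (S : Store n W) (w : Fin W) (r s : Reg (Block n)) (c : Reg (Fin n)) :
    Option (Op (Reg (Block n))) :=
  S.bind fun rec =>
    match rec w with
    | .key E => some (pauli r s * cnotTraps c * E.unitary.conjTranspose)
    | _ => none

/-- The bit `m` with `r' = r ⊕ (m, m · c)`, if it exists. -/
def decodeOutcome {n : ℕ} (r : Reg (Block n)) (c : Reg (Fin n)) (r' : Reg (Block n)) :
    Option (ZMod 2) :=
  let m := r' none + r none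
  if r' = r + (fun q => q.elim m fun j => m * c j) then some m else none

/-- The content of `S` after the measurement protocol on the wire `w`, where `r'` is the reported
result and `b` are the abort bits of the corrupted players: the key of `w` is replaced by the
outcome, unless the MPC aborts. -/
def measStore {P : Setup} {n : ℕ} (S : Store n P.W) (w : Fin P.W) (r : Reg (Block n))
    (c : Reg (Fin n)) (r' : Reg (Block n)) (b : Reg P.Bad) : Store n P.W :=
  if b = 0 then
    S.bind fun rec => (decodeOutcome r c r').map fun m => Function.update rec w (.outcome m)
  else none

/-- The adversary in the ideal functionality for a circuit that measures the wires `M`, followed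
by the measurement protocol on a wire of player `i`. The party `first` interacts with the ideal
functionality, keeping `mem` qubits. Afterwards, if player `i` is corrupted, `attack` receives the
classical description of `V` and produces the reported result; in any case it produces an abort
bit for every corrupted player, and the output register of `fin` qubits. -/
structure Adversary (P : Setup) (n : ℕ) (M : Finset (Fin P.W)) (i : Fin P.k)
    (side fin : ℕ) where
  mem : ℕ
  first : Party P n M side mem
  attack : QCirc ({_q : TabIdx (Block n) // i ∈ P.corrupted} ⊕ Fin mem)
    (({_q : Block n // i ∈ P.corrupted} ⊕ P.Bad) ⊕ Fin fin)

/-- The complexity of an adversary. -/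
def Adversary.cost {P : Setup} {n : ℕ} {M : Finset (Fin P.W)} {i : Fin P.k} {side fin : ℕ}
    (A : Adversary P n M i side fin) : ℕ := A.first.cost + A.attack.cost

/-- The Kraus operator of the honest players in the measurement protocol on the wire `w` of player
`i`. If player `i` is honest, it applies `V` to the encoding of `w` and measures the result `h`;
the encoding is destroyed. The other encoded wires are untouched. -/
def honestMeas {P : Setup} {n : ℕ} (M M' : Finset (Fin P.W)) (w : Fin P.W) (i : Fin P.k)
    (V : Op (Reg (Block n))) (h : Reg {_q : Block n // i ∉ P.corrupted}) :
    Matrix (Reg (P.GoodOut M' × Block n)) (Reg (P.GoodOut M × Block n)) ℂ :=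
  Matrix.of fun u' u =>
    if ∀ (v : Fin P.W) (hv : v ∉ M ∧ ∃ j ∉ P.corrupted, P.out v = some j)
        (hv' : v ∉ M' ∧ ∃ j ∉ P.corrupted, P.out v = some j) (q : Block n),
        u (⟨v, hv⟩, q) = u' (⟨v, hv'⟩, q) then
      if hw : i ∉ P.corrupted ∧ w ∉ M ∧ ∃ j ∉ P.corrupted, P.out w = some j then
        V (fun q => h ⟨q, hw.1⟩) (fun q => u (⟨w, hw.2⟩, q))
      else 1
    else 0

/-- The probability that the environment outputs `1` when it interacts with the ideal
functionality for `C` followed by the measurement protocol on the wire `w` of player `i`, and the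
adversary `A`. If the MPC has aborted before it would hand out `V`, a corrupted player `i` receives
the all-zero string (which describes no Clifford), and an honest player `i` discards the
encoding. -/
def realProb {P : Setup} {n : ℕ} (C : Circuit P.W) (w : Fin P.W) (i : Fin P.k) {side fin : ℕ}
    (A : Adversary P n C.measured i side fin)
    (Z : Environment P n (Circuit.measured (C ++ [Gate.meas w])) side fin) : ℝ :=
  Finset.expect Finset.univ fun E : Fin P.W → Clifford (Block n) =>
    ∑ y : Reg {v // v ∈ C.measured}, ∑ b : Reg P.Bad,
      let S := idealStore E y b
      Finset.expect Finset.univ fun k : Reg (Block n) × Reg (Block n) × Reg (Fin n) =>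
        let r := k.1
        let c := k.2.2
        let V := instruction S w r k.2.1 c
        let message : Reg {_q : TabIdx (Block n) // i ∈ P.corrupted} :=
          fun q => (V.elim 0 description : Reg (TabIdx (Block n))) q.1
        let attacked := onFst A.attack.run (feed message (idealRun C A.first Z.state E y b))
        ∑ a : Reg {_q : Block n // i ∈ P.corrupted}, ∑ b' : Reg P.Bad,
          ∑ h : Reg {_q : Block n // i ∉ P.corrupted},
            let r' : Reg (Block n) :=
              fun q => if hi : i ∈ P.corrupted then a ⟨q, hi⟩ else h ⟨q, hi⟩
            let final := onMid
              (sandwich (honestMeas C.measured (Circuit.measured (C ++ [Gate.meas w])) w i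
                (V.getD 1) h))
              (readOff (Sum.elim a b') attacked)
            (Matrix.trace (Z.test (measStore S w r c r' b') * final)).re

end MPQC

end

/-!
# Measuring an encoded wire by a classical multi-party computation

Two experiments are compared: the trusted party evaluates the circuit, and the wire `w` is measured
afterwards by the protocol; or the trusted party measures `w` itself.

If the player who holds `w` is honest, the two are equal (`onMid_honest`, `realValue_honest`): the
operator `V` cancels the key, the player obtains `r + (m, m · c)` with `m` distributed as a
measurement of `w`, and the result is decoded to `m`. The simulator runs the adversary and aborts
if the adversary aborts in one of its two rounds.

If the player is corrupted, the key `E` of `w` is uniform, hence for fixed `r`, `s`, `c` it may be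
written as `F⁻¹ X^r Z^s CNOT_{1,c}` with `F` uniform (`substKey`). Then the operator that is handed
out is `F`, and the encoding of a bit `m` is `F†|x⟩` with `x = r + (m, m · c)`, up to the sign
`(-1)^(s · (m, m · c))`. The average over `s` removes the coherence between `m = 0` and `m = 1`,
which means that `w` is measured (`sum_onMid_substKey`). As `r` is uniform, `x` is uniform and
independent of `m` and `c`, whatever the state of the other registers (`realValue_corrupted`). So
everything that the adversary sees can be prepared from `F` and `x` alone, without the encoding of
`w`. The MPC accepts the report `x`, which stands for the true outcome, and one more string, the
other codeword `x + (1, c)`; since the adversary has no information about `c`, it reports the latter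
with probability at most `2^{-n}` (`abs_realValue_sub_hybridValue_le`). The simulator accepts `x`
only, and otherwise aborts.

The simulator has to sample `F`, hand out its description, and prepare `F†|x⟩` with polynomially
many operations on at most three qubits. Every Clifford operator is a word of polynomial length in
rotations `exp(± i π/4 P)` about Pauli operators `P` on at most two qubits (`isWord_clifford`, by a
symplectic Gram–Schmidt process). Some sequence of `T + 2n` elements `g₁, g₂, …` of a group of order
at most `2^T` has random subproducts `g₁^{β₁} g₂^{β₂} ⋯` that are `2^{-n}`-close to uniform
(`exists_subprod_close`, by averaging the squared deviation over all sequences). The sequence may be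
fixed in advance, because for each adversary only the existence of a simulator is claimed, and the
bound on its complexity is uniform. The subproduct is then a word of rotations controlled by the
random bits `β`, each a gate on three qubits, and its description, the list of images of the Pauli
generators, is updated after each rotation by a Boolean formula of bounded size (`exists_sampling`).
The remaining classical control of the simulator is in `exists_tail`, and `exists_simulator`
combines the two cases.
-/

noncomputable section

namespace MPQC

open Matrix

set_option linter.unusedSectionVars false

section PauliAlgebra

/-! ### The Pauli algebra -/

/-- The nontrivial additive character of `𝔽₂`. -/
def chi (z : ZMod 2) : ℂ := (-1) ^ z.val

@[simp] lemma chi_zero : chi 0 = 1 := by simp [chi]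

@[simp] lemma chi_one : chi 1 = -1 := by
  have : (1 : ZMod 2).val = 1 := rfl
  simp [chi, this]

lemma zmod_two_cases (z : ZMod 2) : z = 0 ∨ z = 1 := by
  revert z; decide

lemma chi_add (x y : ZMod 2) : chi (x + y) = chi x * chi y := by
  rcases zmod_two_cases x with rfl | rfl <;> rcases zmod_two_cases y with rfl | rfl
  · simp
  · simp
  · simp
  · rw [show (1 + 1 : ZMod 2) = 0 from rfl]; simp

@[simp] lemma star_chi (x : ZMod 2) : star (chi x) = chi x := by
  rcases zmod_two_cases x with rfl | rfl <;> simp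

@[simp] lemma chi_mul_self (x : ZMod 2) : chi x * chi x = 1 := by
  rcases zmod_two_cases x with rfl | rfl <;> simp

lemma chi_ne_zero (x : ZMod 2) : chi x ≠ 0 := by
  rcases zmod_two_cases x with rfl | rfl <;> simp

lemma chi_injective : Function.Injective chi := by
  intro x y h
  rcases zmod_two_cases x with rfl | rfl <;> rcases zmod_two_cases y with rfl | rfl <;>
    first | rfl | (simp at h; norm_num at h)

lemma chi_sum {κ : Type} (s : Finset κ) (f : κ → ZMod 2) :
    chi (∑ j ∈ s, f j) = ∏ j ∈ s, chi (f j) := by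
  classical
  induction s using Finset.induction_on with
  | empty => simp
  | insert a s ha ih => rw [Finset.sum_insert ha, Finset.prod_insert ha, chi_add, ih]

lemma zmod_two_add_self (x : ZMod 2) : x + x = 0 := CharTwo.add_self_eq_zero x

lemma reg_add_self {ι : Type} (x : Reg ι) : x + x = 0 := funext fun j => zmod_two_add_self (x j)

lemma reg_add_cancel {ι : Type} (x y : Reg ι) : x + y + y = x := by
  rw [add_assoc, reg_add_self, add_zero]

lemma reg_eq_add_iff {ι : Type} {x y a : Reg ι} : y = x + a ↔ x = y + a := by
  constructor <;> (rintro rfl; rw [reg_add_cancel])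

variable {ι : Type} [Fintype ι] [DecidableEq ι]

lemma pauli_apply (a b y x : Reg ι) :
    pauli a b y x = if y = x + a then chi (b ⬝ᵥ x) else 0 := by
  simp only [pauli, Matrix.of_apply]
  congr 1
  rw [← Finset.prod_pow_eq_pow_sum]
  rw [dotProduct, chi_sum]; rfl

lemma pauli_mul (a b a' b' : Reg ι) :
    pauli a b * pauli a' b' = chi (b ⬝ᵥ a') • pauli (a + a') (b + b') := by
  ext y x
  simp only [Matrix.mul_apply, pauli_apply, Matrix.smul_apply, smul_eq_mul, mul_ite, mul_zero]
  rw [Finset.sum_ite_eq' Finset.univ (x + a')]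
  simp only [Finset.mem_univ, if_true]
  have : y = x + a' + a ↔ y = x + (a + a') := by rw [add_assoc, add_comm a' a]
  by_cases h : y = x + (a + a')
  · rw [if_pos (this.2 h), if_pos h, dotProduct_add, add_dotProduct, chi_add, chi_add]; ring
  · rw [if_neg (fun h' => h (this.1 h')), if_neg h, zero_mul]

@[simp] lemma pauli_zero : pauli (0 : Reg ι) 0 = 1 := by
  ext y x
  simp [pauli_apply, Matrix.one_apply]

lemma pauli_conjTranspose (a b : Reg ι) : (pauli a b)ᴴ = chi (a ⬝ᵥ b) • pauli a b := by
  ext y x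
  simp only [Matrix.conjTranspose_apply, pauli_apply, Matrix.smul_apply, smul_eq_mul]
  by_cases h : y = x + a
  · rw [if_pos h, if_pos (reg_eq_add_iff.1 h), star_chi, h, dotProduct_add, chi_add,
      dotProduct_comm b a, mul_comm]
  · rw [if_neg h, if_neg (fun h' => h (reg_eq_add_iff.1 h'))]; simp

lemma pauli_mul_conjTranspose (a b : Reg ι) : pauli a b * (pauli a b)ᴴ = 1 := by
  rw [pauli_conjTranspose, Matrix.mul_smul, pauli_mul, reg_add_self, reg_add_self, smul_smul,
    dotProduct_comm b a, chi_mul_self, one_smul, pauli_zero]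

lemma pauli_mem_unitary (a b : Reg ι) : pauli a b ∈ Matrix.unitaryGroup (Reg ι) ℂ :=
  Matrix.mem_unitaryGroup_iff.2 (pauli_mul_conjTranspose a b)

/-- The phase `i^{|a ∧ b|}` of a Hermitian Pauli operator, one qubit. -/
def loc (a b : ZMod 2) : ℂ := Complex.I ^ (a * b).val

lemma loc_sq (a b : ZMod 2) : loc a b * loc a b = chi (a * b) := by
  rw [loc, chi, ← mul_pow, Complex.I_mul_I]

lemma loc_ne_zero (a b : ZMod 2) : loc a b ≠ 0 := pow_ne_zero _ Complex.I_ne_zero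

lemma star_loc (a b : ZMod 2) : star (loc a b) * loc a b = 1 := by
  rw [loc, star_pow, ← mul_pow]
  simp

/-- The Hermitian Pauli operator of a vector of the symplectic space `𝔽₂^{2ι}`. -/
abbrev hp (v : Reg ι × Reg ι) : Op (Reg ι) := hermPauli v.1 v.2

/-- The phase of a Hermitian Pauli operator. -/
def hphase (v : Reg ι × Reg ι) : ℂ := ∏ j, loc (v.1 j) (v.2 j)

lemma hermPauli_eq (a b : Reg ι) : hermPauli a b = hphase (a, b) • pauli a b := by
  rw [hermPauli, hphase, ← Finset.prod_pow_eq_pow_sum]; rfl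

lemma hp_eq (v : Reg ι × Reg ι) : hp v = hphase v • pauli v.1 v.2 := hermPauli_eq _ _

lemma hphase_sq (v : Reg ι × Reg ι) : hphase v * hphase v = chi (v.1 ⬝ᵥ v.2) := by
  rw [hphase, ← Finset.prod_mul_distrib, dotProduct, chi_sum]
  exact Finset.prod_congr rfl fun j _ => loc_sq _ _

lemma hphase_ne_zero (v : Reg ι × Reg ι) : hphase v ≠ 0 :=
  Finset.prod_ne_zero_iff.2 fun _ _ => loc_ne_zero _ _

lemma star_hphase (v : Reg ι × Reg ι) : star (hphase v) * hphase v = 1 := by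
  rw [hphase, star_prod, ← Finset.prod_mul_distrib]
  exact Finset.prod_eq_one fun j _ => star_loc _ _

/-- The symplectic form on `𝔽₂^{2ι}`. -/
def omega (v w : Reg ι × Reg ι) : ZMod 2 := v.1 ⬝ᵥ w.2 + v.2 ⬝ᵥ w.1

lemma omega_comm (v w : Reg ι × Reg ι) : omega v w = omega w v := by
  rw [omega, omega, add_comm, dotProduct_comm v.2, dotProduct_comm v.1]

lemma omega_self (v : Reg ι × Reg ι) : omega v v = 0 := by
  rw [omega, dotProduct_comm v.2, zmod_two_add_self]

lemma omega_add_left (u v w : Reg ι × Reg ι) : omega (u + v) w = omega u w + omega v w := by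
  simp only [omega, Prod.fst_add, Prod.snd_add, add_dotProduct]; ring

lemma omega_add_right (u v w : Reg ι × Reg ι) : omega w (u + v) = omega w u + omega w v := by
  simp only [omega, Prod.fst_add, Prod.snd_add, dotProduct_add]; ring

@[simp] lemma omega_zero_left (w : Reg ι × Reg ι) : omega 0 w = 0 := by simp [omega]

lemma hp_conjTranspose (v : Reg ι × Reg ι) : (hp v)ᴴ = hp v := by
  rw [hp_eq, Matrix.conjTranspose_smul, pauli_conjTranspose, smul_smul]
  congr 1
  rw [← hphase_sq, ← mul_assoc, star_hphase, one_mul]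

lemma hp_mul_self (v : Reg ι × Reg ι) : hp v * hp v = 1 := by
  rw [hp_eq, Matrix.smul_mul, Matrix.mul_smul, pauli_mul, reg_add_self, reg_add_self, smul_smul,
    smul_smul, hphase_sq, dotProduct_comm v.2, chi_mul_self, one_smul, pauli_zero]

/-- The contribution of one qubit to the phase of a product of two Hermitian Pauli operators. -/
def lamLoc (a b a' b' : ZMod 2) : ℂ :=
  loc a b * loc a' b' * chi (b * a') * (loc (a + a') (b + b'))⁻¹

/-- The phase of a product of two Hermitian Pauli operators. -/
def lam (v w : Reg ι × Reg ι) : ℂ := ∏ j, lamLoc (v.1 j) (v.2 j) (w.1 j) (w.2 j)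

lemma hp_mul (v w : Reg ι × Reg ι) : hp v * hp w = lam v w • hp (v + w) := by
  rw [hp_eq, hp_eq, hp_eq, Matrix.smul_mul, Matrix.mul_smul, pauli_mul, smul_smul, smul_smul,
    smul_smul]
  congr 1
  have : lam v w = hphase v * hphase w * chi (v.2 ⬝ᵥ w.1) * (hphase (v + w))⁻¹ := by
    simp only [lam, lamLoc, hphase, dotProduct, chi_sum, Finset.prod_mul_distrib,
      Finset.prod_inv_distrib, Prod.fst_add, Prod.snd_add, Pi.add_apply]
  rw [this, inv_mul_cancel_right₀ (hphase_ne_zero _)]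

lemma hp_comm (v w : Reg ι × Reg ι) : hp v * hp w = chi (omega v w) • (hp w * hp v) := by
  simp only [hp_eq, Matrix.smul_mul, Matrix.mul_smul, pauli_mul, smul_smul]
  rw [add_comm w.1, add_comm w.2]
  congr 1
  rw [omega, chi_add, dotProduct_comm w.2 v.1]
  linear_combination (hphase w * hphase v * chi (v.2 ⬝ᵥ w.1)) * (-chi_mul_self (v.1 ⬝ᵥ w.2))

lemma hp_ne_zero (v : Reg ι × Reg ι) : hp v ≠ 0 := fun h => by
  have := hp_mul_self v
  rw [h, Matrix.mul_zero] at this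
  exact one_ne_zero this.symm

lemma lam_sq (v w : Reg ι × Reg ι) : lam v w * lam v w = chi (omega v w) := by
  have h1 : (hp v * hp w) * (hp v * hp w) = chi (omega v w) • (1 : Op (Reg ι)) := by
    nth_rewrite 1 [hp_comm v w]
    rw [Matrix.smul_mul, show hp w * hp v * (hp v * hp w) = hp w * (hp v * hp v) * hp w by
      simp only [Matrix.mul_assoc], hp_mul_self, Matrix.mul_one, hp_mul_self]
  rw [hp_mul, Matrix.smul_mul, Matrix.mul_smul, smul_smul, hp_mul_self] at h1
  have := congrFun (congrFun h1 0) 0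
  simpa using this

@[simp] lemma lamLoc_zero (a' b' : ZMod 2) : lamLoc 0 0 a' b' = 1 := by
  simp [lamLoc, loc]

/-- Two signed Hermitian Paulis agree only if their signs and their vectors agree. -/
lemma sign_hp_injective {s s' : ZMod 2} {v v' : Reg ι × Reg ι}
    (h : chi s • hp v = chi s' • hp v') : s = s' ∧ v = v' := by
  simp only [hp_eq, smul_smul] at h
  -- The support of the two matrices determines the `X` parts, their entries the `Z` parts and
  -- the signs.
  have key : ∀ y x, chi s * hphase v * (if y = x + v.1 then chi (v.2 ⬝ᵥ x) else 0) =
      chi s' * hphase v' * (if y = x + v'.1 then chi (v'.2 ⬝ᵥ x) else 0) := by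
    intro y x
    have := congrFun (congrFun h y) x
    simpa [pauli_apply] using this
  have h1 : v.1 = v'.1 := by
    by_contra hne
    have := key (0 + v.1) 0
    rw [if_pos rfl, if_neg (fun h' => hne (by simpa using h'))] at this
    simp [chi_ne_zero, hphase_ne_zero] at this
  have key2 : ∀ x, chi s * hphase v * chi (v.2 ⬝ᵥ x) =
      chi s' * hphase v' * chi (v'.2 ⬝ᵥ x) := by
    intro x
    have := key (x + v.1) x
    rwa [if_pos rfl, if_pos (by rw [h1])] at this
  have h0 := key2 0
  simp only [dotProduct_zero, chi_zero, mul_one] at h0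
  have h2 : v.2 = v'.2 := by
    funext j
    have := key2 (Pi.single j 1)
    rw [h0] at this
    have := mul_left_cancel₀ (mul_ne_zero (chi_ne_zero _) (hphase_ne_zero _)) this
    simpa using chi_injective this
  have hv : v = v' := Prod.ext h1 h2
  refine ⟨chi_injective ?_, hv⟩
  rw [hv] at h0
  exact mul_right_cancel₀ (hphase_ne_zero _) h0

/-- The vector of a generator of the Pauli group. -/
def genVec : ι ⊕ ι → Reg ι × Reg ι
  | .inl j => (Pi.single j 1, 0)
  | .inr j => (0, Pi.single j 1)

lemma hp_genVec (g : ι ⊕ ι) : hp (genVec g) = pauliGen g := by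
  cases g <;> simp [hp_eq, genVec, pauliGen, hphase, loc]

lemma omega_inl (j : ι) (v : Reg ι × Reg ι) : omega (genVec (.inl j)) v = v.2 j := by
  simp [omega, genVec]

lemma omega_inr (j : ι) (v : Reg ι × Reg ι) : omega (genVec (.inr j)) v = v.1 j := by
  simp [omega, genVec]

end PauliAlgebra

section CliffordGroup

/-! ### The Clifford group modulo phases -/

variable {ι : Type} [Fintype ι] [DecidableEq ι]

/-- The sign of a row of a tableau. -/
def rowSign (t : Reg (TabIdx ι)) (g : ι ⊕ ι) : ZMod 2 := t (g, .inr (.inr ()))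

/-- The symplectic vector of a row of a tableau. -/
def rowVec (t : Reg (TabIdx ι)) (g : ι ⊕ ι) : Reg ι × Reg ι :=
  (fun j => t (g, .inl j), fun j => t (g, .inr (.inl j)))

lemma tab_ext {t t' : Reg (TabIdx ι)} (h : ∀ g, rowSign t g = rowSign t' g ∧
    rowVec t g = rowVec t' g) : t = t' := by
  funext ⟨g, q⟩
  obtain ⟨h1, h2⟩ := h g
  rcases q with j | j | j
  · exact congrFun (congrArg Prod.fst h2) j
  · exact congrFun (congrArg Prod.snd h2) j
  · exact h1

lemma describes_iff {t : Reg (TabIdx ι)} {U : Op (Reg ι)} :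
    Describes t U ↔ ∀ g, U * hp (genVec g) * Uᴴ = chi (rowSign t g) • hp (rowVec t g) := by
  simp only [hp_genVec]; rfl

lemma describes_unique {t t' : Reg (TabIdx ι)} {U : Op (Reg ι)} (h : Describes t U)
    (h' : Describes t' U) : t = t' := by
  rw [describes_iff] at h h'
  exact tab_ext fun g => sign_hp_injective ((h g).symm.trans (h' g))

lemma unitary_mul_star {U : Op (Reg ι)} (h : U ∈ Matrix.unitaryGroup (Reg ι) ℂ) : U * Uᴴ = 1 :=
  Matrix.mem_unitaryGroup_iff.1 h

lemma unitary_star_mul {U : Op (Reg ι)} (h : U ∈ Matrix.unitaryGroup (Reg ι) ℂ) : Uᴴ * U = 1 :=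
  Matrix.mem_unitaryGroup_iff'.1 h

lemma conj_mul {U : Op (Reg ι)} (h : U ∈ Matrix.unitaryGroup (Reg ι) ℂ) (A B : Op (Reg ι)) :
    (U * A * Uᴴ) * (U * B * Uᴴ) = U * (A * B) * Uᴴ := by
  calc (U * A * Uᴴ) * (U * B * Uᴴ) = U * A * (Uᴴ * U) * B * Uᴴ := by simp only [Matrix.mul_assoc]
    _ = _ := by rw [unitary_star_mul h, Matrix.mul_one]; simp only [Matrix.mul_assoc]

lemma conj_injective {U : Op (Reg ι)} (h : U ∈ Matrix.unitaryGroup (Reg ι) ℂ) {A B : Op (Reg ι)}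
    (hAB : U * A * Uᴴ = U * B * Uᴴ) : A = B := by
  have := congrArg (fun M => Uᴴ * M * U) hAB
  simpa only [← Matrix.mul_assoc, unitary_star_mul h, Matrix.one_mul,
    Matrix.mul_assoc _ Uᴴ U, Matrix.mul_one] using this

lemma sq_eq_one_chi {c : ℂ} (h : c * c = 1) : ∃ s, c = chi s := by
  rcases mul_self_eq_one_iff.1 h with rfl | rfl
  · exact ⟨0, by simp⟩
  · exact ⟨1, by simp⟩

/-- `U` maps the Hermitian Pauli of `v` to the one of `v'`, up to a sign. -/
def Sends (U : Op (Reg ι)) (v v' : Reg ι × Reg ι) : Prop :=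
  ∃ s : ZMod 2, U * hp v * Uᴴ = chi s • hp v'

/-- Clifford unitaries map Hermitian Paulis to Hermitian Paulis, up to a sign. -/
lemma isClifford_iff {U : Op (Reg ι)} :
    IsClifford U ↔ U ∈ Matrix.unitaryGroup (Reg ι) ℂ ∧ ∀ v, ∃ v', Sends U v v' := by
  refine and_congr_right fun hU => ⟨fun h v => ?_, fun h a b => ?_⟩
  · obtain ⟨a', b', φ, hφ⟩ := h v.1 v.2
    have h1 : U * hp v * Uᴴ = (hphase v * φ * (hphase (a', b'))⁻¹) • hp (a', b') := by
      rw [hp_eq v, hp_eq, Matrix.mul_smul, Matrix.smul_mul, hφ, smul_smul, smul_smul,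
        inv_mul_cancel_right₀ (hphase_ne_zero _)]
    have h2 := conj_mul hU (hp v) (hp v)
    rw [h1, hp_mul_self, Matrix.mul_one, unitary_mul_star hU, Matrix.smul_mul, Matrix.mul_smul,
      hp_mul_self, smul_smul] at h2
    have h3 := congrFun (congrFun h2 0) 0
    simp only [Matrix.smul_apply, Matrix.one_apply_eq, smul_eq_mul, mul_one] at h3
    obtain ⟨s, hs⟩ := sq_eq_one_chi h3
    exact ⟨(a', b'), s, by rw [h1, hs]⟩
  · obtain ⟨v', s, hs⟩ := h (a, b)
    refine ⟨v'.1, v'.2, (hphase (a, b))⁻¹ * (chi s * hphase v'), ?_⟩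
    rw [hp_eq, hp_eq, Matrix.mul_smul, Matrix.smul_mul, smul_smul] at hs
    rw [mul_smul, ← hs, smul_smul, inv_mul_cancel₀ (hphase_ne_zero _), one_smul]

lemma Sends.mul {U V : Op (Reg ι)} {v v' v'' : Reg ι × Reg ι} (hU : Sends U v' v'')
    (hV : Sends V v v') : Sends (U * V) v v'' := by
  obtain ⟨s, hs⟩ := hU
  obtain ⟨s', hs'⟩ := hV
  refine ⟨s' + s, ?_⟩
  rw [Matrix.conjTranspose_mul, show U * V * hp v * (Vᴴ * Uᴴ) = U * (V * hp v * Vᴴ) * Uᴴ by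
    simp only [Matrix.mul_assoc], hs', Matrix.mul_smul, Matrix.smul_mul, hs, smul_smul, chi_add]

/-- Conjugation preserves the symplectic form, because the form records which Paulis commute. -/
lemma Sends.omega_eq {U : Op (Reg ι)} (hU : U ∈ Matrix.unitaryGroup (Reg ι) ℂ)
    {v v' w w' : Reg ι × Reg ι} (hv : Sends U v v') (hw : Sends U w w') :
    omega v' w' = omega v w := by
  obtain ⟨s, hs⟩ := hv
  obtain ⟨t, ht⟩ := hw
  have h1 := conj_mul hU (hp v) (hp w)
  have h2 := conj_mul hU (hp w) (hp v)
  rw [hp_comm v w, Matrix.mul_smul, Matrix.smul_mul, ← h2, hs, ht] at h1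
  simp only [Matrix.smul_mul, Matrix.mul_smul, smul_smul] at h1
  rw [hp_comm v' w', smul_smul, hp_mul, smul_smul, smul_smul] at h1
  have h3 := smul_left_injective ℂ (hp_ne_zero (w' + v')) h1
  have hl : lam w' v' ≠ 0 := fun h => by
    have := lam_sq w' v'
    rw [h, zero_mul] at this
    exact chi_ne_zero _ this.symm
  have h4 := mul_right_cancel₀ hl h3
  refine chi_injective ?_
  have h5 : (chi s * chi t) * chi (omega v' w') = (chi s * chi t) * chi (omega v w) := by
    linear_combination h4
  exact mul_left_cancel₀ (mul_ne_zero (chi_ne_zero _) (chi_ne_zero _)) h5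

lemma IsClifford.mul {U V : Op (Reg ι)} (hU : IsClifford U) (hV : IsClifford V) :
    IsClifford (U * V) := by
  rw [isClifford_iff] at *
  refine ⟨mul_mem hU.1 hV.1, fun v => ?_⟩
  obtain ⟨v', h'⟩ := hV.2 v
  obtain ⟨v'', h''⟩ := hU.2 v'
  exact ⟨v'', h''.mul h'⟩

lemma conjTranspose_mem_unitary {U : Op (Reg ι)} (hU : U ∈ Matrix.unitaryGroup (Reg ι) ℂ) :
    Uᴴ ∈ Matrix.unitaryGroup (Reg ι) ℂ :=
  Matrix.mem_unitaryGroup_iff.2 (by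
    rw [Matrix.star_eq_conjTranspose, Matrix.conjTranspose_conjTranspose, unitary_star_mul hU])

lemma IsClifford.conjTranspose {U : Op (Reg ι)} (hU : IsClifford U) : IsClifford Uᴴ := by
  rw [isClifford_iff] at *
  obtain ⟨hu, h⟩ := hU
  choose f s hs using h
  -- The induced map on symplectic vectors is injective, hence surjective.
  have hinj : Function.Injective f := by
    intro v w hvw
    have h1 : U * (chi (s v) • hp v) * Uᴴ = U * (chi (s w) • hp w) * Uᴴ := by
      rw [Matrix.mul_smul, Matrix.smul_mul, hs, smul_smul, chi_mul_self, Matrix.mul_smul,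
        Matrix.smul_mul, hs, smul_smul, chi_mul_self, hvw]
    exact (sign_hp_injective (conj_injective hu h1)).2
  refine ⟨conjTranspose_mem_unitary hu, fun w => ?_⟩
  obtain ⟨v, rfl⟩ := (Finite.injective_iff_surjective.1 hinj) w
  refine ⟨v, s v, ?_⟩
  have h2 : hp (f v) = chi (s v) • (U * hp v * Uᴴ) := by
    rw [hs, smul_smul, chi_mul_self, one_smul]
  rw [Matrix.conjTranspose_conjTranspose, h2, Matrix.mul_smul, Matrix.smul_mul]
  congr 1
  calc Uᴴ * (U * hp v * Uᴴ) * U = (Uᴴ * U) * hp v * (Uᴴ * U) := by simp only [Matrix.mul_assoc]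
    _ = hp v := by rw [unitary_star_mul hu, Matrix.one_mul, Matrix.mul_one]

lemma isClifford_one : IsClifford (1 : Op (Reg ι)) :=
  isClifford_iff.2 ⟨one_mem _, fun v => ⟨v, 0, by simp⟩⟩

lemma isClifford_hp (v : Reg ι × Reg ι) : IsClifford (hp v) := by
  refine isClifford_iff.2 ⟨Matrix.mem_unitaryGroup_iff.2 ?_, fun w => ⟨w, omega v w, ?_⟩⟩
  · rw [Matrix.star_eq_conjTranspose, hp_conjTranspose, hp_mul_self]
  · rw [hp_conjTranspose, hp_comm v w, Matrix.smul_mul, Matrix.mul_assoc, hp_mul_self,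
      Matrix.mul_one]

lemma IsClifford.exists_describes {U : Op (Reg ι)} (hU : IsClifford U) : ∃ t, Describes t U := by
  choose f s hs using (isClifford_iff.1 hU).2
  refine ⟨fun p => match p with
    | (g, .inl j) => (f (genVec g)).1 j
    | (g, .inr (.inl j)) => (f (genVec g)).2 j
    | (g, .inr (.inr _)) => s (genVec g), describes_iff.2 fun g => hs (genVec g)⟩

lemma IsClifford.describes_description {U : Op (Reg ι)} (hU : IsClifford U) :
    Describes (description U) U := by
  rw [description, dif_pos hU.exists_describes]
  exact Classical.choose_spec hU.exists_describes

/-- An operator that commutes with the Pauli generators is a scalar. -/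
lemma scalar_of_commute {W : Op (Reg ι)} (h : ∀ g : ι ⊕ ι, W * hp (genVec g) = hp (genVec g) * W) :
    W = W 0 0 • (1 : Op (Reg ι)) := by
  -- Commuting with `Z_j` kills the entries with `y j ≠ x j`; commuting with `X_j` makes the
  -- diagonal invariant under a flip of the bit `j`.
  have hZ : ∀ j y x, W y x * chi (x j) = chi (y j) * W y x := by
    intro j y x
    have := congrFun (congrFun (h (.inr j)) y) x
    simpa [hp_genVec, pauliGen, Matrix.mul_apply, pauli_apply] using this
  have hX : ∀ j y x, W y (x + Pi.single j 1) = W (y + Pi.single j 1) x := by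
    intro j y x
    have := congrFun (congrFun (h (.inl j)) y) x
    simp only [hp_genVec, pauliGen, Matrix.mul_apply, pauli_apply, zero_dotProduct, chi_zero,
      mul_ite, mul_one, mul_zero, ite_mul, one_mul, zero_mul, Finset.sum_ite_eq',
      Finset.mem_univ, if_true] at this
    rw [this]
    simp only [reg_eq_add_iff (y := y), Finset.sum_ite_eq', Finset.mem_univ, if_true]
  have hoff : ∀ y x, y ≠ x → W y x = 0 := by
    intro y x hne
    obtain ⟨j, hj⟩ := Function.ne_iff.1 hne
    by_contra hW
    have := hZ j y x
    rw [mul_comm] at this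
    exact hj (chi_injective (mul_right_cancel₀ hW this).symm)
  have hdiag : ∀ (s : Finset ι) (x : Reg ι), W (∑ j ∈ s, Pi.single j (x j))
      (∑ j ∈ s, Pi.single j (x j)) = W 0 0 := by
    intro s x
    induction s using Finset.induction_on with
    | empty => simp
    | insert j s hj ih =>
      rw [Finset.sum_insert hj, ← ih]
      rcases zmod_two_cases (x j) with h0 | h0 <;> rw [h0]
      · simp
      · rw [add_comm, hX, reg_add_cancel]
  ext y x
  by_cases hyx : y = x
  · subst hyx
    have := hdiag Finset.univ y
    rw [Finset.univ_sum_single] at this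
    simp [this]
  · rw [hoff y x hyx, Matrix.smul_apply, Matrix.one_apply_ne hyx, smul_zero]

/-- A tableau determines a unitary up to a phase. -/
lemma describes_phase {t : Reg (TabIdx ι)} {U V : Op (Reg ι)}
    (hU : U ∈ Matrix.unitaryGroup (Reg ι) ℂ) (hV : V ∈ Matrix.unitaryGroup (Reg ι) ℂ)
    (htU : Describes t U) (htV : Describes t V) : ∃ φ : ℂ, φ * star φ = 1 ∧ U = φ • V := by
  rw [describes_iff] at htU htV
  -- By the assumption `V† U` commutes with the Pauli generators, so that it is a scalar.
  have hc : ∀ g : ι ⊕ ι, (Vᴴ * U) * hp (genVec g) = hp (genVec g) * (Vᴴ * U) := by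
    intro g
    have h1 : U * hp (genVec g) * Uᴴ = V * hp (genVec g) * Vᴴ := (htU g).trans (htV g).symm
    calc Vᴴ * U * hp (genVec g) = Vᴴ * (U * hp (genVec g) * Uᴴ) * U := by
          simp only [Matrix.mul_assoc, unitary_star_mul hU, Matrix.mul_one]
      _ = (Vᴴ * V) * hp (genVec g) * (Vᴴ * U) := by rw [h1]; simp only [Matrix.mul_assoc]
      _ = _ := by rw [unitary_star_mul hV, Matrix.one_mul]
  have h2 := scalar_of_commute hc
  set φ := (Vᴴ * U) 0 0
  have h3 : U = φ • V := by
    calc U = V * (Vᴴ * U) := by rw [← Matrix.mul_assoc, unitary_mul_star hV, Matrix.one_mul]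
      _ = φ • V := by rw [h2, Matrix.mul_smul, Matrix.mul_one]
  refine ⟨φ, ?_, h3⟩
  have h4 := unitary_mul_star hU
  rw [h3, Matrix.conjTranspose_smul, Matrix.smul_mul, Matrix.mul_smul, unitary_mul_star hV,
    smul_smul] at h4
  have := congrFun (congrFun h4 0) 0
  simpa using this

lemma describes_smul {t : Reg (TabIdx ι)} {V : Op (Reg ι)} {φ : ℂ} (hφ : φ * star φ = 1)
    (h : Describes t V) : Describes t (φ • V) := by
  rw [describes_iff] at *
  intro g
  rw [← h g, Matrix.conjTranspose_smul, Matrix.smul_mul, Matrix.smul_mul, Matrix.mul_smul,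
    smul_smul, hφ, one_smul]

lemma Clifford.isClifford (E : Clifford ι) : IsClifford E.unitary := (Classical.choose_spec E.2).1

lemma Clifford.describes (E : Clifford ι) : Describes E.1 E.unitary :=
  (Classical.choose_spec E.2).2

lemma Clifford.mem_unitary (E : Clifford ι) : E.unitary ∈ Matrix.unitaryGroup (Reg ι) ℂ :=
  E.isClifford.1

/-- The class of a Clifford unitary modulo phases. -/
def toClifford (U : Op (Reg ι)) (hU : IsClifford U) : Clifford ι :=
  ⟨description U, U, hU, hU.describes_description⟩

lemma toClifford_unitary_phase {U : Op (Reg ι)} (hU : IsClifford U) :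
    ∃ φ : ℂ, φ * star φ = 1 ∧ (toClifford U hU).unitary = φ • U :=
  describes_phase (Clifford.mem_unitary _) hU.1 (Clifford.describes _) hU.describes_description

lemma toClifford_eq_of_describes {U : Op (Reg ι)} (hU : IsClifford U) {E : Clifford ι}
    (h : Describes E.1 U) : toClifford U hU = E :=
  Subtype.ext (describes_unique hU.describes_description h)

@[simp] lemma toClifford_unitary (E : Clifford ι) : toClifford E.unitary E.isClifford = E :=
  toClifford_eq_of_describes _ E.describes

lemma toClifford_phase {U V : Op (Reg ι)} (hU : IsClifford U) (hV : IsClifford V) {φ : ℂ}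
    (hφ : φ * star φ = 1) (h : U = φ • V) : toClifford U hU = toClifford V hV :=
  toClifford_eq_of_describes hU (by rw [h]; exact describes_smul hφ hV.describes_description)

instance : Mul (Clifford ι) :=
  ⟨fun E F => toClifford (E.unitary * F.unitary) (E.isClifford.mul F.isClifford)⟩

instance : One (Clifford ι) := ⟨toClifford 1 isClifford_one⟩

instance : Inv (Clifford ι) := ⟨fun E => toClifford E.unitaryᴴ E.isClifford.conjTranspose⟩

lemma toClifford_mul {U V : Op (Reg ι)} (hU : IsClifford U) (hV : IsClifford V) :
    toClifford (U * V) (hU.mul hV) = toClifford U hU * toClifford V hV := by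
  obtain ⟨φ, hφ, h1⟩ := toClifford_unitary_phase hU
  obtain ⟨ψ, hψ, h2⟩ := toClifford_unitary_phase hV
  symm
  refine toClifford_phase _ _ (φ := φ * ψ) ?_ ?_
  · rw [star_mul']; linear_combination ψ * star ψ * hφ + hψ
  · rw [h1, h2, Matrix.smul_mul, Matrix.mul_smul, smul_smul]

lemma toClifford_conjTranspose {U : Op (Reg ι)} (hU : IsClifford U) :
    toClifford Uᴴ hU.conjTranspose = (toClifford U hU)⁻¹ := by
  obtain ⟨φ, hφ, h1⟩ := toClifford_unitary_phase hU
  symm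
  refine toClifford_phase _ _ (φ := star φ) ?_ ?_
  · rw [star_star, mul_comm, hφ]
  · rw [h1, Matrix.conjTranspose_smul]

/-- The Clifford group modulo phases. -/
instance : Group (Clifford ι) :=
  Group.ofLeftAxioms
    (fun E F G => by
      rw [← toClifford_unitary E, ← toClifford_unitary F, ← toClifford_unitary G]
      simp only [← toClifford_mul, Matrix.mul_assoc])
    (fun E => by
      rw [← toClifford_unitary E]
      change toClifford 1 isClifford_one * _ = _
      simp only [← toClifford_mul, Matrix.one_mul])
    (fun E => by
      rw [← toClifford_unitary E, ← toClifford_conjTranspose, ← toClifford_mul]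
      change _ = toClifford 1 isClifford_one
      simp only [unitary_star_mul E.mem_unitary])

lemma toClifford_one : toClifford (1 : Op (Reg ι)) isClifford_one = 1 := rfl

end CliffordGroup

section Rotations

/-! ### Pauli rotations generate the Clifford group -/

variable {ι : Type} [Fintype ι] [DecidableEq ι]

/-- The Pauli rotation `exp(± i π/4 P)` for the Hermitian Pauli `P` of `u`. It acts on symplectic
vectors as the transvection along `u`. -/
def rot (u : Reg ι × Reg ι) (ε : ZMod 2) : Op (Reg ι) :=
  ((Real.sqrt 2 : ℂ)⁻¹) • (1 + (Complex.I * chi ε) • hp u)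

lemma inv_sqrt_two_sq : ((Real.sqrt 2 : ℂ)⁻¹) * ((Real.sqrt 2 : ℂ)⁻¹) = 1 / 2 := by
  rw [← mul_inv, ← Complex.ofReal_mul, Real.mul_self_sqrt (by norm_num)]; norm_num

lemma star_inv_sqrt_two : star ((Real.sqrt 2 : ℂ)⁻¹) = (Real.sqrt 2 : ℂ)⁻¹ := by
  rw [star_inv₀, Complex.star_def, Complex.conj_ofReal]

lemma rot_conjTranspose (u : Reg ι × Reg ι) (ε : ZMod 2) : (rot u ε)ᴴ = rot u (ε + 1) := by
  rw [rot, rot, Matrix.conjTranspose_smul, star_inv_sqrt_two, Matrix.conjTranspose_add,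
    Matrix.conjTranspose_one, Matrix.conjTranspose_smul, hp_conjTranspose, chi_add, chi_one]
  congr 3
  rw [star_mul', star_chi, Complex.star_def, Complex.conj_I]; ring

lemma rot_mul_rot (u : Reg ι × Reg ι) (ε δ : ZMod 2) : rot u ε * rot u δ =
    ((1 : ℂ) / 2) • ((1 - chi ε * chi δ) • 1 + (Complex.I * (chi ε + chi δ)) • hp u) := by
  rw [rot, rot, Matrix.smul_mul, Matrix.mul_smul, smul_smul, inv_sqrt_two_sq]
  congr 1
  rw [Matrix.add_mul, Matrix.mul_add, Matrix.mul_add, Matrix.one_mul, Matrix.one_mul,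
    Matrix.mul_one, Matrix.smul_mul, Matrix.mul_smul, hp_mul_self, smul_smul]
  have : Complex.I * chi ε * (Complex.I * chi δ) = - (chi ε * chi δ) := by
    linear_combination (chi ε * chi δ) * Complex.I_mul_I
  rw [this, sub_smul, mul_add, add_smul, neg_smul, one_smul]
  abel

lemma rot_mem_unitary (u : Reg ι × Reg ι) (ε : ZMod 2) :
    rot u ε ∈ Matrix.unitaryGroup (Reg ι) ℂ := by
  refine Matrix.mem_unitaryGroup_iff.2 ?_
  rw [Matrix.star_eq_conjTranspose, rot_conjTranspose, rot_mul_rot, chi_add, chi_one,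
    show chi ε + chi ε * -1 = 0 by ring, mul_zero, zero_smul, add_zero, smul_smul,
    show (1 : ℂ) / 2 * (1 - chi ε * (chi ε * -1)) = 1 by
      linear_combination (1 / 2 : ℂ) * chi_mul_self ε, one_smul]

lemma rot_sq (u : Reg ι × Reg ι) (ε : ZMod 2) :
    rot u ε * rot u ε = (Complex.I * chi ε) • hp u := by
  rw [rot_mul_rot, chi_mul_self, sub_self, zero_smul, zero_add, smul_smul]
  congr 1; ring

lemma rot_conj_of_omega_zero {u v : Reg ι × Reg ι} (ε : ZMod 2) (h : omega u v = 0) :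
    rot u ε * hp v * (rot u ε)ᴴ = hp v := by
  have hc : rot u ε * hp v = hp v * rot u ε := by
    have := hp_comm u v
    rw [h, chi_zero, one_smul] at this
    simp only [rot, Matrix.smul_mul, Matrix.mul_smul, Matrix.add_mul, Matrix.mul_add,
      Matrix.one_mul, Matrix.mul_one, this]
  rw [hc, Matrix.mul_assoc, unitary_mul_star (rot_mem_unitary u ε), Matrix.mul_one]

/-- The sign that a rotation produces on an anticommuting Pauli. -/
def rotSign (u : Reg ι × Reg ι) (ε : ZMod 2) (v : Reg ι × Reg ι) : ZMod 2 :=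
  if Complex.I * chi ε * lam u v = 1 then 0 else 1

lemma chi_rotSign {u v : Reg ι × Reg ι} (ε : ZMod 2) (h : omega u v = 1) :
    chi (rotSign u ε v) = Complex.I * chi ε * lam u v := by
  have h1 : (Complex.I * chi ε * lam u v) * (Complex.I * chi ε * lam u v) = 1 := by
    have h2 := lam_sq u v
    rw [h, chi_one] at h2
    calc _ = (Complex.I * Complex.I) * (chi ε * chi ε) * (lam u v * lam u v) := by ring
      _ = 1 := by rw [h2, chi_mul_self, Complex.I_mul_I]; ring
  rcases mul_self_eq_one_iff.1 h1 with h3 | h3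
  · rw [rotSign, if_pos h3, h3, chi_zero]
  · rw [rotSign, if_neg (by rw [h3]; norm_num), h3, chi_one]

lemma rot_conj_of_omega_one {u v : Reg ι × Reg ι} (ε : ZMod 2) (h : omega u v = 1) :
    rot u ε * hp v * (rot u ε)ᴴ = chi (rotSign u ε v) • hp (u + v) := by
  have hc : hp v * (rot u ε)ᴴ = rot u ε * hp v := by
    have := hp_comm u v
    rw [h, chi_one] at this
    rw [rot_conjTranspose]
    simp only [rot, Matrix.smul_mul, Matrix.mul_smul, Matrix.add_mul, Matrix.mul_add,
      Matrix.one_mul, Matrix.mul_one, this, chi_add, chi_one, smul_smul]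
    congr 3; ring
  rw [Matrix.mul_assoc, hc, ← Matrix.mul_assoc, rot_sq, Matrix.smul_mul, hp_mul, smul_smul,
    chi_rotSign ε h]

lemma sends_rot_zero {u v : Reg ι × Reg ι} (ε : ZMod 2) (h : omega u v = 0) :
    Sends (rot u ε) v v := ⟨0, by rw [rot_conj_of_omega_zero ε h, chi_zero, one_smul]⟩

lemma sends_rot_one {u v : Reg ι × Reg ι} (ε : ZMod 2) (h : omega u v = 1) :
    Sends (rot u ε) v (u + v) := ⟨_, rot_conj_of_omega_one ε h⟩

lemma isClifford_rot (u : Reg ι × Reg ι) (ε : ZMod 2) : IsClifford (rot u ε) := by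
  refine isClifford_iff.2 ⟨rot_mem_unitary u ε, fun v => ?_⟩
  rcases zmod_two_cases (omega u v) with h | h
  · exact ⟨v, sends_rot_zero ε h⟩
  · exact ⟨u + v, sends_rot_one ε h⟩

/-- A Pauli rotation as an element of the Clifford group. -/
def rotC (u : Reg ι × Reg ι) (ε : ZMod 2) : Clifford ι := toClifford (rot u ε) (isClifford_rot u ε)

lemma toClifford_congr {U V : Op (Reg ι)} (hU : IsClifford U) (hV : IsClifford V) (h : U = V) :
    toClifford U hU = toClifford V hV := by subst h; rfl

lemma rotC_inv (u : Reg ι × Reg ι) (ε : ZMod 2) : (rotC u ε)⁻¹ = rotC u (ε + 1) := by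
  rw [rotC, ← toClifford_conjTranspose]
  exact toClifford_congr _ _ (rot_conjTranspose u ε)

/-- Conjugating a rotation by an anticommuting one gives the rotation about the product. -/
lemma rotC_add {u v : Reg ι × Reg ι} (ε : ZMod 2) (h : omega u v = 1) :
    rotC (u + v) ε = rotC u 0 * rotC v (ε + rotSign u 0 v) * (rotC u 0)⁻¹ := by
  have key : rot (u + v) ε = rot u 0 * rot v (ε + rotSign u 0 v) * (rot u 0)ᴴ := by
    conv_rhs => rw [rot.eq_def v]
    rw [Matrix.mul_smul, Matrix.smul_mul, Matrix.mul_add, Matrix.add_mul, Matrix.mul_one,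
      unitary_mul_star (rot_mem_unitary u 0), Matrix.mul_smul, Matrix.smul_mul,
      rot_conj_of_omega_one 0 h, smul_smul, chi_add, mul_assoc, mul_assoc, chi_mul_self, mul_one]
    rfl
  rw [rotC, rotC, rotC, ← toClifford_conjTranspose, ← toClifford_mul, ← toClifford_mul]
  exact toClifford_congr _ _ key

/-- The qubits on which the Pauli operator of `u` acts nontrivially. -/
def supp (u : Reg ι × Reg ι) : Finset ι := Finset.univ.filter fun j => u.1 j ≠ 0 ∨ u.2 j ≠ 0

lemma mem_supp {u : Reg ι × Reg ι} {j : ι} : j ∈ supp u ↔ u.1 j ≠ 0 ∨ u.2 j ≠ 0 := by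
  simp [supp]

/-- Rotations about Paulis on at most two qubits: these are the elementary gates from which random
Cliffords are assembled. -/
abbrev LocalRot (ι : Type) [Fintype ι] [DecidableEq ι] : Type :=
  {p : (Reg ι × Reg ι) × ZMod 2 // (supp p.1).card ≤ 2}

/-- `g` is a product of at most `L` rotations about Paulis on at most two qubits. -/
def IsWord (L : ℕ) (g : Clifford ι) : Prop :=
  ∃ l : List (LocalRot ι), l.length ≤ L ∧ (l.map fun p => rotC p.1.1 p.1.2).prod = g

lemma IsWord.mono {L L' : ℕ} {g : Clifford ι} (h : IsWord L g) (hL : L ≤ L') : IsWord L' g := by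
  obtain ⟨l, h1, h2⟩ := h
  exact ⟨l, h1.trans hL, h2⟩

lemma isWord_one : IsWord 0 (1 : Clifford ι) := ⟨[], by simp, by simp⟩

lemma IsWord.mul {L L' : ℕ} {g g' : Clifford ι} (h : IsWord L g) (h' : IsWord L' g') :
    IsWord (L + L') (g * g') := by
  obtain ⟨l, h1, h2⟩ := h
  obtain ⟨l', h1', h2'⟩ := h'
  exact ⟨l ++ l', by simp; omega, by simp [h2, h2']⟩

lemma isWord_local {u : Reg ι × Reg ι} (hu : (supp u).card ≤ 2) (ε : ZMod 2) :
    IsWord 1 (rotC u ε) := ⟨[⟨(u, ε), hu⟩], by simp, by simp⟩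

lemma IsWord.inv {L : ℕ} {g : Clifford ι} (h : IsWord L g) : IsWord L g⁻¹ := by
  obtain ⟨l, h1, rfl⟩ := h
  refine ⟨(l.map fun p => ⟨(p.1.1, p.1.2 + 1), p.2⟩).reverse, by simpa using h1, ?_⟩
  rw [List.prod_inv_reverse, List.map_reverse, List.map_map, List.map_map]
  congr 2
  exact List.map_congr_left fun p _ => (rotC_inv _ _).symm

/-- The symplectic vector with the component `p` at the qubit `j`. -/
def sing (j : ι) (p : ZMod 2 × ZMod 2) : Reg ι × Reg ι := (Pi.single j p.1, Pi.single j p.2)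

lemma omega_sing (j : ι) (p : ZMod 2 × ZMod 2) (v : Reg ι × Reg ι) :
    omega (sing j p) v = p.1 * v.2 j + p.2 * v.1 j := by
  simp [omega, sing]

lemma exists_anticommuting {j : ι} {v : Reg ι × Reg ι} (h : j ∈ supp v) :
    ∃ p, omega (sing j p) v = 1 := by
  rcases mem_supp.1 h with h | h
  · refine ⟨(0, 1), ?_⟩
    rcases zmod_two_cases (v.1 j) with h' | h'
    · exact absurd h' h
    · rw [omega_sing, h']; simp
  · refine ⟨(1, 0), ?_⟩
    rcases zmod_two_cases (v.2 j) with h' | h'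
    · exact absurd h' h
    · rw [omega_sing, h']; simp

lemma vec_add_self (u : Reg ι × Reg ι) : u + u = 0 :=
  Prod.ext (reg_add_self _) (reg_add_self _)

lemma vec_add_cancel (u v : Reg ι × Reg ι) : u + v + v = u := by
  rw [add_assoc, vec_add_self, add_zero]

/-- Rotations about arbitrary Paulis are short words in local ones: one qubit of the support is
removed by conjugating with a two-qubit rotation. -/
lemma isWord_rotC (v : Reg ι × Reg ι) (ε : ZMod 2) : IsWord (2 * (supp v).card + 1) (rotC v ε) := by
  induction hk : (supp v).card using Nat.strong_induction_on generalizing v ε with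
  | _ k ih =>
    by_cases h2 : k ≤ 2
    · exact (isWord_local (hk ▸ h2) ε).mono (by omega)
    obtain ⟨q, hq, q', hq', hne⟩ := Finset.one_lt_card.1 (show 1 < (supp v).card by omega)
    obtain ⟨p, hp⟩ := exists_anticommuting hq'
    -- The vector `u` has the component of `v` at `q`, so that `u + v` vanishes there; its
    -- component at `q'` makes it anticommute with `v`.
    set u := sing q (v.1 q, v.2 q) + sing q' p with hu
    have huv : omega u v = 1 := by
      rw [hu, omega_add_left, hp, omega_sing, mul_comm, zmod_two_add_self, zero_add]
    have husupp : (supp u).card ≤ 2 := by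
      refine (Finset.card_le_card (t := {q, q'}) fun j hj => ?_).trans Finset.card_le_two
      by_contra hj'
      simp only [Finset.mem_insert, Finset.mem_singleton, not_or] at hj'
      have h1 := mem_supp.1 hj
      simp [hu, sing, hj'.1, hj'.2] at h1
    have hlt : (supp (u + v)).card < k := by
      rw [← hk]
      refine Finset.card_lt_card ⟨fun j hj => ?_, fun hsub => ?_⟩
      · by_contra hj'
        have hjq : j ≠ q := fun h => hj' (h ▸ hq)
        have hjq' : j ≠ q' := fun h => hj' (h ▸ hq')
        have h1 := mem_supp.1 hj
        have h2 := mt mem_supp.2 hj'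
        simp only [not_or, not_not] at h2
        simp [hu, sing, hjq, hjq', h2.1, h2.2] at h1
      · have h1 := mem_supp.1 (hsub hq)
        simp [hu, sing, hne, zmod_two_add_self] at h1
    have huv' : omega u (u + v) = 1 := by rw [omega_add_right, omega_self, zero_add, huv]
    have hv : v = u + (u + v) := by rw [← add_assoc, vec_add_self, zero_add]
    rw [hv, rotC_add ε huv']
    refine (((isWord_local husupp 0).mul (ih _ hlt (u + v) _ rfl)).mul
      (isWord_local husupp 0).inv).mono ?_
    omega

lemma isWord_rotC' (v : Reg ι × Reg ι) (ε : ZMod 2) :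
    IsWord (2 * Fintype.card ι + 1) (rotC v ε) :=
  (isWord_rotC v ε).mono (by have := Finset.card_le_univ (supp v); omega)

/-- The action of a Clifford group element on symplectic vectors. -/
def CSends (E : Clifford ι) (v v' : Reg ι × Reg ι) : Prop := Sends E.unitary v v'

lemma Sends.smul {U : Op (Reg ι)} {v v' : Reg ι × Reg ι} {φ : ℂ} (hφ : φ * star φ = 1)
    (h : Sends U v v') : Sends (φ • U) v v' := by
  obtain ⟨s, hs⟩ := h
  refine ⟨s, ?_⟩
  rw [Matrix.conjTranspose_smul, Matrix.smul_mul, Matrix.smul_mul, Matrix.mul_smul, smul_smul, hφ,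
    one_smul, hs]

lemma CSends.of_sends {U : Op (Reg ι)} (hU : IsClifford U) {v v' : Reg ι × Reg ι}
    (h : Sends U v v') : CSends (toClifford U hU) v v' := by
  obtain ⟨φ, hφ, h1⟩ := toClifford_unitary_phase hU
  rw [CSends, h1]
  exact h.smul hφ

lemma CSends.mul {E F : Clifford ι} {v v' v'' : Reg ι × Reg ι} (hE : CSends E v' v'')
    (hF : CSends F v v') : CSends (E * F) v v'' :=
  CSends.of_sends _ (Sends.mul hE hF)

lemma csends_one (v : Reg ι × Reg ι) : CSends (1 : Clifford ι) v v :=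
  CSends.of_sends _ ⟨0, by simp⟩

lemma csends_rotC_zero {u v : Reg ι × Reg ι} (h : omega u v = 0) : CSends (rotC u 0) v v :=
  CSends.of_sends _ (sends_rot_zero 0 h)

lemma csends_rotC_one {u v w : Reg ι × Reg ι} (h : omega u v = 1) (hw : u + v = w) :
    CSends (rotC u 0) v w :=
  hw ▸ CSends.of_sends _ (sends_rot_one 0 h)

/-- `E` fixes the Pauli generators of the qubits in `s`, up to signs. -/
def FixesGens (s : Finset ι) (E : Clifford ι) : Prop :=
  ∀ i ∈ s, CSends E (genVec (.inl i)) (genVec (.inl i)) ∧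
    CSends E (genVec (.inr i)) (genVec (.inr i))

/-- `u` vanishes on the qubits in `s`. -/
def Off (s : Finset ι) (u : Reg ι × Reg ι) : Prop := ∀ i ∈ s, u.1 i = 0 ∧ u.2 i = 0

lemma Off.add {s : Finset ι} {u v : Reg ι × Reg ι} (hu : Off s u) (hv : Off s v) :
    Off s (u + v) := fun i hi => by simp [hu i hi, hv i hi]

lemma off_sing {s : Finset ι} {j : ι} (hj : j ∉ s) (p : ZMod 2 × ZMod 2) : Off s (sing j p) := by
  intro i hi
  have : i ≠ j := fun h => hj (h ▸ hi)
  simp [sing, this]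

lemma genVec_inl (j : ι) : genVec (.inl j) = sing j (1, 0) := by simp [genVec, sing]

lemma genVec_inr (j : ι) : genVec (.inr j) = sing j (0, 1) := by simp [genVec, sing]

lemma FixesGens.mul {s : Finset ι} {E F : Clifford ι} (hE : FixesGens s E) (hF : FixesGens s F) :
    FixesGens s (E * F) := fun i hi =>
  ⟨(hE i hi).1.mul (hF i hi).1, (hE i hi).2.mul (hF i hi).2⟩

lemma fixesGens_one (s : Finset ι) : FixesGens s (1 : Clifford ι) := fun _ _ =>
  ⟨csends_one _, csends_one _⟩

lemma fixesGens_rotC {s : Finset ι} {u : Reg ι × Reg ι} (hu : Off s u) :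
    FixesGens s (rotC u 0) := fun i hi =>
  ⟨csends_rotC_zero (by rw [omega_comm, omega_inl, (hu i hi).2]),
    csends_rotC_zero (by rw [omega_comm, omega_inr, (hu i hi).1])⟩

/-- Two transvections suffice to move a nonzero vector to `X_j`. -/
lemma exists_word_to_X {s : Finset ι} {j : ι} (hj : j ∉ s) {x : Reg ι × Reg ι} (hx : Off s x)
    (hx0 : x ≠ 0) : ∃ T : Clifford ι, IsWord (2 * (2 * Fintype.card ι + 1)) T ∧ FixesGens s T ∧
      CSends T x (genVec (.inl j)) := by
  have hX : Off s (genVec (.inl j)) := genVec_inl j ▸ off_sing hj _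
  rcases zmod_two_cases (omega x (genVec (.inl j))) with h0 | h1
  · by_cases hxX : x = genVec (.inl j)
    · exact ⟨1, isWord_one.mono (by omega), fixesGens_one s, hxX ▸ csends_one _⟩
    -- A vector that anticommutes with both `x` and `X_j` serves as an intermediate step.
    obtain ⟨u, hu, hux, huX⟩ : ∃ u, Off s u ∧ omega u x = 1 ∧ omega u (genVec (.inl j)) = 1 := by
      have hx2 : x.2 j = 0 := by rwa [omega_comm, omega_inl] at h0
      rcases zmod_two_cases (x.1 j) with hx1 | hx1
      · obtain ⟨k, hk⟩ : ∃ k, k ∈ supp x := by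
          by_contra hcon
          push Not at hcon
          refine hx0 (Prod.ext (funext fun k => ?_) (funext fun k => ?_))
          · have := mt mem_supp.2 (hcon k); simp only [not_or, not_not] at this; exact this.1
          · have := mt mem_supp.2 (hcon k); simp only [not_or, not_not] at this; exact this.2
        have hkj : j ≠ k := by
          rintro rfl
          rcases mem_supp.1 hk with h | h
          · exact h hx1
          · exact h hx2
        have hks : k ∉ s := fun h => by
          rcases mem_supp.1 hk with h' | h'
          · exact h' (hx k h).1
          · exact h' (hx k h).2
        obtain ⟨p, hp⟩ := exists_anticommuting hk
        refine ⟨sing j (0, 1) + sing k p, (off_sing hj _).add (off_sing hks _), ?_, ?_⟩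
        · rw [omega_add_left, hp, omega_sing, hx1, hx2]; simp
        · rw [omega_add_left, genVec_inl, omega_sing, omega_sing]; simp [sing, hkj.symm]
      · exact ⟨sing j (0, 1), off_sing hj _, by rw [omega_sing, hx1, hx2]; simp,
          by rw [genVec_inl, omega_sing]; simp [sing]⟩
    refine ⟨rotC (u + genVec (.inl j)) 0 * rotC (x + u) 0, ?_,
      (fixesGens_rotC (hu.add hX)).mul (fixesGens_rotC (hx.add hu)),
      CSends.mul (v' := u) (csends_rotC_one ?_ ?_) (csends_rotC_one ?_ ?_)⟩
    · exact ((isWord_rotC' _ _).mul (isWord_rotC' _ _)).mono (by omega)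
    · rw [omega_add_left, omega_self, zero_add, omega_comm, huX]
    · rw [add_comm u, vec_add_cancel]
    · rw [omega_add_left, omega_self, zero_add, hux]
    · rw [add_comm x, vec_add_cancel]
  · refine ⟨rotC (x + genVec (.inl j)) 0, (isWord_rotC' _ _).mono (by omega),
      fixesGens_rotC (hx.add hX), csends_rotC_one ?_ ?_⟩
    · rw [omega_add_left, omega_self, zero_add, omega_comm, h1]
    · rw [add_comm x, vec_add_cancel]

/-- Two transvections that fix `X_j` suffice to move a partner of `X_j` to `Z_j`. -/
lemma exists_word_to_Z {s : Finset ι} {j : ι} (hj : j ∉ s) {z : Reg ι × Reg ι} (hz : Off s z)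
    (hXz : omega (genVec (.inl j)) z = 1) :
    ∃ T : Clifford ι, IsWord (2 * (2 * Fintype.card ι + 1)) T ∧ FixesGens s T ∧
      CSends T (genVec (.inl j)) (genVec (.inl j)) ∧ CSends T z (genVec (.inr j)) := by
  have hX : Off s (genVec (.inl j)) := genVec_inl j ▸ off_sing hj _
  have hZ : Off s (genVec (.inr j)) := genVec_inr j ▸ off_sing hj _
  have hXZ : omega (genVec (.inl j)) (genVec (.inr j)) = 1 := by
    rw [omega_inl]; simp [genVec]
  set X : Reg ι × Reg ι := genVec (.inl j)
  set Z : Reg ι × Reg ι := genVec (.inr j)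
  rcases zmod_two_cases (omega z Z) with h0 | h1
  -- The intermediate step is `z + X_j`, which anticommutes with `Z_j`.
  · refine ⟨rotC (z + X + Z) 0 * rotC X 0, ?_,
      (fixesGens_rotC ((hz.add hX).add hZ)).mul (fixesGens_rotC hX),
      (csends_rotC_zero ?_).mul (csends_rotC_zero (omega_self X)),
      CSends.mul (v' := z + X) (csends_rotC_one ?_ ?_) (csends_rotC_one hXz (add_comm _ _))⟩
    · exact ((isWord_rotC' _ _).mul (isWord_rotC' _ _)).mono (by omega)
    · rw [omega_add_left, omega_add_left, omega_self, omega_comm z, hXz, omega_comm Z, hXZ]; rfl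
    · rw [omega_add_left, omega_self, zero_add, omega_add_right, omega_comm Z z, h0,
        omega_comm Z, hXZ]; rfl
    · rw [add_comm (z + X) Z, vec_add_cancel]
  · refine ⟨rotC (z + Z) 0, (isWord_rotC' _ _).mono (by omega), fixesGens_rotC (hz.add hZ),
      csends_rotC_zero ?_, csends_rotC_one ?_ ?_⟩
    · rw [omega_add_left, omega_comm z, hXz, omega_comm Z, hXZ]; rfl
    · rw [omega_add_left, omega_self, zero_add, omega_comm, h1]
    · rw [add_comm z, vec_add_cancel]

lemma CSends.omega_eq {E : Clifford ι} {v v' w w' : Reg ι × Reg ι} (hv : CSends E v v')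
    (hw : CSends E w w') : omega v' w' = omega v w := Sends.omega_eq E.mem_unitary hv hw

/-- Symplectic Gram–Schmidt: one qubit after the other, short words move the images of its
generators back to these generators, and keep the generators that are already fixed. -/
lemma exists_word_fixesGens (s : Finset ι) (E : Clifford ι) : ∃ T : Clifford ι,
    IsWord (4 * (2 * Fintype.card ι + 1) * s.card) T ∧ FixesGens s (T * E) := by
  induction s using Finset.induction_on with
  | empty => exact ⟨1, isWord_one.mono (by omega), fun i hi => absurd hi (by simp)⟩
  | insert j s hj ih =>
    obtain ⟨T, hT, hTE⟩ := ih
    have hsend := (isClifford_iff.1 (T * E).isClifford).2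
    obtain ⟨x, hx⟩ := hsend (genVec (.inl j))
    obtain ⟨z, hz⟩ := hsend (genVec (.inr j))
    change CSends (T * E) _ _ at hx hz
    have hxz : omega x z = 1 := by
      rw [hx.omega_eq hz, omega_inl]; simp [genVec]
    have hij : ∀ i ∈ s, i ≠ j := fun i hi h => hj (h ▸ hi)
    -- The images are orthogonal to the generators of `s`, which are fixed, hence they vanish on
    -- `s`.
    have hxoff : Off s x := fun i hi => by
      constructor
      · rw [← omega_inr, (hTE i hi).2.omega_eq hx, omega_inr]; simp [genVec, hij i hi]
      · rw [← omega_inl, (hTE i hi).1.omega_eq hx, omega_inl]; simp [genVec]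
    have hzoff : Off s z := fun i hi => by
      constructor
      · rw [← omega_inr, (hTE i hi).2.omega_eq hz, omega_inr]; simp [genVec]
      · rw [← omega_inl, (hTE i hi).1.omega_eq hz, omega_inl]; simp [genVec, hij i hi]
    have hx0 : x ≠ 0 := fun h => by rw [h, omega_zero_left] at hxz; exact zero_ne_one hxz
    obtain ⟨T1, hT1, hT1s, hT1x⟩ := exists_word_to_X hj hxoff hx0
    obtain ⟨z', hz'⟩ := (isClifford_iff.1 T1.isClifford).2 z
    change CSends T1 _ _ at hz'
    have hz'off : Off s z' := fun i hi => by
      constructor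
      · rw [← omega_inr, (hT1s i hi).2.omega_eq hz', omega_inr, (hzoff i hi).1]
      · rw [← omega_inl, (hT1s i hi).1.omega_eq hz', omega_inl, (hzoff i hi).2]
    obtain ⟨T2, hT2, hT2s, hT2x, hT2z⟩ := exists_word_to_Z hj hz'off
      (by rw [hT1x.omega_eq hz', hxz])
    refine ⟨T2 * T1 * T, ((hT2.mul hT1).mul hT).mono ?_, ?_⟩
    · rw [Finset.card_insert_of_notMem hj]; ring_nf; omega
    · rw [mul_assoc, mul_assoc, ← mul_assoc T1]
      intro i hi
      rw [mul_assoc T1]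
      rcases Finset.mem_insert.1 hi with rfl | hi
      · exact ⟨hT2x.mul (hT1x.mul hx), hT2z.mul (hz'.mul hz)⟩
      · exact (hT2s.mul (hT1s.mul hTE)) i hi

/-- Every Clifford group element is a product of polynomially many local Pauli rotations. -/
theorem isWord_clifford (E : Clifford ι) :
    IsWord ((4 * Fintype.card ι + 2) * (2 * Fintype.card ι + 1)) E := by
  obtain ⟨T, hT, hTE⟩ := exists_word_fixesGens Finset.univ E
  choose s hs using fun i => (hTE i (Finset.mem_univ i)).1
  choose t ht using fun i => (hTE i (Finset.mem_univ i)).2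
  -- What remains fixes all generators up to signs; it is the Pauli that produces these signs.
  have hP : T * E = toClifford (hp (t, s)) (isClifford_hp _) := by
    symm
    refine toClifford_eq_of_describes _ (describes_iff.2 fun g => ?_)
    rw [← describes_iff.1 (T * E).describes g, hp_conjTranspose, hp_comm, Matrix.smul_mul,
      Matrix.mul_assoc, hp_mul_self, Matrix.mul_one]
    cases g with
    | inl j => rw [hs, omega_comm, omega_inl]
    | inr j => rw [ht, omega_comm, omega_inr]
  have hw : IsWord (2 * (2 * Fintype.card ι + 1)) (T * E) := by
    -- A Pauli is, up to a phase, the square of a rotation.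
    have h1 : rotC (t, s) 0 * rotC (t, s) 0 = T * E := by
      rw [hP, rotC, ← toClifford_mul]
      refine toClifford_phase _ _ (φ := Complex.I) (by simp) ?_
      rw [rot_sq, chi_zero, mul_one]
    rw [← h1]
    exact ((isWord_rotC' _ _).mul (isWord_rotC' _ _)).mono (by omega)
  have h2 : E = T⁻¹ * (T * E) := by group
  rw [h2]
  refine (hT.inv.mul hw).mono ?_
  rw [Finset.card_univ]; ring_nf; omega

end Rotations

section RandomSubproducts

/-! ### Random subproducts -/

variable {G : Type} [Group G] [Fintype G]

/-- The subproduct of `g` that is selected by the bits `β`. -/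
def subprod {m : ℕ} (g : Fin m → G) (β : Reg (Fin m)) : G :=
  (List.ofFn fun k => if β k = 1 then g k else 1).prod

open Classical in
/-- The deviation of the distribution of a random subproduct from the uniform distribution. -/
def deviation {m : ℕ} (g : Fin m → G) (F : G) : ℝ :=
  (∑ β : Reg (Fin m), if subprod g β = F then (1 : ℝ) else 0) / 2 ^ m - 1 / Fintype.card G

lemma subprod_cons {m : ℕ} (g₀ : G) (g : Fin m → G) (b : ZMod 2) (β : Reg (Fin m)) :
    subprod (Fin.cons g₀ g : Fin (m + 1) → G) (Fin.cons b β : Fin (m + 1) → ZMod 2) =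
      (if b = 1 then g₀ else 1) * subprod g β := by
  simp [subprod, List.ofFn_succ]

lemma sum_reg_succ {M : Type} [AddCommMonoid M] {m : ℕ} (f : Reg (Fin (m + 1)) → M) :
    ∑ β, f β = ∑ b : ZMod 2, ∑ β : Reg (Fin m), f (Fin.cons b β : Fin (m + 1) → ZMod 2) := by
  rw [← Fintype.sum_prod_type']
  exact (Fintype.sum_equiv (Fin.consEquiv fun _ => ZMod 2) _ _ fun _ => rfl).symm

lemma sum_zmod_two {M : Type} [AddCommMonoid M] (f : ZMod 2 → M) : ∑ b, f b = f 0 + f 1 :=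
  Fin.sum_univ_two f

lemma sum_deviation {m : ℕ} (g : Fin m → G) : ∑ F, deviation g F = 0 := by
  classical
  simp only [deviation]
  rw [Finset.sum_sub_distrib, ← Finset.sum_div, Finset.sum_comm]
  simp [ZMod.card]

lemma deviation_cons {m : ℕ} (g₀ : G) (g : Fin m → G) (F : G) :
    deviation (Fin.cons g₀ g : Fin (m + 1) → G) F =
      (deviation g F + deviation g (g₀⁻¹ * F)) / 2 := by
  classical
  simp only [deviation]
  rw [sum_reg_succ, sum_zmod_two]
  simp only [subprod_cons, if_pos, if_neg zero_ne_one, one_mul, ← eq_inv_mul_iff_mul_eq]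
  rw [pow_succ]
  field_simp
  ring

/-- On average over `g₀`, prepending `g₀` halves the squared deviation, because the two halves of
the new distribution are uncorrelated. -/
lemma exists_deviation_cons {m : ℕ} (g : Fin m → G) : ∃ g₀ : G,
    ∑ F, deviation (Fin.cons g₀ g : Fin (m + 1) → G) F ^ 2 ≤ (∑ F, deviation g F ^ 2) / 2 := by
  have hsum : ∑ g₀ : G, ∑ F, deviation (Fin.cons g₀ g : Fin (m + 1) → G) F ^ 2 =
      ∑ _g₀ : G, (∑ F, deviation g F ^ 2) / 2 := by
    have h1 : ∀ g₀ : G, ∑ F, deviation (Fin.cons g₀ g : Fin (m + 1) → G) F ^ 2 =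
        (∑ F, deviation g F ^ 2) / 2 +
          (∑ F, deviation g F * deviation g (g₀⁻¹ * F)) / 2 := by
      intro g₀
      have h2 : ∑ F, deviation g (g₀⁻¹ * F) ^ 2 = ∑ F, deviation g F ^ 2 :=
        Fintype.sum_equiv (Equiv.mulLeft g₀⁻¹) _ _ fun _ => rfl
      have h3 : ∀ F, deviation (Fin.cons g₀ g : Fin (m + 1) → G) F ^ 2 =
          deviation g F ^ 2 / 4 + deviation g (g₀⁻¹ * F) ^ 2 / 4 +
            (deviation g F * deviation g (g₀⁻¹ * F)) / 2 := by
        intro F; rw [deviation_cons]; ring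
      simp only [h3, Finset.sum_add_distrib, ← Finset.sum_div, h2]
      ring
    simp only [h1]
    -- The mixed terms vanish on average, since the deviations sum up to `0`.
    have h4 : ∀ F, ∑ g₀ : G, deviation g F * deviation g (g₀⁻¹ * F) = 0 := by
      intro F
      rw [← Finset.mul_sum]
      have : ∑ g₀ : G, deviation g (g₀⁻¹ * F) = ∑ F, deviation g F :=
        Fintype.sum_equiv ((Equiv.inv G).trans (Equiv.mulRight F)) _ _ fun _ => rfl
      rw [this, sum_deviation, mul_zero]
    have h5 : ∑ g₀ : G, (∑ F, deviation g F * deviation g (g₀⁻¹ * F)) / 2 = 0 := by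
      rw [← Finset.sum_div, Finset.sum_comm, Finset.sum_eq_zero fun F _ => h4 F, zero_div]
    rw [Finset.sum_add_distrib, h5, add_zero]
  obtain ⟨g₀, -, h⟩ := Finset.exists_le_of_sum_le Finset.univ_nonempty hsum.le
  exact ⟨g₀, h⟩

/-- The theorem of Erdős and Rényi: suitable random subproducts are close to uniform. -/
theorem exists_subprod (G : Type) [Group G] [Fintype G] (m : ℕ) :
    ∃ g : Fin m → G, ∑ F, deviation g F ^ 2 ≤ 1 / 2 ^ m := by
  classical
  induction m with
  | zero =>
    refine ⟨Fin.elim0, ?_⟩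
    have h1 : ∀ F : G, deviation (Fin.elim0 : Fin 0 → G) F =
        (if 1 = F then (1 : ℝ) else 0) - 1 / Fintype.card G := by
      intro F; simp [deviation, subprod]
    have h2 : ∀ F : G, deviation (Fin.elim0 : Fin 0 → G) F ^ 2 =
        (if 1 = F then (1 - 2 / Fintype.card G : ℝ) else 0) + (1 / Fintype.card G) ^ 2 := by
      intro F; rw [h1]; split_ifs <;> ring
    have hc : (0 : ℝ) < Fintype.card G := by exact_mod_cast Fintype.card_pos
    simp only [h2, Finset.sum_add_distrib, Finset.sum_ite_eq, Finset.mem_univ, if_true,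
      Finset.sum_const, Finset.card_univ, nsmul_eq_mul]
    have : (Fintype.card G : ℝ) * (1 / Fintype.card G) ^ 2 = 1 / Fintype.card G := by
      field_simp
    rw [this]
    have h3 : (0 : ℝ) < 1 / Fintype.card G := by positivity
    rw [show (2 : ℝ) / Fintype.card G = 2 * (1 / Fintype.card G) by ring]
    rw [pow_zero, div_one]; linarith
  | succ m ih =>
    obtain ⟨g, hg⟩ := ih
    obtain ⟨g₀, h⟩ := exists_deviation_cons g
    refine ⟨Fin.cons g₀ g, h.trans ?_⟩
    rw [pow_succ, ← div_div]
    linarith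

/-- Random subproducts of `T + 2 n` suitable elements of a group of order at most `2 ^ T` are
`2 ^ (-n)`-indistinguishable from uniform group elements. -/
theorem exists_subprod_close (G : Type) [Group G] [Fintype G] (T n : ℕ)
    (hG : Fintype.card G ≤ 2 ^ T) : ∃ g : Fin (T + 2 * n) → G, ∀ h : G → ℝ, (∀ F, |h F| ≤ 1) →
      |Finset.expect Finset.univ h - Finset.expect Finset.univ fun β => h (subprod g β)| ≤
        1 / 2 ^ n := by
  classical
  obtain ⟨g, hg⟩ := exists_subprod G (T + 2 * n)
  refine ⟨g, fun h hh => ?_⟩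
  have h1 : (Finset.expect Finset.univ h - Finset.expect Finset.univ fun β => h (subprod g β)) =
      -∑ F, deviation g F * h F := by
    have h2 : ∑ β, h (subprod g β) = ∑ F, (∑ β, if subprod g β = F then (1 : ℝ) else 0) * h F := by
      simp only [Finset.sum_mul]
      rw [Finset.sum_comm]
      simp
    have h3 : ((Fintype.card (Reg (Fin (T + 2 * n))) : ℕ) : ℝ) = 2 ^ (T + 2 * n) := by
      simp [ZMod.card]
    rw [Fintype.expect_eq_sum_div_card, Fintype.expect_eq_sum_div_card, h2, h3]
    simp only [deviation, sub_mul, Finset.sum_sub_distrib, Finset.sum_div]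
    rw [neg_sub]
    congr 1
    · exact Finset.sum_congr rfl fun F _ => by ring
    · exact Finset.sum_congr rfl fun F _ => by rw [← Finset.sum_div]; ring
  rw [h1, abs_neg]
  have h4 : |∑ F, deviation g F * h F| ≤ ∑ F, |deviation g F| := by
    refine (Finset.abs_sum_le_sum_abs _ _).trans (Finset.sum_le_sum fun F _ => ?_)
    rw [abs_mul]
    exact mul_le_of_le_one_right (abs_nonneg _) (hh F)
  -- By the Cauchy–Schwarz inequality, the `ℓ¹` norm is at most `√(2^T · 2^{-(T + 2n)}) =
  -- 2^{-n}`.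
  refine h4.trans (abs_le_of_sq_le_sq' ?_ (by positivity)).2
  calc (∑ F, |deviation g F|) ^ 2 ≤ Fintype.card G * ∑ F, |deviation g F| ^ 2 := by
        have := sq_sum_le_card_mul_sum_sq (s := Finset.univ) (f := fun F => |deviation g F|)
        simpa using this
    _ ≤ 2 ^ T * (1 / 2 ^ (T + 2 * n)) := by
        simp only [sq_abs]
        gcongr
        exact_mod_cast hG
    _ = (1 / 2 ^ n) ^ 2 := by
        rw [pow_add, div_pow, one_pow, ← pow_mul, mul_comm n 2]; field_simp

end RandomSubproducts

section CircuitLibrary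

/-! ### Quantum circuits: linearity, padding, local gates -/

lemma QCirc.run_add {a b : Type} (q : QCirc a b) (ρ σ : Op (Reg a)) :
    q.run (ρ + σ) = q.run ρ + q.run σ := by
  induction q with
  | relabel e => rfl
  | gate j hj U =>
    ext x y
    simp only [QCirc.run, Matrix.of_apply, Matrix.add_apply, mul_add, add_mul,
      Finset.sum_add_distrib]
  | alloc =>
    ext x y
    simp only [QCirc.run, Matrix.of_apply, Matrix.add_apply]
    split_ifs <;> simp
  | discard =>
    ext x y
    simp only [QCirc.run, Matrix.of_apply, Matrix.add_apply, Finset.sum_add_distrib]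
  | seq f g hf hg => simp only [QCirc.run, hf, hg]

lemma QCirc.run_smul {a b : Type} (q : QCirc a b) (c : ℂ) (ρ : Op (Reg a)) :
    q.run (c • ρ) = c • q.run ρ := by
  induction q with
  | relabel e => rfl
  | gate j hj U =>
    ext x y
    simp only [QCirc.run, Matrix.of_apply, Matrix.smul_apply, smul_eq_mul, Finset.mul_sum]
    refine Finset.sum_congr rfl fun p _ => Finset.sum_congr rfl fun r _ => by ring
  | alloc =>
    ext x y
    simp only [QCirc.run, Matrix.of_apply, Matrix.smul_apply]
    split_ifs <;> simp
  | discard =>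
    ext x y
    simp only [QCirc.run, Matrix.of_apply, Matrix.smul_apply, smul_eq_mul, Finset.mul_sum]
  | seq f g hf hg => simp only [QCirc.run, hf, hg]

/-- The channel of a circuit as a linear map. -/
def QCirc.lin {a b : Type} (q : QCirc a b) : Op (Reg a) →ₗ[ℂ] Op (Reg b) where
  toFun := q.run
  map_add' := q.run_add
  map_smul' := q.run_smul

@[simp] lemma QCirc.run_zero {a b : Type} (q : QCirc a b) : q.run 0 = 0 := q.lin.map_zero

lemma QCirc.run_sum {a b κ : Type} (q : QCirc a b) (s : Finset κ) (f : κ → Op (Reg a)) :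
    q.run (∑ k ∈ s, f k) = ∑ k ∈ s, q.run (f k) := map_sum q.lin f s

/-- The block of an operator for given basis states of the first register. -/
def block {c a : Type} (y y' : Reg c) (ρ : Op (Reg (c ⊕ a))) : Op (Reg a) :=
  Matrix.of fun u v => ρ (Sum.elim y u) (Sum.elim y' v)

/-- The diagonal block of an operator for a given basis state of the first register. -/
def slice {c a : Type} (y : Reg c) (ρ : Op (Reg (c ⊕ a))) : Op (Reg a) :=
  ρ.submatrix (Sum.elim y) (Sum.elim y)

/-- The state `|y⟩⟨y| ⊗ σ`. -/
def put {c a : Type} [Fintype c] (y : Reg c) (σ : Op (Reg a)) : Op (Reg (c ⊕ a)) :=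
  Matrix.of fun u v =>
    if u ∘ Sum.inl = y ∧ v ∘ Sum.inl = y then σ (u ∘ Sum.inr) (v ∘ Sum.inr) else 0

lemma block_ext {c a : Type} {ρ σ : Op (Reg (c ⊕ a))} (h : ∀ y y', block y y' ρ = block y y' σ) :
    ρ = σ := by
  ext u v
  have := congrFun (congrFun (h (u ∘ Sum.inl) (v ∘ Sum.inl)) (u ∘ Sum.inr)) (v ∘ Sum.inr)
  simpa [block] using this

lemma block_put {c a : Type} [Fintype c] (y z z' : Reg c) (σ : Op (Reg a)) :
    block z z' (put y σ) = if z = y ∧ z' = y then σ else 0 := by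
  ext u v
  by_cases h : z = y ∧ z' = y
  · rw [if_pos h]; exact if_pos h
  · rw [if_neg h]; exact if_neg h

lemma block_self {c a : Type} (y : Reg c) (ρ : Op (Reg (c ⊕ a))) : block y y ρ = slice y ρ := rfl

lemma block_sum {c a κ : Type} (y y' : Reg c) (s : Finset κ) (f : κ → Op (Reg (c ⊕ a))) :
    block y y' (∑ k ∈ s, f k) = ∑ k ∈ s, block y y' (f k) := by
  ext u v
  simp [block, Matrix.sum_apply]

lemma block_smul {c a : Type} (y y' : Reg c) (r : ℂ) (ρ : Op (Reg (c ⊕ a))) :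
    block y y' (r • ρ) = r • block y y' ρ := rfl

lemma slice_sum {c a κ : Type} (y : Reg c) (s : Finset κ) (f : κ → Op (Reg (c ⊕ a))) :
    slice y (∑ k ∈ s, f k) = ∑ k ∈ s, slice y (f k) := block_sum y y s f

lemma slice_smul {c a : Type} (y : Reg c) (r : ℂ) (ρ : Op (Reg (c ⊕ a))) :
    slice y (r • ρ) = r • slice y ρ := rfl

lemma slice_put {c a : Type} [Fintype c] (y z : Reg c) (σ : Op (Reg a)) :
    slice z (put y σ) = if z = y then σ else 0 := by
  rw [← block_self, block_put]; simp

lemma put_sum {c a κ : Type} [Fintype c] (y : Reg c) (s : Finset κ) (f : κ → Op (Reg a)) :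
    put y (∑ k ∈ s, f k) = ∑ k ∈ s, put y (f k) := by
  refine block_ext fun z z' => ?_
  rw [block_sum]
  simp only [block_put]
  split_ifs <;> simp

lemma put_smul {c a : Type} [Fintype c] (y : Reg c) (r : ℂ) (σ : Op (Reg a)) :
    put y (r • σ) = r • put y σ := by
  refine block_ext fun z z' => ?_
  rw [block_smul]
  simp only [block_put]
  split_ifs <;> simp

lemma put_zero {c a : Type} [Fintype c] (y : Reg c) : put y (0 : Op (Reg a)) = 0 := by
  have := put_smul y 0 (0 : Op (Reg a))
  simpa using this

lemma block_zero {c a : Type} (y y' : Reg c) : block y y' (0 : Op (Reg (c ⊕ a))) = 0 := rfl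

lemma QCirc.run_relabel {a b : Type} (e : a ≃ b) (ρ : Op (Reg a)) :
    (QCirc.relabel e).run ρ = ρ.submatrix (fun x => x ∘ e) (fun x => x ∘ e) := rfl

/-- The wires of `Fin j ⊕ a`, or `Unit ⊕ a`, next to an idle register `c`. -/
def swapSum (c j a : Type) : c ⊕ (j ⊕ a) ≃ j ⊕ (c ⊕ a) :=
  ((Equiv.sumAssoc c j a).symm.trans (Equiv.sumCongr (Equiv.sumComm c j) (Equiv.refl a))).trans
    (Equiv.sumAssoc j c a)

@[simp] lemma swapSum_inr_inl (c j a : Type) (x : j) :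
    swapSum c j a (.inr (.inl x)) = .inl x := rfl
@[simp] lemma swapSum_inr_inr (c j a : Type) (x : a) :
    swapSum c j a (.inr (.inr x)) = .inr (.inr x) := rfl
@[simp] lemma swapSum_symm (c j a : Type) : (swapSum c j a).symm = swapSum j c a := rfl

/-- A circuit run next to an idle register. -/
def QCirc.pad (c : Type) : {a b : Type} → QCirc a b → QCirc (c ⊕ a) (c ⊕ b)
  | _, _, .relabel e => .relabel (Equiv.sumCongr (Equiv.refl c) e)
  | _, _, .gate (a := a) j hj U =>
    .seq (.seq (.relabel (swapSum c (Fin j) a)) (.gate j hj U)) (.relabel (swapSum (Fin j) c a))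
  | _, _, .alloc (a := a) => .seq .alloc (.relabel (swapSum Unit c a))
  | _, _, .discard (a := a) => .seq (.relabel (swapSum c Unit a)) .discard
  | _, _, .seq f g => .seq (f.pad c) (g.pad c)

@[simp] lemma QCirc.pad_size (c : Type) {a b : Type} (q : QCirc a b) :
    (q.pad c).size = q.size := by
  induction q with
  | seq f g hf hg => simp only [QCirc.pad, QCirc.size, hf, hg]
  | _ => simp [QCirc.pad, QCirc.size]

lemma QCirc.block_pad (c : Type) {a b : Type} (q : QCirc a b) (y y' : Reg c)
    (ρ : Op (Reg (c ⊕ a))) : block y y' ((q.pad c).run ρ) = q.run (block y y' ρ) := by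
  induction q with
  | relabel e =>
    ext u v
    simp only [block, QCirc.pad, QCirc.run, Matrix.of_apply, Matrix.submatrix_apply]
    congr 1 <;> (funext z; rcases z with z | z <;> rfl)
  | gate j hj U =>
    ext u v
    simp only [block, QCirc.pad, QCirc.run, Matrix.of_apply, Matrix.submatrix_apply]
    refine Finset.sum_congr rfl fun p _ => Finset.sum_congr rfl fun r _ => ?_
    congr 2
    congr 1 <;> (funext z; rcases z with z | z | z <;> rfl)
  | alloc =>
    ext u v
    simp only [block, QCirc.pad, QCirc.run, Matrix.of_apply, Matrix.submatrix_apply]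
    congr 2 <;> (funext z; rcases z with z | z <;> rfl)
  | discard =>
    ext u v
    simp only [block, QCirc.pad, QCirc.run, Matrix.of_apply, Matrix.submatrix_apply]
    refine Finset.sum_congr rfl fun p _ => ?_
    congr 1 <;> (funext z; rcases z with z | z | z <;> rfl)
  | seq f g hf hg => simp only [QCirc.pad, QCirc.run, hf, hg]

lemma QCirc.pad_put {c : Type} [Fintype c] {a b : Type} (q : QCirc a b) (y : Reg c)
    (σ : Op (Reg a)) : (q.pad c).run (put y σ) = put y (q.run σ) := by
  refine block_ext fun z z' => ?_
  rw [QCirc.block_pad, block_put, block_put]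
  split_ifs <;> simp

/-- A circuit run next to an idle register, which is written on the right. -/
def QCirc.padRight {a b : Type} (q : QCirc a b) (c : Type) : QCirc (a ⊕ c) (b ⊕ c) :=
  .seq (.seq (.relabel (Equiv.sumComm a c)) (q.pad c)) (.relabel (Equiv.sumComm c b))

@[simp] lemma QCirc.padRight_size {a b : Type} (q : QCirc a b) (c : Type) :
    (q.padRight c).size = q.size := by
  simp [QCirc.padRight, QCirc.size]

lemma QCirc.padRight_apply {a b : Type} (q : QCirc a b) (c : Type) (ρ : Op (Reg (a ⊕ c)))
    (x y : Reg b) (u v : Reg c) : (q.padRight c).run ρ (Sum.elim x u) (Sum.elim y v) =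
      q.run (Matrix.of fun s t => ρ (Sum.elim s u) (Sum.elim t v)) x y := by
  have h := congrFun (congrFun (QCirc.block_pad c q u v
    ((QCirc.relabel (Equiv.sumComm a c)).run ρ)) x) y
  have h2 : block u v ((QCirc.relabel (Equiv.sumComm a c)).run ρ) =
      Matrix.of fun s t => ρ (Sum.elim s u) (Sum.elim t v) := by
    ext s t
    simp only [block, QCirc.run, Matrix.of_apply, Matrix.submatrix_apply]
    congr 1 <;> (funext z; rcases z with z | z <;> rfl)
  rw [h2] at h
  rw [← h]
  simp only [QCirc.padRight, QCirc.run, block, Matrix.of_apply, Matrix.submatrix_apply]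
  congr 1 <;> (funext z; rcases z with z | z <;> rfl)

/-- `M` acts only on the wires in `s`. -/
def LocalOn {a : Type} (s : Finset a) (M : Op (Reg a)) : Prop :=
  ∃ f : Reg {v // v ∈ s} → Reg {v // v ∈ s} → ℂ, ∀ y x : Reg a,
    ((∀ v, v ∉ s → y v = x v) → M y x = f (fun v => y v) (fun v => x v)) ∧
    (¬ (∀ v, v ∉ s → y v = x v) → M y x = 0)

/-- A unitary that acts on at most three wires is a single elementary operation. -/
lemma exists_gate {a : Type} [Fintype a] [DecidableEq a] {s : Finset a} (hs : s.card ≤ 3)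
    {M : Op (Reg a)} (hM : M ∈ Matrix.unitaryGroup (Reg a) ℂ) (hloc : LocalOn s M) :
    ∃ q : QCirc a a, q.size = 1 ∧ ∀ ρ, q.run ρ = M * ρ * Mᴴ := by
  obtain ⟨f, hf⟩ := hloc
  let e : Fin s.card ⊕ {v // v ∉ s} ≃ a :=
    (Equiv.sumCongr s.equivFin.symm (Equiv.refl _)).trans (Equiv.sumCompl (· ∈ s))
  -- `U` is the matrix of `M` on the wires in `s`; `glue` joins an assignment of these wires and
  -- one of the others.
  let U : Op (Reg (Fin s.card)) :=
    Matrix.of fun p p' => f (fun v => p (s.equivFin v)) (fun v => p' (s.equivFin v))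
  let glue : Reg (Fin s.card) → Reg {v // v ∉ s} → Reg a := fun p z => Sum.elim p z ∘ e.symm
  have hglue_in : ∀ p z (v : {v // v ∈ s}), glue p z v = p (s.equivFin v) := by
    intro p z v
    have : e.symm v.1 = .inl (s.equivFin v) := by
      rw [Equiv.symm_apply_eq]; simp [e]
    simp [glue, this]
  have hglue_out : ∀ p z (v : {v // v ∉ s}), glue p z v = z v := by
    intro p z v
    have : e.symm v.1 = .inr v := by
      rw [Equiv.symm_apply_eq]; simp [e]
    simp [glue, this]
  have hMU : ∀ p p' z, M (glue p z) (glue p' z) = U p p' := by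
    intro p p' z
    rw [(hf _ _).1 (fun v hv => by rw [hglue_out p z ⟨v, hv⟩, hglue_out p' z ⟨v, hv⟩])]
    simp only [hglue_in]; rfl
  have hM0 : ∀ p p' z z', z ≠ z' → M (glue p z) (glue p' z') = 0 := by
    intro p p' z z' hz
    refine (hf _ _).2 fun h => hz (funext fun v => ?_)
    rw [← hglue_out p z v, ← hglue_out p' z' v]
    exact h v v.2
  let E : Reg (Fin s.card) × Reg {v // v ∉ s} ≃ Reg a :=
    (Equiv.sumArrowEquivProdArrow _ _ _).symm.trans (Equiv.arrowCongr e (Equiv.refl _))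
  have hE : ∀ p z, E (p, z) = glue p z := fun p z => rfl
  have hsum : ∀ (p : Reg (Fin s.card)) z (F : Reg a → ℂ),
      ∑ x, M (glue p z) x * F x = ∑ p', U p p' * F (glue p' z) := by
    intro p z F
    rw [← E.sum_comp, Fintype.sum_prod_type]
    refine Finset.sum_congr rfl fun p' _ => ?_
    rw [Finset.sum_eq_single z]
    · rw [hE, hMU]
    · intro z' _ hz'
      rw [hE, hM0 _ _ _ _ hz'.symm, zero_mul]
    · simp
  -- Since `M` is block diagonal with the block `U`, unitarity passes to `U`.
  have hU : U ∈ Matrix.unitaryGroup (Reg (Fin s.card)) ℂ := by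
    rw [Matrix.mem_unitaryGroup_iff] at hM ⊢
    ext p p'
    have h1 := congrFun (congrFun hM (glue p 0)) (glue p' 0)
    rw [Matrix.mul_apply, hsum] at h1
    simp only [Matrix.star_apply, hMU] at h1
    rw [Matrix.mul_apply]
    simp only [Matrix.star_apply]
    rw [h1]
    have : glue p 0 = glue p' 0 ↔ p = p' := by
      constructor
      · intro h
        funext k
        have := congrFun h (s.equivFin.symm k).1
        rwa [hglue_in, hglue_in, Equiv.apply_symm_apply] at this
      · rintro rfl; rfl
    simp only [Matrix.one_apply, this]
  refine ⟨.seq (.seq (.relabel e.symm) (.gate s.card hs ⟨U, hU⟩)) (.relabel e), rfl, fun ρ => ?_⟩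
  ext x y
  obtain ⟨⟨p, z⟩, rfl⟩ := E.surjective x
  obtain ⟨⟨p', z'⟩, rfl⟩ := E.surjective y
  rw [hE, hE]
  have hge : ∀ p z, glue p z ∘ e = Sum.elim p z := by
    intro p z; funext k; simp [glue]
  have h2 : ∀ (F : Reg a → ℂ), ∑ x, F x * star (M (glue p' z') x) =
      ∑ r, F (glue r z') * star (U p' r) := by
    intro F
    have := congrArg star (hsum p' z' (fun x => star (F x)))
    simp only [star_sum, star_mul', star_star] at this
    simp only [mul_comm (F _)]
    exact this
  simp only [QCirc.run, Matrix.of_apply, Matrix.submatrix_apply, hge, Sum.elim_comp_inl,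
    Sum.elim_comp_inr]
  rw [Matrix.mul_apply]
  simp only [Matrix.conjTranspose_apply]
  rw [h2 fun x => (M * ρ) (glue p z) x]
  simp only [Matrix.mul_apply, hsum, Finset.sum_mul]
  rw [Finset.sum_comm]

end CircuitLibrary

section ClassicalCircuits

/-! ### Classical computations as quantum circuits -/

open Classical in
/-- The operator `|x⟩⟨x'|`. -/
def ket {a : Type} (x x' : Reg a) : Op (Reg a) :=
  Matrix.of fun u v => if u = x ∧ v = x' then 1 else 0

lemma ket_apply_self {a : Type} (x x' : Reg a) : ket x x' x x' = 1 := by simp [ket]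

lemma ket_apply_of_ne {a : Type} {x x' u v : Reg a} (h : ¬ (u = x ∧ v = x')) :
    ket x x' u v = 0 := by
  simp only [ket, Matrix.of_apply, if_neg h]

lemma op_eq_sum_ket {a : Type} [Fintype a] [DecidableEq a] (ρ : Op (Reg a)) :
    ρ = ∑ x, ∑ x', ρ x x' • ket x x' := by
  ext u v
  simp [Matrix.sum_apply, ket, ite_and]

/-- The circuit `q` computes the classical function `f`: it maps `|x⟩⟨x'|` to `|f x⟩⟨f x'|` up to a
factor, which is `1` on the diagonal. -/
def Maps {a b : Type} (q : QCirc a b) (f : Reg a → Reg b) : Prop :=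
  ∃ κ : Reg a → Reg a → ℂ, (∀ x, κ x x = 1) ∧
    ∀ x x', q.run (ket x x') = κ x x' • ket (f x) (f x')

lemma Maps.congr {a b : Type} {q : QCirc a b} {f g : Reg a → Reg b} (h : Maps q f)
    (hfg : ∀ x, f x = g x) : Maps q g := by
  rwa [← show f = g from funext hfg]

lemma Maps.seq {a b c : Type} {p : QCirc a b} {q : QCirc b c} {f : Reg a → Reg b}
    {g : Reg b → Reg c} (hp : Maps p f) (hq : Maps q g) : Maps (.seq p q) (fun x => g (f x)) := by
  obtain ⟨κ, h1, h2⟩ := hp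
  obtain ⟨κ', h1', h2'⟩ := hq
  refine ⟨fun x x' => κ x x' * κ' (f x) (f x'), fun x => by simp only [h1, h1', one_mul],
    fun x x' => ?_⟩
  rw [QCirc.run, h2, QCirc.run_smul, h2', smul_smul]

lemma maps_relabel {a b : Type} (e : a ≃ b) : Maps (.relabel e) (fun x => x ∘ e.symm) := by
  classical
  refine ⟨fun _ _ => 1, fun _ => rfl, fun x x' => ?_⟩
  have h : ∀ (u : Reg b) (x : Reg a), u ∘ e = x ↔ u = x ∘ e.symm := by
    intro u x
    constructor
    · rintro rfl; funext k; simp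
    · rintro rfl; funext k; simp
  ext u v
  simp only [QCirc.run, Matrix.submatrix_apply, ket, Matrix.of_apply, one_smul, h]

lemma maps_alloc {a : Type} : Maps (.alloc : QCirc a (Unit ⊕ a)) (Sum.elim fun _ => 0) := by
  classical
  refine ⟨fun _ _ => 1, fun _ => rfl, fun x x' => ?_⟩
  have h : ∀ (u : Reg (Unit ⊕ a)) (x : Reg a),
      u = Sum.elim (fun _ => 0) x ↔ u (.inl ()) = 0 ∧ u ∘ Sum.inr = x := by
    intro u x
    constructor
    · rintro rfl; exact ⟨rfl, rfl⟩
    · rintro ⟨h1, rfl⟩; funext k; rcases k with ⟨⟩ | k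
      · exact h1
      · rfl
  ext u v
  simp only [QCirc.run, ket, Matrix.of_apply, one_smul, h]
  by_cases h1 : u (.inl ()) = 0 <;> by_cases h2 : v (.inl ()) = 0 <;> simp [h1, h2]

lemma maps_discard {a : Type} :
    Maps (.discard : QCirc (Unit ⊕ a) a) (fun x => x ∘ Sum.inr) := by
  classical
  refine ⟨fun x x' => if x (.inl ()) = x' (.inl ()) then 1 else 0, fun _ => if_pos rfl,
    fun x x' => ?_⟩
  have h : ∀ (b : ZMod 2) (u : Reg a) (x : Reg (Unit ⊕ a)),
      Sum.elim (fun _ => b) u = x ↔ b = x (.inl ()) ∧ u = x ∘ Sum.inr := by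
    intro b u x
    constructor
    · rintro rfl; exact ⟨rfl, rfl⟩
    · rintro ⟨rfl, rfl⟩; funext k; rcases k with ⟨⟩ | k <;> rfl
  ext u v
  simp only [QCirc.run, ket, Matrix.of_apply, h, Matrix.smul_apply, smul_eq_mul]
  by_cases hu : u = x ∘ Sum.inr <;> by_cases hv : v = x' ∘ Sum.inr <;> simp [hu, hv, ite_and]

/-- An involution of the basis states that acts on at most three wires is one operation. -/
lemma exists_involution_gate {a : Type} [Fintype a] {s : Finset a} (hs : s.card ≤ 3)
    {π : Reg a → Reg a} (hπ : ∀ x, π (π x) = x) (hout : ∀ x, ∀ v ∉ s, π x v = x v)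
    (hloc : ∀ x x', (∀ v ∈ s, x v = x' v) → ∀ v ∈ s, π x v = π x' v) :
    ∃ q : QCirc a a, q.size = 1 ∧ Maps q π := by
  classical
  let M : Op (Reg a) := Matrix.of fun y x => if y = π x then 1 else 0
  have hadj : Mᴴ = M := by
    ext y x
    simp only [Matrix.conjTranspose_apply, M, Matrix.of_apply]
    have : x = π y ↔ y = π x := by
      constructor <;> (rintro rfl; rw [hπ])
    simp only [this]
    split_ifs <;> simp
  have hMM : M * M = 1 := by
    ext y x
    simp [M, Matrix.mul_apply, hπ, Matrix.one_apply]
  have hM : M ∈ Matrix.unitaryGroup (Reg a) ℂ :=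
    Matrix.mem_unitaryGroup_iff.2 (by rw [Matrix.star_eq_conjTranspose, hadj, hMM])
  have hl : LocalOn s M := by
    refine ⟨fun p p' => if ∀ v (hv : v ∈ s),
      p ⟨v, hv⟩ = π (fun v => if h : v ∈ s then p' ⟨v, h⟩ else 0) v then 1 else 0,
      fun y x => ⟨fun h => ?_, fun h => ?_⟩⟩
    · simp only [M, Matrix.of_apply]
      congr 1
      refine propext ⟨fun hy v hv => ?_, fun hy => funext fun v => ?_⟩
      · rw [hy]
        exact hloc _ _ (fun v hv => by rw [dif_pos hv]) v hv
      · by_cases hv : v ∈ s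
        · rw [hy v hv]
          exact hloc _ _ (fun v hv => by rw [dif_pos hv]) v hv
        · rw [h v hv, hout x v hv]
    · simp only [M, Matrix.of_apply]
      refine if_neg fun hy => h fun v hv => ?_
      rw [hy, hout x v hv]
  obtain ⟨q, hq, hrun⟩ := exists_gate hs hM hl
  refine ⟨q, hq, fun _ _ => 1, fun _ => rfl, fun x x' => ?_⟩
  rw [hrun, hadj]
  ext u v
  have h1 : ∀ u v : Reg a, u = π v ↔ v = π u := by
    intro u v
    constructor <;> (rintro rfl; rw [hπ])
  simp only [Matrix.mul_apply, M, Matrix.of_apply, ket, one_smul,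
    mul_ite, mul_one, mul_zero, h1 u, Finset.sum_ite_eq', Finset.mem_univ, if_true]
  simp only [ite_and, Finset.sum_ite_eq', Finset.mem_univ, if_true]
  have h2 : x = π u ↔ π u = x := eq_comm
  split_ifs <;> simp_all

/-- The target wire `v` is replaced by `v ⊕ h(u, u')`. -/
lemma exists_xor_gate {a : Type} [Fintype a] [DecidableEq a] {v u u' : a} (hu : u ≠ v)
    (hu' : u' ≠ v) (h : ZMod 2 → ZMod 2 → ZMod 2) : ∃ q : QCirc a a, q.size = 1 ∧
      Maps q (fun x => Function.update x v (x v + h (x u) (x u'))) := by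
  refine exists_involution_gate (s := {v, u, u'}) Finset.card_le_three (fun x => ?_)
    (fun x k hk => ?_) (fun x x' hx k hk => ?_)
  · funext k
    by_cases hk : k = v
    · subst hk
      simp [hu, hu', add_assoc, zmod_two_add_self]
    · simp [hk]
  · simp only [Finset.mem_insert, not_or] at hk
    simp [hk.1]
  · by_cases hkv : k = v
    · subst hkv
      simp [hx k (by simp), hx u (by simp), hx u' (by simp)]
    · simp [hkv, hx k hk]

/-- The Boolean function `f` can be evaluated on arbitrarily chosen wires of any register, into a
new wire, with `s` elementary operations. -/
def BitCost {a : Type} (s : ℕ) (f : Reg a → ZMod 2) : Prop :=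
  ∀ (a' : Type) [Fintype a'] (e : a → a'), ∃ q : QCirc a' (Unit ⊕ a'), q.size ≤ s ∧
    Maps q (fun x => Sum.elim (fun _ => f (x ∘ e)) x)

lemma BitCost.mono {a : Type} {s s' : ℕ} {f : Reg a → ZMod 2} (h : BitCost s f) (hs : s ≤ s') :
    BitCost s' f := fun a' _ e => by
  obtain ⟨q, h1, h2⟩ := h a' e
  exact ⟨q, h1.trans hs, h2⟩

lemma BitCost.congr {a : Type} {s : ℕ} {f g : Reg a → ZMod 2} (h : BitCost s f)
    (hfg : ∀ x, f x = g x) : BitCost s g := by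
  rwa [← show f = g from funext hfg]

lemma bitCost_zero {a : Type} : BitCost 1 (fun _ : Reg a => 0) := fun _ _ _ =>
  ⟨.alloc, le_rfl, maps_alloc⟩

lemma bitCost_var {a : Type} (u : a) : BitCost 2 (fun x : Reg a => x u) := by
  classical
  intro a' _ e
  obtain ⟨q, hq, hm⟩ := exists_xor_gate (v := (Sum.inl () : Unit ⊕ a')) (u := .inr (e u))
    (u' := .inr (e u)) (by simp) (by simp) fun x _ => x
  refine ⟨.seq .alloc q, by simp [QCirc.size, hq], (maps_alloc.seq hm).congr fun x => ?_⟩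
  funext k
  rcases k with ⟨⟩ | k <;> simp

/-- Both values are computed into new wires, combined into a third one by a single gate, and
discarded; discarding only destroys coherence between different inputs, which `Maps` permits. -/
lemma BitCost.op {a : Type} {s s' : ℕ} {f g : Reg a → ZMod 2} (hf : BitCost s f)
    (hg : BitCost s' g) (h : ZMod 2 → ZMod 2 → ZMod 2) :
    BitCost (s + s' + 4) (fun x => h (f x) (g x)) := by
  classical
  intro a' _ e
  obtain ⟨qf, hqf, hmf⟩ := hf a' e
  obtain ⟨qg, hqg, hmg⟩ := hg (Unit ⊕ a') (Sum.inr ∘ e)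
  obtain ⟨q, hq, hm⟩ := exists_xor_gate (v := (Sum.inl () : Unit ⊕ (Unit ⊕ (Unit ⊕ a'))))
    (u := .inr (.inr (.inl ()))) (u' := .inr (.inl ())) (by simp) (by simp) h
  let d1 : QCirc (Unit ⊕ (Unit ⊕ (Unit ⊕ a'))) (Unit ⊕ (Unit ⊕ a')) :=
    .seq (.relabel (swapSum Unit Unit (Unit ⊕ a'))) .discard
  let d2 : QCirc (Unit ⊕ (Unit ⊕ a')) (Unit ⊕ a') :=
    .seq (.relabel (swapSum Unit Unit a')) .discard
  have hd1 := (maps_relabel (swapSum Unit Unit (Unit ⊕ a'))).seq maps_discard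
  have hd2 := (maps_relabel (swapSum Unit Unit a')).seq maps_discard
  refine ⟨.seq (.seq (.seq (.seq qf qg) (.seq .alloc q)) d1) d2, ?_,
    (((((hmf.seq hmg).seq (maps_alloc.seq hm)).seq hd1).seq hd2)).congr fun x => ?_⟩
  · simp only [QCirc.size, hq, d1, d2]; omega
  · funext k
    rcases k with ⟨⟩ | k
    · simp only [Function.comp_apply, swapSum_symm, swapSum_inr_inl]
      rw [Function.update_self]
      exact zero_add _
    · have hne : (Sum.inr (Sum.inr (Sum.inr k)) : Unit ⊕ (Unit ⊕ (Unit ⊕ a'))) ≠ Sum.inl () := by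
        simp
      simp only [Function.comp_apply, Sum.elim_inr, swapSum_symm, swapSum_inr_inr]
      rw [Function.update_of_ne hne]
      rfl

lemma bitCost_const {a : Type} (c : ZMod 2) : BitCost 6 (fun _ : Reg a => c) :=
  bitCost_zero.op bitCost_zero fun _ _ => c

/-- A Boolean function of few wires has a small circuit. -/
lemma bitCost_of_dependsOn {a : Type} (s : Finset a) (f : Reg a → ZMod 2)
    (h : ∀ x x' : Reg a, (∀ v ∈ s, x v = x' v) → f x = f x') : BitCost (22 * 2 ^ s.card) f := by
  classical
  suffices ∀ n, ∀ (s : Finset a), s.card = n → ∀ f : Reg a → ZMod 2,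
      (∀ x x' : Reg a, (∀ v ∈ s, x v = x' v) → f x = f x') → BitCost (22 * 2 ^ n - 16) f from
    (this _ s rfl f h).mono (Nat.sub_le _ _)
  intro n
  induction n with
  | zero =>
    intro s hs f hf
    have hs0 := Finset.card_eq_zero.1 hs
    refine ((bitCost_const (f 0)).mono (by omega)).congr fun x => hf _ _ ?_
    simp [hs0]
  | succ n ih =>
    intro s hs f hf
    obtain ⟨u, hu⟩ : s.Nonempty := Finset.card_pos.1 (by omega)
    have hc : (s.erase u).card = n := by rw [Finset.card_erase_of_mem hu, hs]; rfl
    have key : ∀ c, BitCost (22 * 2 ^ n - 16) (fun x => f (Function.update x u c)) := by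
      intro c
      refine ih _ hc _ fun x x' hx => hf _ _ fun v hv => ?_
      by_cases hvu : v = u
      · subst hvu; simp
      · simp [hvu, hx v (Finset.mem_erase.2 ⟨hvu, hv⟩)]
    have h1 := (bitCost_var u).op (key 1) fun p q => p * q
    have h0 := (bitCost_var u).op (key 0) fun p q => (1 + p) * q
    -- A case distinction on the wire `u`: `f x = x_u · f(x[u ↦ 1]) + (1 + x_u) · f(x[u ↦ 0])`.
    refine ((h1.op h0 fun p q => p + q).mono ?_).congr fun x => ?_
    · have := Nat.one_le_two_pow (n := n)
      rw [pow_succ]; omega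
    · rcases zmod_two_cases (x u) with hx | hx
      · have hx' : Function.update x u 0 = x := by rw [← hx, Function.update_eq_self]
        simp [hx, hx']
      · have hx' : Function.update x u 1 = x := by rw [← hx, Function.update_eq_self]
        simp [hx, hx', show (1 + 1 : ZMod 2) = 0 from rfl]

open Classical in
/-- Testing whether one of several bits is set. -/
lemma bitCost_exists {a κ : Type} [Fintype κ] {s : ℕ} {f : κ → Reg a → ZMod 2}
    (hf : ∀ k, BitCost s (f k)) :
    BitCost (Fintype.card κ * (s + 4) + 1) (fun x => if ∃ k, f k x ≠ 0 then 1 else 0) := by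
  suffices ∀ t : Finset κ,
      BitCost (t.card * (s + 4) + 1) (fun x => if ∃ k ∈ t, f k x ≠ 0 then 1 else 0) by
    simpa using this Finset.univ
  intro t
  induction t using Finset.induction_on with
  | empty => simpa using bitCost_zero
  | insert k t hk ih =>
    refine (((hf k).op ih fun p q => if p ≠ 0 ∨ q ≠ 0 then 1 else 0).mono ?_).congr fun x => ?_
    · rw [Finset.card_insert_of_notMem hk]; ring_nf; omega
    · simp only [Finset.mem_insert, exists_eq_or_imp]
      by_cases h : ∃ k ∈ t, f k x ≠ 0
      · simp [h]
      · simp [h]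

/-- The wires `Unit ⊕ (b ⊕ a)` as `Option b ⊕ a`. -/
def optionSum (b a : Type) : Unit ⊕ (b ⊕ a) ≃ Option b ⊕ a :=
  (Equiv.sumAssoc Unit b a).symm.trans
    (Equiv.sumCongr ((Equiv.sumComm Unit b).trans (Equiv.optionEquivSumPUnit b).symm)
      (Equiv.refl a))

@[simp] lemma optionSum_symm_none (b a : Type) :
    (optionSum b a).symm (.inl none) = .inl () := rfl
@[simp] lemma optionSum_symm_some (b a : Type) (x : b) :
    (optionSum b a).symm (.inl (some x)) = .inr (.inl x) := rfl
@[simp] lemma optionSum_symm_inr (b a : Type) (x : a) :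
    (optionSum b a).symm (.inr x) = .inr (.inr x) := rfl

/-- Several bits are evaluated into a new register. -/
lemma exists_maps_compute {a : Type} {s : ℕ} (b : Type) [Fintype b] : ∀ F : Reg a → Reg b,
    (∀ j, BitCost s fun x => F x j) → ∀ (a' : Type) [Fintype a'] (e : a → a'),
      ∃ q : QCirc a' (b ⊕ a'), q.size ≤ Fintype.card b * s ∧
        Maps q (fun x => Sum.elim (F (x ∘ e)) x) := by
  refine Fintype.induction_empty_option (P := fun b _ => ∀ F : Reg a → Reg b,
    (∀ j, BitCost s fun x => F x j) → ∀ (a' : Type) [Fintype a'] (e : a → a'),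
      ∃ q : QCirc a' (b ⊕ a'), q.size ≤ Fintype.card b * s ∧
        Maps q (fun x => Sum.elim (F (x ∘ e)) x)) ?_ ?_ ?_ b
  · intro b b' _ ε ih F hF a' _ e
    let _ : Fintype b := Fintype.ofEquiv b' ε.symm
    obtain ⟨q, hq, hm⟩ := ih (fun x => F x ∘ ε) (fun j => hF (ε j)) a' e
    refine ⟨.seq q (.relabel (Equiv.sumCongr ε (Equiv.refl a'))), ?_,
      (hm.seq (maps_relabel _)).congr fun x => ?_⟩
    · simpa [QCirc.size, ← Fintype.card_congr ε] using hq
    · funext k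
      rcases k with k | k <;> simp
  · intro F _ a' _ e
    refine ⟨.relabel (Equiv.emptySum PEmpty a').symm, by simp [QCirc.size],
      (maps_relabel _).congr fun x => ?_⟩
    funext k
    rcases k with k | k
    · exact k.elim
    · rfl
  · intro b _ ih F hF a' _ e
    obtain ⟨q, hq, hm⟩ := ih (fun x j => F x (some j)) (fun j => hF (some j)) a' e
    obtain ⟨q', hq', hm'⟩ := hF none (b ⊕ a') (Sum.inr ∘ e)
    refine ⟨.seq (.seq q q') (.relabel (optionSum b a')), ?_,
      ((hm.seq hm').seq (maps_relabel _)).congr fun x => ?_⟩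
    · simp only [QCirc.size, Fintype.card_option, add_mul]; omega
    · funext k
      rcases k with (_ | k) | k
      · simp only [Function.comp_apply, optionSum_symm_none, Sum.elim_inl]; rfl
      · simp
      · simp

lemma sum_reg_option {M : Type} [AddCommMonoid M] {c : Type} [Fintype c] [DecidableEq c]
    [DecidableEq (Option c)] (f : Reg (Option c) → M) :
    ∑ y, f y = ∑ b : ZMod 2, ∑ y : Reg c, f (fun o => o.elim b y) := by
  rw [← Fintype.sum_prod_type']
  refine Fintype.sum_equiv (Equiv.piOptionEquivProd (α := c) (β := fun _ => ZMod 2)) _ _ ?_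
  intro y
  congr 1
  funext o
  cases o <;> rfl

/-- Discarding a whole register. -/
lemma exists_discardAll (c : Type) [Fintype c] : ∀ [DecidableEq c] (a : Type),
    ∃ q : QCirc (c ⊕ a) a, q.size = Fintype.card c ∧ ∀ ρ, q.run ρ = ∑ y, slice y ρ := by
  refine Fintype.induction_empty_option (P := fun c _ => ∀ [DecidableEq c] (a : Type),
    ∃ q : QCirc (c ⊕ a) a, q.size = Fintype.card c ∧ ∀ ρ, q.run ρ = ∑ y, slice y ρ) ?_ ?_ ?_ c
  · intro b c _ ε ih _ a
    let _ : DecidableEq b := ε.decidableEq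
    let _ : Fintype b := Fintype.ofEquiv c ε.symm
    obtain ⟨q, hq, hr⟩ := ih a
    refine ⟨.seq (.relabel (Equiv.sumCongr ε.symm (Equiv.refl a))) q, ?_, fun ρ => ?_⟩
    · simpa [QCirc.size, ← Fintype.card_congr ε] using hq
    · rw [QCirc.run, hr]
      refine Fintype.sum_equiv (Equiv.arrowCongr ε (Equiv.refl _)) _ _ fun y => ?_
      ext u v
      simp only [slice, QCirc.run, Matrix.submatrix_apply]
      congr 1 <;> (funext k; rcases k with k | k <;> rfl)
  · intro _ a
    refine ⟨.relabel (Equiv.emptySum PEmpty a), by simp [QCirc.size], fun ρ => ?_⟩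
    rw [Fintype.sum_unique]
    ext u v
    simp only [slice, QCirc.run, Matrix.submatrix_apply]
    congr 1 <;> (funext k; rcases k with k | k <;> first | rfl | exact k.elim)
  · intro c _ ih _ a
    let _ : DecidableEq c := Classical.decEq c
    obtain ⟨q, hq, hr⟩ := ih a
    refine ⟨.seq (.seq (.relabel (optionSum c a).symm) .discard) q, ?_, fun ρ => ?_⟩
    · simp only [QCirc.size, hq, Fintype.card_option]; omega
    · rw [QCirc.run, hr, sum_reg_option, Finset.sum_comm]
      refine Finset.sum_congr rfl fun y _ => ?_
      ext u v
      simp only [slice, QCirc.run, Matrix.submatrix_apply, Matrix.of_apply, Matrix.sum_apply]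
      refine Finset.sum_congr rfl fun b _ => ?_
      congr 1 <;> (funext k; rcases k with (_ | k) | k <;> rfl)

lemma slice_ket {c a : Type} (y : Reg c) (x x' : Reg (c ⊕ a)) [Decidable (x ∘ Sum.inl = y)]
    [Decidable (x' ∘ Sum.inl = y)] : slice y (ket x x') =
    if x ∘ Sum.inl = y ∧ x' ∘ Sum.inl = y then ket (x ∘ Sum.inr) (x' ∘ Sum.inr) else 0 := by
  classical
  have h : ∀ (u : Reg a) (x : Reg (c ⊕ a)),
      Sum.elim y u = x ↔ x ∘ Sum.inl = y ∧ u = x ∘ Sum.inr := by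
    intro u x
    constructor
    · rintro rfl; exact ⟨rfl, rfl⟩
    · rintro ⟨rfl, rfl⟩; funext k; rcases k with k | k <;> rfl
  ext u v
  simp only [slice, ket, Matrix.submatrix_apply, Matrix.of_apply, h]
  by_cases h1 : x ∘ Sum.inl = y <;> by_cases h2 : x' ∘ Sum.inl = y <;> simp [h1, h2]

/-- A classical function whose output bits have small circuits is computed by a small circuit that
measures its input. -/
lemma exists_classical {a b : Type} [Fintype a] [Fintype b] [DecidableEq a] {s : ℕ}
    (F : Reg a → Reg b) (hF : ∀ j, BitCost s fun x => F x j) : ∃ q : QCirc a b,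
      q.size ≤ Fintype.card b * s + Fintype.card a ∧
        ∀ ρ, q.run ρ = ∑ x, ρ x x • ket (F x) (F x) := by
  classical
  obtain ⟨q, hq, κ, hκ, hm⟩ := exists_maps_compute b F hF a id
  obtain ⟨d, hd, hdr⟩ := exists_discardAll a b
  refine ⟨.seq (.seq q (.relabel (Equiv.sumComm b a))) d, ?_, fun ρ => ?_⟩
  · simp only [QCirc.size, hd]; omega
  · have h2 : ∀ x x', (QCirc.relabel (Equiv.sumComm b a)).run
        (ket (Sum.elim (F x) x) (Sum.elim (F x') x')) =
          ket (Sum.elim x (F x)) (Sum.elim x' (F x')) := by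
      intro x x'
      have he : ∀ (u : Reg (a ⊕ b)) (x : Reg a), u ∘ (Equiv.sumComm b a) = Sum.elim (F x) x ↔
          u = Sum.elim x (F x) := by
        intro u x
        constructor
        · intro h; funext k
          rcases k with k | k
          · exact congrFun h (.inr k)
          · exact congrFun h (.inl k)
        · rintro rfl; funext k; rcases k with k | k <;> rfl
      ext u v
      simp only [QCirc.run, ket, Matrix.submatrix_apply, Matrix.of_apply, he]
      congr
    -- The input is copied into the output and discarded, which removes its coherences.
    have h1 : ∀ x x', (QCirc.seq (.seq q (.relabel (Equiv.sumComm b a))) d).run (ket x x') =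
        if x = x' then ket (F x) (F x) else 0 := by
      intro x x'
      rw [QCirc.run, QCirc.run, hm]
      simp only [Function.comp_id]
      rw [QCirc.run_smul, QCirc.run_smul, h2, hdr]
      simp only [slice_ket, Sum.elim_comp_inl, Sum.elim_comp_inr]
      by_cases hx : x = x'
      · subst hx
        simp [hκ]
      · rw [if_neg hx, Finset.sum_eq_zero, smul_zero]
        intro y _
        exact if_neg fun h => hx (h.1.trans h.2.symm)
    conv_lhs => rw [op_eq_sum_ket ρ]
    simp only [QCirc.run_sum, QCirc.run_smul, h1, smul_ite, smul_zero, Finset.sum_ite_eq,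
      Finset.mem_univ, if_true]

/-- A measured classical computation next to a quantum register. -/
lemma exists_classical_right {a b : Type} [Fintype a] [Fintype b] [DecidableEq a] {s : ℕ}
    (F : Reg a → Reg b) (hF : ∀ j, BitCost s fun x => F x j) (c : Type) :
    ∃ q : QCirc (a ⊕ c) (b ⊕ c), q.size ≤ Fintype.card b * s + Fintype.card a ∧
        ∀ ρ, q.run ρ = ∑ x, put (F x) (slice x ρ) := by
  classical
  obtain ⟨q, hq, hr⟩ := exists_classical F hF
  refine ⟨q.padRight c, by simpa using hq, fun ρ => block_ext fun y y' => ?_⟩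
  rw [block_sum]
  ext u v
  have := QCirc.padRight_apply q c ρ y y' u v
  rw [block, Matrix.of_apply, this, hr, Matrix.sum_apply, Matrix.sum_apply]
  refine Finset.sum_congr rfl fun x _ => ?_
  rw [block_put]
  simp only [Matrix.smul_apply, Matrix.of_apply, ket, smul_eq_mul, mul_ite, mul_one, mul_zero]
  split_ifs <;> rfl

end ClassicalCircuits

section Sampling

/-! ### Sampling a random Clifford together with its description -/

lemma QCirc.run_seq {a b c : Type} (f : QCirc a b) (g : QCirc b c) (ρ : Op (Reg a)) :
    (QCirc.seq f g).run ρ = g.run (f.run ρ) := rfl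

/-- The product state `τ ⊗ ρ`. -/
def tens {c a : Type} (τ : Op (Reg c)) (ρ : Op (Reg a)) : Op (Reg (c ⊕ a)) :=
  Matrix.of fun u v => τ (u ∘ Sum.inl) (v ∘ Sum.inl) * ρ (u ∘ Sum.inr) (v ∘ Sum.inr)

lemma QCirc.padRight_tens {a b c : Type} (q : QCirc a b) (τ : Op (Reg a)) (ρ : Op (Reg c)) :
    (q.padRight c).run (tens τ ρ) = tens (q.run τ) ρ := by
  ext x y
  have h := QCirc.padRight_apply q c (tens τ ρ) (x ∘ Sum.inl) (y ∘ Sum.inl) (x ∘ Sum.inr)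
    (y ∘ Sum.inr)
  rw [Sum.elim_comp_inl_inr, Sum.elim_comp_inl_inr] at h
  rw [h]
  have h2 : (Matrix.of fun s t => tens τ ρ (Sum.elim s (x ∘ Sum.inr)) (Sum.elim t (y ∘ Sum.inr))) =
      ρ (x ∘ Sum.inr) (y ∘ Sum.inr) • τ := by
    ext s t
    simp only [tens, Matrix.of_apply, Matrix.smul_apply, smul_eq_mul, mul_comm]
    rfl
  rw [h2, QCirc.run_smul]
  simp only [tens, Matrix.of_apply, Matrix.smul_apply, smul_eq_mul, mul_comm]

lemma tens_ket {c a : Type} [Fintype c] (y : Reg c) (ρ : Op (Reg a)) :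
    tens (ket y y) ρ = put y ρ := by
  ext u v
  simp only [tens, ket, put, Matrix.of_apply]
  by_cases h : u ∘ Sum.inl = y ∧ v ∘ Sum.inl = y
  · rw [if_pos h, if_pos h, one_mul]
  · rw [if_neg h, if_neg h, zero_mul]

lemma tens_sum_left {c a κ : Type} (s : Finset κ) (f : κ → Op (Reg c)) (ρ : Op (Reg a)) :
    tens (∑ k ∈ s, f k) ρ = ∑ k ∈ s, tens (f k) ρ := by
  ext u v
  simp [tens, Matrix.sum_apply, Finset.sum_mul]

lemma tens_smul_left {c a : Type} (r : ℂ) (τ : Op (Reg c)) (ρ : Op (Reg a)) :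
    tens (r • τ) ρ = r • tens τ ρ := by
  ext u v
  simp [tens, mul_assoc]

/-- A circuit that computes a classical value on a part of a register. -/
lemma QCirc.padRight_put {a b c : Type} [Fintype a] [Fintype b] {q : QCirc a b} {x : Reg a}
    {y : Reg b} (h : q.run (ket x x) = ket y y) (ρ : Op (Reg c)) :
    (q.padRight c).run (put x ρ) = put y ρ := by
  rw [← tens_ket, QCirc.padRight_tens, h, tens_ket]

lemma relabel_assoc_symm_put {c d a : Type} [Fintype c] [Fintype d] (y : Reg c) (z : Reg d)
    (ρ : Op (Reg a)) : (QCirc.relabel (Equiv.sumAssoc c d a).symm).run (put y (put z ρ)) =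
      put (Sum.elim y z) ρ := by
  ext u v
  simp only [QCirc.run, put, Matrix.submatrix_apply, Matrix.of_apply]
  have h : ∀ u : Reg ((c ⊕ d) ⊕ a), u ∘ Sum.inl = Sum.elim y z ↔
      (u ∘ (Equiv.sumAssoc c d a).symm) ∘ Sum.inl = y ∧
        ((u ∘ (Equiv.sumAssoc c d a).symm) ∘ Sum.inr) ∘ Sum.inl = z := by
    intro u
    constructor
    · intro h
      exact ⟨funext fun k => congrFun h (.inl k), funext fun k => congrFun h (.inr k)⟩
    · rintro ⟨h1, h2⟩
      funext k
      rcases k with k | k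
      · exact congrFun h1 k
      · exact congrFun h2 k
  by_cases h1 : u ∘ Sum.inl = Sum.elim y z ∧ v ∘ Sum.inl = Sum.elim y z
  · rw [if_pos h1]
    have h2 := (h u).1 h1.1
    have h3 := (h v).1 h1.2
    rw [if_pos ⟨h2.1, h3.1⟩, if_pos ⟨h2.2, h3.2⟩]
    rfl
  · rw [if_neg h1]
    split_ifs with h2 h3
    · exact absurd ⟨(h u).2 ⟨h2.1, h3.1⟩, (h v).2 ⟨h2.2, h3.2⟩⟩ h1
    · rfl
    · rfl

lemma relabel_symm_run {a b : Type} (e : a ≃ b) (ρ : Op (Reg a)) :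
    (QCirc.relabel e.symm).run ((QCirc.relabel e).run ρ) = ρ := by
  ext u v
  simp only [QCirc.run, Matrix.submatrix_apply]
  congr 1 <;> (funext k; simp)

lemma relabel_assoc_put {c d a : Type} [Fintype c] [Fintype d] (y : Reg c) (z : Reg d)
    (ρ : Op (Reg a)) : (QCirc.relabel (Equiv.sumAssoc c d a)).run (put (Sum.elim y z) ρ) =
      put y (put z ρ) := by
  rw [← relabel_assoc_symm_put]
  exact relabel_symm_run (Equiv.sumAssoc c d a).symm _

/-! #### Random bits -/

/-- A new qubit is rotated from `|0⟩` to an equal superposition and measured. -/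
lemma exists_random_bit (a : Type) : ∃ q : QCirc a (Unit ⊕ a), q.size ≤ 5 ∧
    ∀ ρ, q.run ρ = (1 / 2 : ℂ) • ∑ y : Reg Unit, put y ρ := by
  classical
  let U : Matrix.unitaryGroup (Reg (Fin 1)) ℂ :=
    ⟨rot ((fun _ => 1), 0) 0, rot_mem_unitary _ _⟩
  -- The rotation about `X` maps `|0⟩` to a superposition of equal weights.
  have hU : ∀ x : Reg (Fin 1), (U : Op (Reg (Fin 1))) x 0 * star ((U : Op (Reg (Fin 1))) x 0) =
      1 / 2 := by
    intro x
    have h1 : (U : Op (Reg (Fin 1))) x 0 = (Real.sqrt 2 : ℂ)⁻¹ *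
        ((if x = 0 then 1 else 0) + Complex.I * (if x = fun _ => 1 then 1 else 0)) := by
      simp [U, rot, hp_eq, hphase, loc, pauli_apply, Matrix.one_apply]
    rw [h1, star_mul', star_inv_sqrt_two, mul_mul_mul_comm, inv_sqrt_two_sq]
    have hx : x = fun _ => x 0 := funext fun k => by rw [Subsingleton.elim k 0]
    rcases zmod_two_cases (x 0) with h0 | h0
    · have hx0 : x = 0 := by rw [hx, h0]; rfl
      have h01 : (0 : Reg (Fin 1)) ≠ fun _ => 1 := fun h => zero_ne_one (congrFun h 0)
      simp [hx0, h01]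
    · have hx1 : x = fun _ => 1 := by rw [hx, h0]
      have h01 : (fun _ => 1 : Reg (Fin 1)) ≠ 0 := fun h => one_ne_zero (congrFun h 0)
      simp [hx1, h01]
  let e : Unit ⊕ a ≃ Fin 1 ⊕ a := Equiv.sumCongr (Equiv.ofUnique Unit (Fin 1)) (Equiv.refl a)
  obtain ⟨d, hd, hdr⟩ := exists_classical_right (a := Unit) (b := Unit) (s := 2) (fun x => x)
    (fun j => bitCost_var j) a
  refine ⟨.seq (.seq .alloc (.seq (.seq (.relabel e) (.gate 1 (by norm_num) U)) (.relabel e.symm)))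
    d, ?_, fun ρ => ?_⟩
  · simp only [QCirc.size, Fintype.card_unit] at hd ⊢; omega
  · rw [QCirc.run, hdr, Finset.smul_sum]
    refine Finset.sum_congr rfl fun y _ => ?_
    rw [← put_smul]
    congr 1
    ext u v
    simp only [slice, QCirc.run, Matrix.submatrix_apply, Matrix.of_apply, Matrix.smul_apply,
      smul_eq_mul]
    have h2 : ∀ (p : Reg (Fin 1)) (u : Reg a),
        (Sum.elim p (((Sum.elim y u) ∘ e.symm) ∘ Sum.inr) ∘ e) = Sum.elim (fun _ => p 0) u := by
      intro p u
      funext k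
      rcases k with k | k
      · simp [e]
      · simp [e]
    simp only [h2, Sum.elim_inl]
    have h3 : ∀ p : Reg (Fin 1), p 0 = 0 ↔ p = 0 := fun p =>
      ⟨fun h => funext fun k => by rw [Subsingleton.elim k 0]; exact h, fun h => by rw [h]; rfl⟩
    simp only [h3, ite_and, mul_ite, ite_mul, mul_zero, zero_mul]
    rw [Finset.sum_eq_single 0 ?_ (by simp), Finset.sum_eq_single 0 ?_ (by simp)]
    · simp only [if_true]
      have h4 := hU ((Sum.elim y u ∘ e.symm) ∘ Sum.inl)
      have h5 : (Sum.elim y v ∘ e.symm) ∘ Sum.inl = (Sum.elim y u ∘ e.symm) ∘ Sum.inl := rfl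
      rw [h5]
      simp only [Sum.elim_comp_inr]
      linear_combination (ρ u v) * h4
    · intro p _ hp
      simp [hp]
    · intro p _ hp
      simp [hp]

/-- A register of uniformly random bits. -/
lemma exists_random (c : Type) [Fintype c] : ∀ [DecidableEq c] (a : Type),
    ∃ q : QCirc a (c ⊕ a), q.size ≤ 5 * Fintype.card c ∧
      ∀ ρ, q.run ρ = (1 / 2 ^ Fintype.card c : ℂ) • ∑ y, put y ρ := by
  refine Fintype.induction_empty_option (P := fun c _ => ∀ [DecidableEq c] (a : Type),
    ∃ q : QCirc a (c ⊕ a), q.size ≤ 5 * Fintype.card c ∧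
      ∀ ρ, q.run ρ = (1 / 2 ^ Fintype.card c : ℂ) • ∑ y, put y ρ) ?_ ?_ ?_ c
  · intro b c _ ε ih _ a
    let _ : DecidableEq b := ε.decidableEq
    let _ : Fintype b := Fintype.ofEquiv c ε.symm
    obtain ⟨q, hq, hr⟩ := ih a
    refine ⟨.seq q (.relabel (Equiv.sumCongr ε (Equiv.refl a))), ?_, fun ρ => ?_⟩
    · simpa [QCirc.size, ← Fintype.card_congr ε] using hq
    · rw [QCirc.run, hr, QCirc.run_smul, QCirc.run_sum, ← Fintype.card_congr ε]
      congr 1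
      refine Fintype.sum_equiv (Equiv.arrowCongr ε (Equiv.refl _)) _ _ fun y => ?_
      refine block_ext fun z z' => ?_
      rw [block_put]
      have h1 : block z z' ((QCirc.relabel (Equiv.sumCongr ε (Equiv.refl a))).run (put y ρ)) =
          block (z ∘ ε) (z' ∘ ε) (put y ρ) := by
        ext u v
        simp only [block, QCirc.run, Matrix.of_apply, Matrix.submatrix_apply]
        congr 1 <;> (funext k; rcases k with k | k <;> rfl)
      have h2 : ∀ z : Reg c, z ∘ ε = y ↔ z = Equiv.arrowCongr ε (Equiv.refl _) y := by
        intro z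
        constructor
        · rintro rfl; funext k; simp
        · rintro rfl; funext k; simp
      rw [h1, block_put]
      simp only [h2]
  · intro _ a
    refine ⟨.relabel (Equiv.emptySum PEmpty a).symm, by simp [QCirc.size], fun ρ => ?_⟩
    rw [Fintype.sum_unique]
    refine block_ext fun z z' => ?_
    rw [block_smul, block_put, if_pos ⟨Subsingleton.elim _ _, Subsingleton.elim _ _⟩]
    simp only [Fintype.card_pempty, pow_zero, div_one, one_smul]
    rfl
  · intro c _ ih _ a
    let _ : DecidableEq c := Classical.decEq c
    obtain ⟨q, hq, hr⟩ := ih a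
    obtain ⟨q', hq', hr'⟩ := exists_random_bit (c ⊕ a)
    refine ⟨.seq (.seq q q') (.relabel (optionSum c a)), ?_, fun ρ => ?_⟩
    · simp only [QCirc.size, Fintype.card_option]; omega
    · rw [QCirc.run_seq, QCirc.run_seq, hr, hr', QCirc.run_smul, QCirc.run_sum,
        Fintype.card_option]
      simp only [put_smul, put_sum, QCirc.run_smul, QCirc.run_sum]
      rw [sum_reg_option, ← Finset.smul_sum, smul_smul,
        show (1 : ℂ) / 2 * (1 / 2 ^ Fintype.card c) = 1 / 2 ^ (Fintype.card c + 1) by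
          rw [pow_succ]; field_simp]
      congr 1
      rw [← (Equiv.funUnique Unit (ZMod 2)).symm.sum_comp]
      refine Finset.sum_congr rfl fun b _ => Finset.sum_congr rfl fun y _ => ?_
      refine block_ext fun z z' => ?_
      have h1 : block z z' ((QCirc.relabel (optionSum c a)).run
          (put ((Equiv.funUnique Unit (ZMod 2)).symm b) (put y ρ))) =
          block (fun j => z (some j)) (fun j => z' (some j)) (block (fun _ => z none)
            (fun _ => z' none) (put ((Equiv.funUnique Unit (ZMod 2)).symm b) (put y ρ))) := by
        ext u v
        simp only [block, QCirc.run, Matrix.of_apply, Matrix.submatrix_apply]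
        congr 1 <;> (funext k; rcases k with k | k | k <;> rfl)
      have h2 : ∀ z : Reg (Option c), z = (fun o => o.elim b y) ↔
          (fun _ => z none) = (Equiv.funUnique Unit (ZMod 2)).symm b ∧
            (fun j => z (some j)) = y := by
        intro z
        constructor
        · rintro rfl; exact ⟨rfl, rfl⟩
        · rintro ⟨h1, h2⟩
          funext o
          rcases o with _ | j
          · exact congrFun h1 ()
          · exact congrFun h2 j
      rw [h1, block_put, block_put]
      by_cases hz : (fun _ => z none) = (Equiv.funUnique Unit (ZMod 2)).symm b ∧
        (fun _ => z' none) = (Equiv.funUnique Unit (ZMod 2)).symm b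
      · rw [if_pos hz, block_put]
        congr 1
        rw [h2, h2]
        simp [hz.1, hz.2]
      · rw [if_neg hz, block_zero, if_neg]
        rintro ⟨h3, h4⟩
        exact hz ⟨((h2 z).1 h3).1, ((h2 z').1 h4).1⟩

end Sampling

section ControlledWords

/-! ### Controlled words of rotations and their tableaux -/

variable {ι : Type} [Fintype ι] [DecidableEq ι] {K : Type} [Fintype K] [DecidableEq K]

/-- The operator that applies `R β` to the second register if the first one holds `β`. -/
def bdiag (R : Reg K → Op (Reg ι)) : Op (Reg (K ⊕ ι)) :=
  Matrix.of fun y x =>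
    if y ∘ Sum.inl = x ∘ Sum.inl then R (x ∘ Sum.inl) (y ∘ Sum.inr) (x ∘ Sum.inr) else 0

lemma block_bdiag (R : Reg K → Op (Reg ι)) (z z' : Reg K) :
    block z z' (bdiag R) = if z = z' then R z' else 0 := by
  by_cases h : z = z'
  · rw [if_pos h]; ext u v; exact if_pos h
  · rw [if_neg h]; ext u v; exact if_neg h

lemma block_mul (M N : Op (Reg (K ⊕ ι))) (z z' : Reg K) :
    block z z' (M * N) = ∑ y, block z y M * block y z' N := by
  ext u v
  simp only [block, Matrix.of_apply, Matrix.mul_apply, Matrix.sum_apply]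
  rw [← Fintype.sum_prod_type']
  refine Fintype.sum_equiv (Equiv.sumArrowEquivProdArrow _ _ _) _ _ fun x => ?_
  change _ = M _ (Sum.elim (x ∘ Sum.inl) (x ∘ Sum.inr)) * N (Sum.elim (x ∘ Sum.inl) (x ∘ Sum.inr)) _
  rw [Sum.elim_comp_inl_inr]

lemma block_conjTranspose (M : Op (Reg (K ⊕ ι))) (z z' : Reg K) :
    block z z' Mᴴ = (block z' z M)ᴴ := rfl

lemma bdiag_conj_put (R : Reg K → Op (Reg ι)) (β : Reg K) (σ : Op (Reg ι)) :
    bdiag R * put β σ * (bdiag R)ᴴ = put β (R β * σ * (R β)ᴴ) := by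
  refine block_ext fun z z' => ?_
  simp only [block_mul, block_conjTranspose, block_bdiag, block_put]
  by_cases h : z = β
  · subst h
    by_cases h' : z' = z
    · subst h'
      simp [ite_and]
    · simp [h', ite_and]
  · simp [h, ite_and]

lemma bdiag_mem_unitary {R : Reg K → Op (Reg ι)}
    (hR : ∀ β, R β ∈ Matrix.unitaryGroup (Reg ι) ℂ) :
    bdiag R ∈ Matrix.unitaryGroup (Reg (K ⊕ ι)) ℂ := by
  refine Matrix.mem_unitaryGroup_iff.2 (block_ext fun z z' => ?_)
  have h1 : block z z' (1 : Op (Reg (K ⊕ ι))) = if z = z' then 1 else 0 := by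
    ext u v
    have : Sum.elim z u = Sum.elim z' v ↔ z = z' ∧ u = v := by
      constructor
      · intro h
        exact ⟨funext fun k => congrFun h (.inl k), funext fun k => congrFun h (.inr k)⟩
      · rintro ⟨rfl, rfl⟩; rfl
    simp only [block, Matrix.of_apply, Matrix.one_apply, this]
    by_cases h : z = z' <;> simp [h, Matrix.one_apply]
  rw [h1, Matrix.star_eq_conjTranspose, block_mul]
  simp only [block_conjTranspose, block_bdiag]
  by_cases h : z = z'
  · subst h
    simp [unitary_mul_star (hR z)]
  · rw [if_neg h, Finset.sum_eq_zero]
    intro y _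
    by_cases hy : z = y
    · subst hy; simp [Ne.symm h]
    · simp [hy]

lemma localOn_of_restrict {a : Type} [DecidableEq a] {s : Finset a} {M : Op (Reg a)}
    (h1 : ∀ y x, (∀ v ∉ s, y v = x v) →
      M y x = M (fun v => if v ∈ s then y v else 0) (fun v => if v ∈ s then x v else 0))
    (h2 : ∀ y x, M y x ≠ 0 → ∀ v ∉ s, y v = x v) : LocalOn s M := by
  refine ⟨fun p p' => M (fun v => if h : v ∈ s then p ⟨v, h⟩ else 0)
    (fun v => if h : v ∈ s then p' ⟨v, h⟩ else 0), fun y x => ⟨fun h => ?_, fun h => ?_⟩⟩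
  · rw [h1 y x h]
    congr 1
  · by_contra hne
    exact h (h2 y x hne)

/-- The entries of a rotation depend only on the qubits in the support of its Pauli. -/
lemma rot_restrict {u : Reg ι × Reg ι} {ε : ZMod 2} {s : Finset ι} (hs : supp u ⊆ s)
    {y x : Reg ι} (h : ∀ v ∉ s, y v = x v) : rot u ε y x =
      rot u ε (fun v => if v ∈ s then y v else 0) (fun v => if v ∈ s then x v else 0) := by
  have hu : ∀ v ∉ s, u.1 v = 0 ∧ u.2 v = 0 := by
    intro v hv
    have := mt mem_supp.2 (fun h => hv (hs h))
    simpa only [not_or, not_not] using this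
  have e1 : ∀ w : Reg ι, (∀ v ∉ s, w v = 0) → (y = x + w ↔
      (fun v => if v ∈ s then y v else 0) = (fun v => if v ∈ s then x v else 0) + w) := by
    intro w hw
    constructor
    · rintro rfl
      funext v
      by_cases hv : v ∈ s <;> simp [hv, hw]
    · intro h'
      funext v
      by_cases hv : v ∈ s
      · simpa [hv] using congrFun h' v
      · simp [h v hv, hw v hv]
  have e2 : u.2 ⬝ᵥ x = u.2 ⬝ᵥ (fun v => if v ∈ s then x v else 0) := by
    simp only [dotProduct]
    refine Finset.sum_congr rfl fun v _ => ?_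
    by_cases hv : v ∈ s <;> simp [hv, hu]
  have e0 := e1 0 fun _ _ => rfl
  rw [add_zero, add_zero] at e0
  simp only [rot, hp_eq, Matrix.smul_apply, Matrix.add_apply, pauli_apply, Matrix.one_apply, e0,
    e1 u.1 fun v hv => (hu v hv).1, e2]

/-- A rotation does not change the qubits outside the support of its Pauli. -/
lemma rot_agree {u : Reg ι × Reg ι} {ε : ZMod 2} {y x : Reg ι} (h : rot u ε y x ≠ 0) :
    ∀ v ∉ supp u, y v = x v := by
  intro v hv
  have hu : u.1 v = 0 := by
    have := mt mem_supp.2 hv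
    simp only [not_or, not_not] at this
    exact this.1
  by_contra hne
  refine h ?_
  have h1 : y ≠ x := fun h => hne (congrFun h v)
  have h2 : y ≠ x + u.1 := fun h => hne (by rw [h]; simp [hu])
  simp [rot, hp_eq, pauli_apply, h1, h2]

/-- The rotation of a word, switched on by a control bit. -/
def ctrlRot (p : K × LocalRot ι) (β : Reg K) : Op (Reg ι) :=
  if β p.1 = 1 then rot p.2.1.1 p.2.1.2 else 1

lemma ctrlRot_mem_unitary (p : K × LocalRot ι) (β : Reg K) :
    ctrlRot p β ∈ Matrix.unitaryGroup (Reg ι) ℂ := by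
  rw [ctrlRot]
  split_ifs
  · exact rot_mem_unitary _ _
  · exact one_mem _

lemma ctrlRot_conjTranspose (p : K × LocalRot ι) (β : Reg K) : (ctrlRot p β)ᴴ =
    ctrlRot (p.1, ⟨(p.2.1.1, p.2.1.2 + 1), p.2.2⟩) β := by
  rw [ctrlRot, ctrlRot]
  split_ifs
  · exact rot_conjTranspose _ _
  · exact Matrix.conjTranspose_one

/-- A controlled local rotation acts on at most three wires. -/
lemma exists_ctrlRot_gate (p : K × LocalRot ι) : ∃ q : QCirc (K ⊕ ι) (K ⊕ ι), q.size = 1 ∧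
    ∀ β σ, q.run (put β σ) = put β (ctrlRot p β * σ * (ctrlRot p β)ᴴ) := by
  let s : Finset (K ⊕ ι) := insert (.inl p.1) ((supp p.2.1.1).map Function.Embedding.inr)
  have hs : s.card ≤ 3 := by
    refine (Finset.card_insert_le _ _).trans ?_
    rw [Finset.card_map]
    have := p.2.2
    omega
  have hin : ∀ v, (Sum.inr v : K ⊕ ι) ∈ s ↔ v ∈ supp p.2.1.1 := by simp [s]
  have hk : (Sum.inl p.1 : K ⊕ ι) ∈ s := by simp [s]
  suffices hloc : LocalOn s (bdiag (ctrlRot p)) by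
    obtain ⟨q, hq, hr⟩ := exists_gate hs (bdiag_mem_unitary (ctrlRot_mem_unitary p)) hloc
    exact ⟨q, hq, fun β σ => by rw [hr, bdiag_conj_put]⟩
  refine localOn_of_restrict (fun y x h => ?_) (fun y x h v hv => ?_)
  · have h1 : y ∘ Sum.inl = x ∘ Sum.inl ↔
        (fun v => if v ∈ s then y v else 0) ∘ Sum.inl =
          (fun v => if v ∈ s then x v else 0) ∘ Sum.inl := by
      constructor
      · intro h'
        funext k
        have := congrFun h' k
        simp only [Function.comp_apply] at this ⊢
        rw [this]
      · intro h'
        funext k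
        have := congrFun h' k
        simp only [Function.comp_apply] at this ⊢
        by_cases hks : (Sum.inl k : K ⊕ ι) ∈ s
        · simpa [hks] using this
        · exact h _ hks
    simp only [bdiag, Matrix.of_apply, ← h1]
    congr 1
    have h2 : ∀ w : Reg (K ⊕ ι), (fun v => if v ∈ s then w v else 0) ∘ Sum.inr =
        fun v => if v ∈ supp p.2.1.1 then (w ∘ Sum.inr) v else 0 := by
      intro w; funext v; simp only [Function.comp_apply, hin]
    rw [h2, h2]
    simp only [ctrlRot, Function.comp_apply, hk, if_true]
    split_ifs with hx
    · exact rot_restrict le_rfl fun v hv => h _ (fun h' => hv ((hin v).1 h'))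
    · simp only [Matrix.one_apply]
      congr 1
      refine propext ⟨fun h' => funext fun v => ?_, fun h' => funext fun v => ?_⟩
      · rw [show y (Sum.inr v) = x (Sum.inr v) from congrFun h' v]
      by_cases hv : v ∈ supp p.2.1.1
      · simpa [hv] using congrFun h' v
      · exact h _ (fun h' => hv ((hin v).1 h'))
  · simp only [bdiag, Matrix.of_apply] at h
    split_ifs at h with h1
    · rcases v with k | v
      · exact congrFun h1 k
      · rw [ctrlRot] at h
        split_ifs at h with h2
        · exact rot_agree h v (fun h' => hv ((hin v).2 h'))
        · have h3 : y ∘ Sum.inr = x ∘ Sum.inr := by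
            by_contra hne
            exact h (Matrix.one_apply_ne hne)
          exact congrFun h3 v
    · exact absurd rfl h

/-- The unitary of a word of controlled rotations. -/
def wordMat (l : List (K × LocalRot ι)) (β : Reg K) : Op (Reg ι) :=
  (l.map fun p => ctrlRot p β).prod

/-- The inverse of a word of controlled rotations as a circuit. -/
lemma exists_word_circuit (l : List (K × LocalRot ι)) : ∃ q : QCirc (K ⊕ ι) (K ⊕ ι),
    q.size = l.length ∧
      ∀ β σ, q.run (put β σ) = put β ((wordMat l β)ᴴ * σ * wordMat l β) := by
  induction l with
  | nil =>
    refine ⟨.relabel (Equiv.refl _), rfl, fun β σ => ?_⟩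
    simp only [wordMat, List.map_nil, List.prod_nil, Matrix.conjTranspose_one, Matrix.one_mul,
      Matrix.mul_one]
    rfl
  | cons p l ih =>
    obtain ⟨q, hq, hr⟩ := ih
    obtain ⟨g, hg, hgr⟩ := exists_ctrlRot_gate (p.1, ⟨(p.2.1.1, p.2.1.2 + 1), p.2.2⟩)
    refine ⟨.seq g q, by simp [QCirc.size, hq, hg, add_comm], fun β σ => ?_⟩
    rw [QCirc.run_seq, hgr, hr, ← ctrlRot_conjTranspose, Matrix.conjTranspose_conjTranspose]
    congr 1
    simp only [wordMat, List.map_cons, List.prod_cons, Matrix.conjTranspose_mul,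
      Matrix.mul_assoc]

/-- The effect of a controlled rotation on a tableau. -/
def tabStep (p : K × LocalRot ι) (β : Reg K) (t : Reg (TabIdx ι)) : Reg (TabIdx ι) := fun q =>
  if β p.1 = 1 ∧ omega p.2.1.1 (rowVec t q.1) = 1 then
    match q.2 with
    | .inl j => p.2.1.1.1 j + t q
    | .inr (.inl j) => p.2.1.1.2 j + t q
    | .inr (.inr _) => rotSign p.2.1.1 p.2.1.2 (rowVec t q.1) + t q
  else t q

/-- Conjugation by the rotation of a Pauli `u` changes just the rows that anticommute with `u`:
to these, `u` and a sign are added. -/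
lemma describes_tabStep (p : K × LocalRot ι) (β : Reg K) {t : Reg (TabIdx ι)} {U : Op (Reg ι)}
    (h : Describes t U) : Describes (tabStep p β t) (ctrlRot p β * U) := by
  rw [describes_iff] at h ⊢
  intro g
  have h1 : ctrlRot p β * U * hp (genVec g) * (ctrlRot p β * U)ᴴ =
      chi (rowSign t g) • (ctrlRot p β * hp (rowVec t g) * (ctrlRot p β)ᴴ) := by
    rw [Matrix.conjTranspose_mul, show ctrlRot p β * U * hp (genVec g) * (Uᴴ * (ctrlRot p β)ᴴ) =
      ctrlRot p β * (U * hp (genVec g) * Uᴴ) * (ctrlRot p β)ᴴ by simp only [Matrix.mul_assoc], h,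
      Matrix.mul_smul, Matrix.smul_mul]
  rw [h1]
  by_cases hβ : β p.1 = 1
  · rw [ctrlRot, if_pos hβ]
    rcases zmod_two_cases (omega p.2.1.1 (rowVec t g)) with h0 | h0
    · rw [rot_conj_of_omega_zero _ h0]
      have : ∀ q, tabStep p β t (g, q) = t (g, q) := fun q =>
        if_neg fun h' => zero_ne_one (h0.symm.trans h'.2)
      simp only [rowSign, rowVec, this]
    · rw [rot_conj_of_omega_one _ h0, smul_smul, ← chi_add]
      have : ∀ q, tabStep p β t (g, q) = match q with
          | .inl j => p.2.1.1.1 j + t (g, q)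
          | .inr (.inl j) => p.2.1.1.2 j + t (g, q)
          | .inr (.inr _) => rotSign p.2.1.1 p.2.1.2 (rowVec t g) + t (g, q) := fun q =>
        if_pos ⟨hβ, h0⟩
      have e1 : rowSign (tabStep p β t) g =
          rowSign t g + rotSign p.2.1.1 p.2.1.2 (rowVec t g) := by
        simp only [rowSign, this]; exact add_comm _ _
      have e2 : rowVec (tabStep p β t) g = p.2.1.1 + rowVec t g := by
        simp only [rowVec, this]; rfl
      rw [e1, e2]
  · have : ∀ q, tabStep p β t (g, q) = t (g, q) := fun q => if_neg fun h' => hβ h'.1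
    rw [ctrlRot, if_neg hβ, Matrix.one_mul, Matrix.conjTranspose_one, Matrix.mul_one]
    simp only [rowSign, rowVec, this]

/-- The form `omega u` reads only the support of `u`; so does the sign of a rotation. Hence an
update of the tableau is a computation on boundedly many bits. -/
lemma omega_congr {u v v' : Reg ι × Reg ι} (h : ∀ j ∈ supp u, v.1 j = v'.1 j ∧ v.2 j = v'.2 j) :
    omega u v = omega u v' := by
  simp only [omega, dotProduct]
  congr 1
  · refine Finset.sum_congr rfl fun j _ => ?_
    by_cases hj : j ∈ supp u
    · rw [(h j hj).2]
    · have := mt mem_supp.2 hj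
      simp only [not_or, not_not] at this
      rw [this.1, zero_mul, zero_mul]
  · refine Finset.sum_congr rfl fun j _ => ?_
    by_cases hj : j ∈ supp u
    · rw [(h j hj).1]
    · have := mt mem_supp.2 hj
      simp only [not_or, not_not] at this
      rw [this.2, zero_mul, zero_mul]

lemma rotSign_congr {u v v' : Reg ι × Reg ι} (ε : ZMod 2)
    (h : ∀ j ∈ supp u, v.1 j = v'.1 j ∧ v.2 j = v'.2 j) : rotSign u ε v = rotSign u ε v' := by
  have : lam u v = lam u v' := by
    refine Finset.prod_congr rfl fun j _ => ?_
    by_cases hj : j ∈ supp u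
    · rw [(h j hj).1, (h j hj).2]
    · have := mt mem_supp.2 hj
      simp only [not_or, not_not] at this
      rw [this.1, this.2, lamLoc_zero, lamLoc_zero]
  rw [rotSign, rotSign, this]

/-- Each bit of the updated tableau depends on at most six bits. -/
lemma bitCost_tabStep (p : K × LocalRot ι) (q : TabIdx ι) :
    BitCost 1408 (fun z : Reg (K ⊕ TabIdx ι) => tabStep p (z ∘ Sum.inl) (z ∘ Sum.inr) q) := by
  let s : Finset (K ⊕ TabIdx ι) := {.inl p.1, .inr q} ∪
    ((supp p.2.1.1).image (fun j => .inr (q.1, .inl j)) ∪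
      (supp p.2.1.1).image (fun j => .inr (q.1, .inr (.inl j))))
  have hs : s.card ≤ 6 := by
    have h1 := Finset.card_union_le ({.inl p.1, .inr q} : Finset (K ⊕ TabIdx ι))
      ((supp p.2.1.1).image (fun j => .inr (q.1, .inl j)) ∪
        (supp p.2.1.1).image (fun j => .inr (q.1, .inr (.inl j))))
    have h2 := Finset.card_union_le
      ((supp p.2.1.1).image (fun j => (.inr (q.1, .inl j) : K ⊕ TabIdx ι)))
      ((supp p.2.1.1).image (fun j => .inr (q.1, .inr (.inl j))))
    have h3 : ((supp p.2.1.1).image (fun j => (.inr (q.1, .inl j) : K ⊕ TabIdx ι))).card ≤ 2 :=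
      Finset.card_image_le.trans p.2.2
    have h4 : ((supp p.2.1.1).image
        (fun j => (.inr (q.1, .inr (.inl j)) : K ⊕ TabIdx ι))).card ≤ 2 :=
      Finset.card_image_le.trans p.2.2
    have h5 : ({.inl p.1, .inr q} : Finset (K ⊕ TabIdx ι)).card ≤ 2 := Finset.card_le_two
    change Finset.card (_ ∪ _) ≤ 6
    omega
  refine (bitCost_of_dependsOn s _ fun z z' hz => ?_).mono ?_
  · have hk : z (.inl p.1) = z' (.inl p.1) := hz _ (by simp [s])
    have hq : z (.inr q) = z' (.inr q) := hz _ (by simp [s])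
    have hrow : ∀ j ∈ supp p.2.1.1, (rowVec (z ∘ Sum.inr) q.1).1 j =
        (rowVec (z' ∘ Sum.inr) q.1).1 j ∧
        (rowVec (z ∘ Sum.inr) q.1).2 j = (rowVec (z' ∘ Sum.inr) q.1).2 j := by
      intro j hj
      refine ⟨hz _ ?_, hz _ ?_⟩
      · refine Finset.mem_union_right _ (Finset.mem_union_left _ (Finset.mem_image_of_mem _ hj))
      · refine Finset.mem_union_right _ (Finset.mem_union_right _
          (Finset.mem_image_of_mem (fun j => (.inr (q.1, .inr (.inl j)) : K ⊕ TabIdx ι)) hj))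
    simp only [tabStep, Function.comp_apply, hk, hq, omega_congr hrow, rotSign_congr _ hrow]
  · calc 22 * 2 ^ s.card ≤ 22 * 2 ^ 6 := by gcongr; norm_num
      _ = 1408 := by norm_num

/-- The tableau of a word of controlled rotations. -/
def wordTab (l : List (K × LocalRot ι)) (β : Reg K) : Reg (TabIdx ι) :=
  l.foldr (fun p t => tabStep p β t) (description (1 : Op (Reg ι)))

lemma describes_wordTab (l : List (K × LocalRot ι)) (β : Reg K) :
    Describes (wordTab l β) (wordMat l β) := by
  induction l with
  | nil => exact isClifford_one.describes_description
  | cons p l ih => exact describes_tabStep p β ih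

lemma ket_classical {a b : Type} [Fintype a] [DecidableEq a] {q : QCirc a b}
    {F : Reg a → Reg b} (h : ∀ ρ, q.run ρ = ∑ x, ρ x x • ket (F x) (F x)) (x : Reg a) :
    q.run (ket x x) = ket (F x) (F x) := by
  rw [h, Finset.sum_eq_single x, ket_apply_self, one_smul]
  · intro y _ hy
    rw [ket_apply_of_ne (fun h => hy h.1), zero_smul]
  · simp

/-- The tableau of a word of controlled rotations is computed by a small circuit. -/
lemma exists_tab_circuit (l : List (K × LocalRot ι)) : ∃ q : QCirc K (TabIdx ι),
    q.size ≤ (l.length + 2) *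
      ((Fintype.card K + Fintype.card (TabIdx ι)) * 1409) ∧
      ∀ β, q.run (ket β β) = ket (wordTab l β) (wordTab l β) := by
  have main : ∀ l : List (K × LocalRot ι), ∃ q : QCirc K (K ⊕ TabIdx ι),
      q.size ≤ (l.length + 1) * ((Fintype.card K + Fintype.card (TabIdx ι)) * 1409) ∧
      ∀ β, q.run (ket β β) = ket (Sum.elim β (wordTab l β)) (Sum.elim β (wordTab l β)) := by
    intro l
    induction l with
    | nil =>
      -- The tableau of the identity is a constant.
      obtain ⟨q, hq, hr⟩ := exists_classical (s := 6)
        (fun β : Reg K => (Sum.elim β (wordTab [] β) : Reg (K ⊕ TabIdx ι))) (by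
          rintro (k | k)
          · exact (bitCost_var k).mono (by norm_num)
          · exact bitCost_const _)
      refine ⟨q, hq.trans ?_, ket_classical hr⟩
      rw [Fintype.card_sum, List.length_nil]
      ring_nf; omega
    | cons p l ih =>
      obtain ⟨q, hq, hr⟩ := ih
      obtain ⟨g, hg, hgr⟩ := exists_classical (s := 1408)
        (fun z : Reg (K ⊕ TabIdx ι) => (Sum.elim (z ∘ Sum.inl)
          (tabStep p (z ∘ Sum.inl) (z ∘ Sum.inr)) : Reg (K ⊕ TabIdx ι))) (by
          rintro (k | k)
          · exact (bitCost_var (Sum.inl k : K ⊕ TabIdx ι)).mono (by norm_num)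
          · exact bitCost_tabStep p k)
      refine ⟨.seq q g, ?_, fun β => ?_⟩
      · rw [Fintype.card_sum] at hg
        simp only [QCirc.size, List.length_cons]
        linarith
      · rw [QCirc.run_seq, hr, ket_classical hgr]
        rfl
  obtain ⟨q, hq, hr⟩ := main l
  -- The random bits, which were kept for the control of the updates, are dropped.
  obtain ⟨g, hg, hgr⟩ := exists_classical (s := 2)
    (fun z : Reg (K ⊕ TabIdx ι) => z ∘ Sum.inr) (fun j => bitCost_var (Sum.inr j))
  refine ⟨.seq q g, ?_, fun β => ?_⟩
  · rw [Fintype.card_sum] at hg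
    simp only [QCirc.size]
    linarith
  · rw [QCirc.run_seq, hr, ket_classical hgr]
    rfl

end ControlledWords

/-! ### Sampling Clifford operators by a circuit -/

section Sampling

variable {ι : Type} [Fintype ι] [DecidableEq ι]

lemma toClifford_ctrlRot {K : Type} [Fintype K] [DecidableEq K] (p : K × LocalRot ι) (β : Reg K) :
    ∃ h : IsClifford (ctrlRot p β), toClifford (ctrlRot p β) h =
      if β p.1 = 1 then rotC p.2.1.1 p.2.1.2 else 1 := by
  by_cases hβ : β p.1 = 1
  · have e : ctrlRot p β = rot p.2.1.1 p.2.1.2 := if_pos hβ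
    refine ⟨e ▸ isClifford_rot _ _, ?_⟩
    rw [if_pos hβ, rotC]
    exact toClifford_congr _ _ e
  · have e : ctrlRot p β = 1 := if_neg hβ
    refine ⟨e ▸ isClifford_one, ?_⟩
    rw [if_neg hβ, ← toClifford_one]
    exact toClifford_congr _ _ e

lemma toClifford_wordMat {K : Type} [Fintype K] [DecidableEq K] (l : List (K × LocalRot ι))
    (β : Reg K) : ∃ h : IsClifford (wordMat l β), toClifford (wordMat l β) h =
      (l.map fun p => if β p.1 = 1 then rotC p.2.1.1 p.2.1.2 else 1).prod := by
  induction l with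
  | nil =>
    refine ⟨isClifford_one, ?_⟩
    exact toClifford_one
  | cons p l ih =>
    obtain ⟨h, e⟩ := ih
    obtain ⟨h', e'⟩ := toClifford_ctrlRot p β
    have hc : wordMat (p :: l) β = ctrlRot p β * wordMat l β := by
      simp [wordMat]
    refine ⟨hc ▸ h'.mul h, ?_⟩
    rw [List.map_cons, List.prod_cons, ← e, ← e', ← toClifford_mul]
    exact toClifford_congr _ _ hc

/-- Random subproducts of words are words of controlled rotations. -/
lemma exists_controlled_word {m L : ℕ} (g : Fin m → Clifford ι) (hg : ∀ k, IsWord L (g k)) :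
    ∃ l : List (Fin m × LocalRot ι), l.length ≤ m * L ∧
      ∀ β, ∃ h : IsClifford (wordMat l β), toClifford (wordMat l β) h = subprod g β := by
  choose f hf hp using hg
  refine ⟨(List.ofFn fun k => (f k).map fun p => (k, p)).flatten, ?_, fun β => ?_⟩
  · rw [List.length_flatten, List.map_ofFn, List.sum_ofFn]
    refine (Finset.sum_le_sum (g := fun _ => L) fun k _ => ?_).trans (by simp)
    simpa using hf k
  · obtain ⟨h, e⟩ := toClifford_wordMat
      (List.ofFn fun k => (f k).map fun p => (k, p)).flatten β
    refine ⟨h, e.trans ?_⟩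
    rw [List.map_flatten, List.prod_flatten, List.map_ofFn, List.map_ofFn, subprod]
    congr 2
    funext k
    simp only [Function.comp_apply, List.map_map]
    by_cases hβ : β k = 1
    · rw [if_pos hβ, ← hp k]
      congr 1
      refine List.map_congr_left fun p _ => ?_
      simp [hβ]
    · rw [if_neg hβ]
      refine List.prod_eq_one fun z hz => ?_
      simp only [List.mem_map, Function.comp_apply, hβ, if_false] at hz
      obtain ⟨_, _, rfl⟩ := hz
      rfl

/-- The state `F† |x⟩⟨x| F`. -/
def twirled (F : Clifford ι) (x : Reg ι) : Op (Reg ι) := F.unitaryᴴ * ket x x * F.unitary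

lemma twirled_toClifford (U : Op (Reg ι)) (hU : IsClifford U) (x : Reg ι) :
    twirled (toClifford U hU) x = Uᴴ * ket x x * U := by
  obtain ⟨φ, hφ, h⟩ := toClifford_unitary_phase hU
  rw [twirled, h, conjTranspose_smul, Matrix.smul_mul, Matrix.smul_mul, Matrix.mul_smul, smul_smul,
    mul_comm, hφ, one_smul]

lemma put_ket {c a : Type} [Fintype c] (y : Reg c) (z : Reg a) :
    put y (ket z z) = ket (Sum.elim y z) (Sum.elim y z) := by
  classical
  ext u v
  have h : ∀ u : Reg (c ⊕ a), u = Sum.elim y z ↔ u ∘ Sum.inl = y ∧ u ∘ Sum.inr = z := by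
    intro u
    constructor
    · rintro rfl; exact ⟨rfl, rfl⟩
    · rintro ⟨rfl, rfl⟩; exact (Sum.elim_comp_inl_inr u).symm
  simp only [put, ket, Matrix.of_apply, h]
  by_cases h1 : u ∘ Sum.inl = y ∧ v ∘ Sum.inl = y
  · rw [if_pos h1]
    simp only [h1.1, h1.2, true_and]
  · rw [if_neg h1, if_neg (fun h2 => h1 ⟨h2.1.1, h2.2.1⟩)]

lemma relabel_sumEmpty_put {c : Type} [Fintype c] (y : Reg c) (σ : Op (Reg Empty)) :
    (QCirc.relabel (Equiv.sumEmpty c Empty)).run (put y σ) = σ default default • ket y y := by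
  classical
  ext u v
  have h : ∀ u : Reg c, (u ∘ Equiv.sumEmpty c Empty) ∘ Sum.inl = u := fun u => rfl
  simp only [QCirc.run_relabel, Matrix.submatrix_apply, put, ket, Matrix.of_apply, h,
    Matrix.smul_apply, smul_eq_mul]
  by_cases h1 : u = y ∧ v = y
  · rw [if_pos h1, if_pos h1, mul_one]
    congr 1 <;> exact Subsingleton.elim _ _
  · rw [if_neg h1, if_neg h1, mul_zero]

lemma relabel_emptySum_symm {c : Type} (ρ : Op (Reg c)) :
    (QCirc.relabel (Equiv.emptySum Empty c).symm).run ρ =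
      tens (ket (default : Reg Empty) default) ρ := by
  ext u v
  simp only [QCirc.run_relabel, Matrix.submatrix_apply, tens, Matrix.of_apply]
  rw [Subsingleton.elim (u ∘ Sum.inl) (default : Reg Empty),
    Subsingleton.elim (v ∘ Sum.inl) (default : Reg Empty), ket_apply_self, one_mul]
  rfl

lemma relabel_assoc_tens_put {c d a : Type} [Fintype c] (y : Reg c) (τ : Op (Reg d))
    (ρ : Op (Reg a)) : (QCirc.relabel (Equiv.sumAssoc c d a)).run (tens (put y τ) ρ) =
      put y (tens τ ρ) := by
  ext u v
  simp only [QCirc.run_relabel, Matrix.submatrix_apply, tens, put, Matrix.of_apply]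
  have h1 : ∀ u : Reg (c ⊕ (d ⊕ a)), ((u ∘ Equiv.sumAssoc c d a) ∘ Sum.inl) ∘ Sum.inl =
    u ∘ Sum.inl := fun u => rfl
  simp only [h1]
  split_ifs with h
  · rfl
  · rw [zero_mul]

/-- The registers `K` (random bits) and `ι` (a random label `x`) are turned into `x`, the tableau
of a Clifford operator `F` and the state `F†|x⟩`. -/
lemma exists_sampling_circuit {K : Type} [Fintype K] [DecidableEq K]
    (l : List (K × LocalRot ι)) :
    ∃ q : QCirc Empty ((ι ⊕ TabIdx ι) ⊕ ι),
      q.size ≤ 9 * (Fintype.card K + Fintype.card ι) + 2 * Fintype.card ι +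
        Fintype.card K + l.length +
        (l.length + 2) * ((Fintype.card K + Fintype.card (TabIdx ι)) * 1409) +
        2 * Fintype.card ι ∧
      q.run (ket default default) = (1 / 2 ^ Fintype.card (K ⊕ ι) : ℂ) • ∑ z : Reg (K ⊕ ι),
        put (Sum.elim (z ∘ Sum.inr) (wordTab l (z ∘ Sum.inl)))
          ((wordMat l (z ∘ Sum.inl))ᴴ * ket (z ∘ Sum.inr) (z ∘ Sum.inr) *
            wordMat l (z ∘ Sum.inl)) := by
  -- Random bits `β` and a random label `x` are drawn, `x` is copied, the inverse of the word
  -- that `β` selects is applied to the copy, and `β` is replaced by the tableau.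
  obtain ⟨q1, h1, r1⟩ := exists_random (K ⊕ ι) Empty
  obtain ⟨q2, h2, r2⟩ := exists_classical (s := 2)
    (fun z : Reg (K ⊕ ι) => (Sum.elim (z ∘ Sum.inr) z : Reg (ι ⊕ (K ⊕ ι)))) (by
      rintro (k | k)
      · exact bitCost_var (Sum.inr k : K ⊕ ι)
      · exact bitCost_var k)
  obtain ⟨q3, h3, r3⟩ := exists_word_circuit l
  obtain ⟨q4, h4, r4⟩ := exists_tab_circuit l
  refine ⟨.seq (.seq (.seq (.seq (.seq q1 (.relabel (Equiv.sumEmpty _ _))) q2) (q3.pad ι))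
    ((q4.padRight ι).pad ι)) (.relabel (Equiv.sumAssoc _ _ _).symm), ?_, ?_⟩
  · simp only [QCirc.size, QCirc.pad_size, QCirc.padRight_size, h3]
    simp only [Fintype.card_sum] at h1 h2
    omega
  · simp only [QCirc.run_seq]
    rw [r1]
    simp only [QCirc.run_smul, QCirc.run_sum]
    congr 1
    refine Finset.sum_congr rfl fun z _ => ?_
    rw [relabel_sumEmpty_put, ket_apply_self, one_smul, ket_classical r2]
    have : ket (Sum.elim (z ∘ Sum.inr) z) (Sum.elim (z ∘ Sum.inr) z) =
        put (z ∘ Sum.inr) (put (z ∘ Sum.inl) (ket (z ∘ Sum.inr) (z ∘ Sum.inr))) := by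
      rw [put_ket, put_ket, Sum.elim_comp_inl_inr]
    rw [this, QCirc.pad_put, r3, QCirc.pad_put, QCirc.padRight_put (r4 _),
      relabel_assoc_symm_put]

/-- The number of elementary operations that are spent on sampling a Clifford operator. -/
def samplingBound (N T n : ℕ) : ℕ :=
  10 * (T + 2 * n + N) + 4 * N +
    (T + 2 * n) * ((4 * N + 2) * (2 * N + 1)) +
    ((T + 2 * n) * ((4 * N + 2) * (2 * N + 1)) + 2) * ((2 * T + 2 * n) * 1409)

/-- A small circuit that prepares a uniformly random label `x`, the description of an almost
uniformly random Clifford operator `F`, and the state `F†|x⟩`. -/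
theorem exists_sampling (ι c : Type) [Fintype ι] [DecidableEq ι] (n : ℕ) :
    ∃ (m : ℕ) (g : Fin m → Clifford ι) (q : QCirc c ((ι ⊕ TabIdx ι) ⊕ (ι ⊕ c))),
      q.size ≤ samplingBound (Fintype.card ι) (Fintype.card (TabIdx ι)) n ∧
      (∀ h : Clifford ι → ℝ, (∀ F, |h F| ≤ 1) → |Finset.expect Finset.univ h -
        Finset.expect Finset.univ fun β => h (subprod g β)| ≤ 1 / 2 ^ n) ∧
      ∀ ρ, q.run ρ = (1 / 2 ^ Fintype.card (Fin m ⊕ ι) : ℂ) • ∑ z : Reg (Fin m ⊕ ι),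
        put (Sum.elim (z ∘ Sum.inr) (subprod g (z ∘ Sum.inl)).1)
          (tens (twirled (subprod g (z ∘ Sum.inl)) (z ∘ Sum.inr)) ρ) := by
  -- A Clifford operator is determined by its tableau, which bounds the order of the group.
  obtain ⟨g, hg⟩ := exists_subprod_close (G := Clifford ι) (Fintype.card (TabIdx ι)) n (by
    refine (Fintype.card_le_of_injective (fun E : Clifford ι => (E.1 : Reg (TabIdx ι)))
      Subtype.val_injective).trans ?_
    simp [ZMod.card])
  obtain ⟨l, hl, hw⟩ := exists_controlled_word g fun k => isWord_clifford (g k)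
  obtain ⟨q, hq, hr⟩ := exists_sampling_circuit l
  refine ⟨_, g, .seq (.seq (.relabel (Equiv.emptySum Empty c).symm) (q.padRight c))
    (.relabel (Equiv.sumAssoc _ _ _)), ?_, hg, fun ρ => ?_⟩
  · simp only [QCirc.size, QCirc.padRight_size]
    refine (by omega : _ ≤ q.size).trans (hq.trans ?_)
    rw [samplingBound, Fintype.card_fin]
    have h1 : (l.length + 2) *
        ((Fintype.card (TabIdx ι) + 2 * n + Fintype.card (TabIdx ι)) * 1409) ≤
        ((Fintype.card (TabIdx ι) + 2 * n) *
          ((4 * Fintype.card ι + 2) * (2 * Fintype.card ι + 1)) + 2) *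
        ((2 * Fintype.card (TabIdx ι) + 2 * n) * 1409) :=
      Nat.mul_le_mul (by omega) (le_of_eq (by ring))
    omega
  · rw [QCirc.run_seq, QCirc.run_seq, relabel_emptySum_symm, QCirc.padRight_tens, hr]
    simp only [tens_smul_left, tens_sum_left, QCirc.run_smul, QCirc.run_sum]
    congr 1
    refine Finset.sum_congr rfl fun z _ => ?_
    obtain ⟨h, e⟩ := hw (z ∘ Sum.inl)
    rw [relabel_assoc_tens_put, ← e, twirled_toClifford]
    congr 2
    -- The tableau that was computed is the description of the subproduct.
    exact describes_unique (describes_wordTab l _) h.describes_description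

end Sampling

/-! ### The final phase of the simulator -/

section Tail

open Classical in
/-- The bits `1` in the register `b` if `v` has a bit that is not `0`, and `0` otherwise. -/
def raise {κ b : Type} (v : Reg κ) : Reg b := fun _ => if ∃ k, v k ≠ 0 then 1 else 0

lemma raise_eq_zero {κ b : Type} {v : Reg κ} (h : v = 0) : (raise v : Reg b) = 0 := by
  funext j
  exact if_neg fun ⟨k, hk⟩ => hk (congrFun h k)

lemma eq_zero_of_raise {κ b : Type} [Nonempty b] {v : Reg κ} (h : (raise v : Reg b) = 0) :
    v = 0 := by
  funext k
  by_contra hk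
  have := congrFun h (Classical.arbitrary b)
  rw [raise, if_pos ⟨k, hk⟩] at this
  exact one_ne_zero this

lemma sum_reg_sum {a b M : Type} [Fintype a] [Fintype b] [DecidableEq a] [DecidableEq b]
    [AddCommMonoid M] (f : Reg (a ⊕ b) → M) :
    ∑ z, f z = ∑ x : Reg a, ∑ y : Reg b, f (Sum.elim x y) := by
  rw [← Fintype.sum_prod_type']
  exact (Equiv.sum_comp (Equiv.sumArrowEquivProdArrow a b (ZMod 2)).symm f).symm

lemma slice_relabel_assoc_symm {c d a : Type} [Fintype c] [DecidableEq c] (y : Reg c)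
    (z : Reg c) (w : Reg d) (σ : Op (Reg (d ⊕ a))) :
    slice (Sum.elim z w) ((QCirc.relabel (Equiv.sumAssoc c d a).symm).run (put y σ)) =
      if z = y then slice w σ else 0 := by
  have h : slice (Sum.elim z w) ((QCirc.relabel (Equiv.sumAssoc c d a).symm).run (put y σ)) =
      slice w (slice z (put y σ)) := by
    ext u v
    simp only [slice, QCirc.run_relabel, Matrix.submatrix_apply]
    congr 1 <;> (funext j; rcases j with j | j | j <;> rfl)
  rw [h, slice_put]
  split_ifs <;> rfl

/-- A classical computation on a known string `y` and the measured register `d`. -/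
lemma classical_after_put {c d a e : Type} [Fintype c] [Fintype d] [Fintype e] [DecidableEq c]
    [DecidableEq d] {q : QCirc ((c ⊕ d) ⊕ a) (e ⊕ a)} {F : Reg (c ⊕ d) → Reg e}
    (h : ∀ ρ, q.run ρ = ∑ z, put (F z) (slice z ρ)) (y : Reg c) (σ : Op (Reg (d ⊕ a))) :
    q.run ((QCirc.relabel (Equiv.sumAssoc c d a).symm).run (put y σ)) =
      ∑ w : Reg d, put (F (Sum.elim y w)) (slice w σ) := by
  rw [h, sum_reg_sum, Finset.sum_eq_single y]
  · simp only [slice_relabel_assoc_symm, if_true]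
  · intro z _ hz
    refine Finset.sum_eq_zero fun w _ => ?_
    rw [slice_relabel_assoc_symm, if_neg hz, put_zero]
  · simp

lemma bitCost_raise {a κ b : Type} [Fintype κ] {s : ℕ} {F : Reg a → Reg κ}
    (hF : ∀ k, BitCost s fun z => F z k) (j : b) :
    BitCost (Fintype.card κ * (s + 4) + 1) (fun z => (raise (F z) : Reg b) j) :=
  (bitCost_exists hF).congr fun z => by
    by_cases h : ∃ k, F z k ≠ 0
    · rw [if_pos h]; exact (if_pos h).symm
    · rw [if_neg h]; exact (if_neg h).symm

/-- The difference of two strings `x` and `a`, followed by two strings of abort bits. -/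
def discrepancy {X B : Type} (z : Reg ((X ⊕ B) ⊕ (X ⊕ B))) : Reg (X ⊕ (B ⊕ B)) :=
  Sum.elim (fun q => z (.inl (.inl q)) + z (.inr (.inl q)))
    (Sum.elim (fun j => z (.inl (.inr j))) (fun j => z (.inr (.inr j))))

/-- The number of elementary operations of the classical control in `exists_tail`. -/
def tailBound (x t b : ℕ) : ℕ :=
  (x + b + t) * (6 * b + 7) + (x + t + b) + (b * ((x + 2 * b) * 12 + 1) + 2 * (x + b))

/-- From a label `x`, a message `t` and the quantum register `D`: the party `resp` is run, and
produces abort bits `b`; it is followed by `att`, which receives the message `t` only if `b = 0`;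
finally all abort bits are raised if `b` or the new abort bits are not `0`, or if the reported
result differs from `x`. -/
lemma exists_tail {X T D B mem fin : Type} [Fintype X] [Fintype T] [Fintype B] [DecidableEq X]
    [DecidableEq T] [DecidableEq B] (resp : QCirc D (B ⊕ mem))
    (att : QCirc (T ⊕ mem) ((X ⊕ B) ⊕ fin)) : ∃ q : QCirc ((X ⊕ T) ⊕ D) (B ⊕ fin),
      q.size ≤ resp.size + att.size +
        tailBound (Fintype.card X) (Fintype.card T) (Fintype.card B) ∧
      ∀ x t ρ, q.run (put (Sum.elim x t) ρ) = ∑ b : Reg B, ∑ a : Reg X, ∑ b' : Reg B,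
        put (raise (Sum.elim (x + a) (Sum.elim b b')))
          (slice (Sum.elim a b') (att.run (put (if b = 0 then t else 0)
            (slice b (resp.run ρ))))) := by
  classical
  -- `q1` keeps `x` and `b`, and replaces the message by `0` if `b ≠ 0`.
  obtain ⟨q1, h1, r1⟩ := exists_classical_right (s := 6 * Fintype.card B + 7)
    (fun z : Reg ((X ⊕ T) ⊕ B) => (Sum.elim (Sum.elim ((z ∘ Sum.inl) ∘ Sum.inl) (z ∘ Sum.inr))
      (if z ∘ Sum.inr = 0 then (z ∘ Sum.inl) ∘ Sum.inr else 0) : Reg ((X ⊕ B) ⊕ T))) (by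
      rintro ((j | j) | j)
      · exact (bitCost_var (Sum.inl (Sum.inl j) : (X ⊕ T) ⊕ B)).mono (by omega)
      · exact (bitCost_var (Sum.inr j : (X ⊕ T) ⊕ B)).mono (by omega)
      · refine (((bitCost_var (Sum.inl (Sum.inr j) : (X ⊕ T) ⊕ B)).op (bitCost_exists fun k : B =>
          bitCost_var (Sum.inr k : (X ⊕ T) ⊕ B)) fun t f => t * (1 + f)).mono
          (by omega)).congr fun z => ?_
        by_cases hz : z ∘ Sum.inr = 0
        · rw [if_neg (fun ⟨k, hk⟩ => hk (congrFun hz k))]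
          simp [hz]
        · have : ∃ k, z (Sum.inr k) ≠ 0 := by
            by_contra h
            push Not at h
            exact hz (funext h)
          rw [if_pos this]
          simp [hz, zmod_two_add_self]) mem
  -- `q2` raises all abort bits unless the discrepancy vanishes.
  obtain ⟨q2, h2, r2⟩ := exists_classical_right
    (s := (Fintype.card X + 2 * Fintype.card B) * 12 + 1)
    (fun z => (raise (discrepancy z) : Reg B)) (fun j => (bitCost_raise (s := 8)
      (F := discrepancy (X := X) (B := B)) (by
      rintro (k | k | k)
      · exact (bitCost_var (Sum.inl (Sum.inl k) : (X ⊕ B) ⊕ (X ⊕ B))).op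
          (bitCost_var (Sum.inr (Sum.inl k))) fun u v => u + v
      · exact (bitCost_var (Sum.inl (Sum.inr k) : (X ⊕ B) ⊕ (X ⊕ B))).mono (by omega)
      · exact (bitCost_var (Sum.inr (Sum.inr k) : (X ⊕ B) ⊕ (X ⊕ B))).mono (by omega))
      j).mono (by simp only [Fintype.card_sum]; omega)) fin
  refine ⟨.seq (.seq (.seq (.seq (.seq (.seq (resp.pad (X ⊕ T))
    (.relabel (Equiv.sumAssoc _ _ _).symm)) q1) (.relabel (Equiv.sumAssoc _ _ _)))
    (att.pad (X ⊕ B))) (.relabel (Equiv.sumAssoc _ _ _).symm)) q2, ?_, fun x t ρ => ?_⟩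
  · simp only [QCirc.size, QCirc.pad_size]
    simp only [Fintype.card_sum] at h1 h2
    rw [tailBound]
    omega
  · simp only [QCirc.run_seq]
    rw [QCirc.pad_put, classical_after_put r1]
    simp only [QCirc.run_sum]
    refine Finset.sum_congr rfl fun b _ => ?_
    rw [relabel_assoc_put, QCirc.pad_put, classical_after_put r2, sum_reg_sum]
    rfl

end Tail

/-! ### Positivity and traces -/

open scoped ComplexOrder MatrixOrder

section Positivity

variable {α β γ : Type}

/-- The block of a joint operator for given basis states of the second system. -/
def cut (ρ : Op (α × γ)) (g g' : γ) : Op α := Matrix.of fun a a' => ρ (a, g) (a', g')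

lemma onFst_apply (Φ : Op α → Op β) (ρ : Op (α × γ)) (x y : β × γ) :
    onFst Φ ρ x y = Φ (cut ρ x.2 y.2) x.1 y.1 := rfl

lemma cut_onFst (Φ : Op α → Op β) (ρ : Op (α × γ)) (g g' : γ) :
    cut (onFst Φ ρ) g g' = Φ (cut ρ g g') := rfl

lemma op_ext_cut {ρ σ : Op (α × γ)} (h : ∀ g g', cut ρ g g' = cut σ g g') : ρ = σ := by
  ext x y
  exact congrFun (congrFun (h x.2 y.2) x.1) y.1

lemma cut_sum {κ : Type} (s : Finset κ) (f : κ → Op (α × γ)) (g g' : γ) :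
    cut (∑ k ∈ s, f k) g g' = ∑ k ∈ s, cut (f k) g g' := by
  ext x y
  simp only [cut, Matrix.of_apply, Matrix.sum_apply]

lemma cut_smul (c : ℂ) (ρ : Op (α × γ)) (g g' : γ) : cut (c • ρ) g g' = c • cut ρ g g' := rfl

/-- `Φ ⊗ id` preserves positivity for every finite ancilla. -/
def CompletelyPositive (Φ : Op α → Op β) : Prop :=
  ∀ (γ : Type) [Fintype γ] (ρ : Op (α × γ)), ρ.PosSemidef → (onFst Φ ρ).PosSemidef

lemma CompletelyPositive.comp {δ : Type} {Ψ : Op β → Op δ} {Φ : Op α → Op β}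
    (hΨ : CompletelyPositive Ψ) (hΦ : CompletelyPositive Φ) :
    CompletelyPositive (fun ρ => Ψ (Φ ρ)) := fun γ _ ρ h => hΨ γ (onFst Φ ρ) (hΦ γ ρ h)

lemma CompletelyPositive.sum {κ : Type} (s : Finset κ) {Φ : κ → Op α → Op β}
    (h : ∀ k ∈ s, CompletelyPositive (Φ k)) : CompletelyPositive (fun ρ => ∑ k ∈ s, Φ k ρ) := by
  intro γ _ ρ hρ
  have : onFst (fun ρ => ∑ k ∈ s, Φ k ρ) ρ = ∑ k ∈ s, onFst (Φ k) ρ :=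
    op_ext_cut fun g g' => by simp only [cut_onFst, cut_sum]
  rw [this]
  exact Matrix.posSemidef_sum s fun k hk => h k hk γ ρ hρ

lemma posSemidef_weight [Fintype β] {ρ : Op α} (hρ : ρ.PosSemidef) (f : β → ℂ) (g : β → α) :
    (Matrix.of fun x y => f x * ρ (g x) (g y) * star (f y) : Op β).PosSemidef := by
  classical
  have h := (hρ.submatrix g).mul_mul_conjTranspose_same (Matrix.diagonal f)
  rw [Matrix.diagonal_conjTranspose] at h
  convert h using 1
  ext x y
  rw [Matrix.mul_diagonal, Matrix.diagonal_mul]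
  rfl

lemma posSemidef_mask [Fintype β] {ρ : Op α} (hρ : ρ.PosSemidef) (p : β → Prop) [DecidablePred p]
    (g : β → α) :
    (Matrix.of fun x y => if p x ∧ p y then ρ (g x) (g y) else 0 : Op β).PosSemidef := by
  convert posSemidef_weight hρ (fun x => if p x then 1 else 0) g using 1
  ext x y
  simp only [Matrix.of_apply]
  by_cases hx : p x <;> by_cases hy : p y <;> simp [hx, hy]

lemma completelyPositive_sandwich [Fintype α] [Fintype β] (K : Matrix β α ℂ) :
    CompletelyPositive (sandwich K) := by
  classical
  intro γ _ ρ hρ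
  convert hρ.mul_mul_conjTranspose_same (Matrix.of fun (x : β × γ) (y : α × γ) =>
    if x.2 = y.2 then K x.1 y.1 else 0) using 1
  ext x y
  simp only [onFst_apply, sandwich, Matrix.mul_apply, Matrix.conjTranspose_apply, Matrix.of_apply,
    Fintype.sum_prod_type, cut, ite_mul, zero_mul, Finset.sum_ite_eq, Finset.mem_univ, if_true,
    apply_ite star, star_zero, mul_ite, mul_zero]

lemma completelyPositive_submatrix (g : β → α) :
    CompletelyPositive (fun ρ : Op α => ρ.submatrix g g) := fun γ _ ρ hρ => by
  exact hρ.submatrix (fun x : β × γ => (g x.1, x.2))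

lemma sum_ite_eq_any {κ M : Type} [Fintype κ] [AddCommMonoid M] (a : κ) (f : κ → M)
    [∀ x, Decidable (a = x)] : (∑ x, if a = x then f x else 0) = f a := by
  rw [Finset.sum_eq_single a]
  · rw [if_pos rfl]
  · exact fun b _ hb => if_neg fun h => hb h.symm
  · simp

lemma QCirc.finite : ∀ {a b : Type}, QCirc a b → Finite a → Finite b
  | _, _, .relabel e, _ => Finite.of_equiv _ e
  | _, _, .gate _ _ _, h => h
  | _, _, .alloc, _ => inferInstance
  | _, _, .discard, _ => Finite.of_injective (β := Unit ⊕ _) Sum.inr Sum.inr_injective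
  | _, _, .seq f g, h => g.finite (f.finite h)

lemma sum_reg_sum' {a b M : Type} [Fintype (Reg a)] [Fintype (Reg b)] [Fintype (Reg (a ⊕ b))]
    [AddCommMonoid M] (f : Reg (a ⊕ b) → M) :
    ∑ z, f z = ∑ x : Reg a, ∑ y : Reg b, f (Sum.elim x y) := by
  rw [← Fintype.sum_prod_type']
  exact (Equiv.sum_comp (Equiv.sumArrowEquivProdArrow a b (ZMod 2)).symm f).symm

/-- A unitary on the register `j`, with the identity on `a`, is conjugation by one matrix. The
identity matrix is given as a function `δ`, independently of the instance that decides equality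
of labels. -/
lemma local_sandwich {j a : Type} [Fintype j] [Fintype a] [DecidableEq j] [DecidableEq a]
    {δ : Reg a → Reg a → ℂ} (hδ : ∀ u v, δ u v = if u = v then 1 else 0)
    (U : Reg j → Reg j → ℂ) (ρ : Op (Reg (j ⊕ a))) (x y : Reg (j ⊕ a)) :
    ∑ p, ∑ q, U (x ∘ Sum.inl) p * ρ (Sum.elim p (x ∘ Sum.inr)) (Sum.elim q (y ∘ Sum.inr)) *
      star (U (y ∘ Sum.inl) q) = sandwich (Matrix.of fun x x' : Reg (j ⊕ a) =>
        δ (x ∘ Sum.inr) (x' ∘ Sum.inr) * U (x ∘ Sum.inl) (x' ∘ Sum.inl)) ρ x y := by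
  simp only [sandwich, Matrix.mul_apply, Matrix.conjTranspose_apply,
        Matrix.of_apply, sum_reg_sum', Sum.elim_comp_inl, Sum.elim_comp_inr]
  simp only [hδ, ite_mul, zero_mul, one_mul, sum_ite_eq_any, apply_ite star,
    star_zero, mul_ite, mul_zero]
  rw [Finset.sum_comm]
  simp only [Finset.sum_mul]

lemma QCirc.completelyPositive {a b : Type} (q : QCirc a b) :
    Finite a → CompletelyPositive q.run := by
  classical
  induction q with
  | relabel e => exact fun _ => completelyPositive_submatrix fun x => x ∘ e
  | @gate a j hj U =>
    intro h
    have : Finite a := Finite.of_injective (β := Fin j ⊕ a) Sum.inr Sum.inr_injective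
    let _ := Fintype.ofFinite a
    obtain ⟨U, hU⟩ := U
    have : (QCirc.gate (a := a) j hj ⟨U, hU⟩).run =
        sandwich (Matrix.of fun x x' : Reg (Fin j ⊕ a) =>
        (1 : Op (Reg a)) (x ∘ Sum.inr) (x' ∘ Sum.inr) *
          U (x ∘ Sum.inl) (x' ∘ Sum.inl)) := by
      funext ρ
      ext x y
      exact local_sandwich (fun u v => Matrix.one_apply) U ρ x y
    rw [this]
    exact completelyPositive_sandwich _
  | @alloc a =>
    intro _ γ _ ρ hρ
    let _ := Fintype.ofFinite a
    exact posSemidef_mask hρ (fun x : Reg (Unit ⊕ a) × γ => x.1 (.inl ()) = 0)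
      (fun x => (x.1 ∘ Sum.inr, x.2))
  | @discard a =>
    intro _
    have : (QCirc.discard (a := a)).run = fun ρ => ∑ b : ZMod 2,
        ρ.submatrix (Sum.elim fun _ => b) (Sum.elim fun _ => b) := by
      funext ρ
      ext x y
      rw [Matrix.sum_apply]
      rfl
    rw [this]
    exact CompletelyPositive.sum _ fun b _ => completelyPositive_submatrix _
  | seq f g ihf ihg => exact fun h => (ihg (f.finite h)).comp (ihf h)

/-- `Φ` preserves the trace. -/
def TracePreserving [Fintype α] [Fintype β] (Φ : Op α → Op β) : Prop :=
  ∀ ρ, (Φ ρ).trace = ρ.trace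

lemma trace_prod [Fintype α] [Fintype γ] (ρ : Op (α × γ)) :
    ρ.trace = ∑ g, (cut ρ g g).trace := by
  simp only [Matrix.trace, Matrix.diag_apply, cut, Matrix.of_apply]
  rw [Fintype.sum_prod_type, Finset.sum_comm]

lemma trace_onFst_sum {κ : Type} [Fintype α] [Fintype β] [Fintype γ] (s : Finset κ)
    {Φ : κ → Op α → Op β} (h : ∀ ρ, ∑ k ∈ s, (Φ k ρ).trace = ρ.trace) (ρ : Op (α × γ)) :
    ∑ k ∈ s, (onFst (Φ k) ρ).trace = ρ.trace := by
  simp only [trace_prod, cut_onFst]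
  rw [Finset.sum_comm]
  simp only [h]

lemma TracePreserving.onFst [Fintype α] [Fintype β] [Fintype γ] {Φ : Op α → Op β}
    (h : TracePreserving Φ) : TracePreserving (onFst (γ := γ) Φ) := fun ρ => by
  simp only [trace_prod, cut_onFst, h _]

lemma QCirc.tracePreserving {a b : Type} (q : QCirc a b) : Finite a →
    ∀ [Fintype (Reg a)] [Fintype (Reg b)], TracePreserving q.run := by
  classical
  induction q with
  | relabel e =>
    intro _ _ _ ρ
    exact Equiv.sum_comp (Equiv.arrowCongr e (Equiv.refl (ZMod 2))).symm fun x => ρ x x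
  | @gate a j hj U =>
    intro h _ _ ρ
    have : Finite a := Finite.of_injective (β := Fin j ⊕ a) Sum.inr Sum.inr_injective
    let _ := Fintype.ofFinite a
    have hU : ∀ p q, ∑ x, star ((U : Op (Reg (Fin j))) x q) * (U : Op (Reg (Fin j))) x p =
        if q = p then 1 else 0 := by
      intro p q
      have := congrFun (congrFun (Matrix.mem_unitaryGroup_iff'.1 U.2) q) p
      rwa [Matrix.mul_apply, Matrix.one_apply] at this
    simp only [Matrix.trace, Matrix.diag_apply, QCirc.run, Matrix.of_apply, sum_reg_sum',
      Sum.elim_comp_inl, Sum.elim_comp_inr]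
    rw [Finset.sum_comm]
    conv_rhs => rw [Finset.sum_comm]
    refine Finset.sum_congr rfl fun z _ => ?_
    rw [Finset.sum_comm]
    refine Finset.sum_congr rfl fun p _ => ?_
    have e : ∀ q, ∑ x, (U : Op (Reg (Fin j))) x p * ρ (Sum.elim p z) (Sum.elim q z) *
        star ((U : Op (Reg (Fin j))) x q) =
          if q = p then ρ (Sum.elim p z) (Sum.elim q z) else 0 := by
      intro q
      rw [← mul_one (ρ _ _), ← mul_zero (ρ (Sum.elim p z) (Sum.elim q z)), ← mul_ite, mul_one, ← hU,
        Finset.mul_sum]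
      exact Finset.sum_congr rfl fun x _ => by ring
    rw [Finset.sum_comm]
    simp only [e]
    rw [Finset.sum_ite_eq' Finset.univ p, if_pos (Finset.mem_univ p)]
  | @alloc a =>
    intro _ _ _ ρ
    simp only [Matrix.trace, Matrix.diag_apply, QCirc.run, Matrix.of_apply,
      sum_reg_sum' (a := Unit),
      Sum.elim_inl, Sum.elim_comp_inr, and_self]
    rw [Finset.sum_eq_single 0]
    · simp
    · intro x _ hx
      have : ¬ x () = 0 := fun h => hx (funext fun _ => h)
      simp [this]
    · simp
  | @discard a =>
    intro _ _ _ ρ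
    simp only [Matrix.trace, Matrix.diag_apply, QCirc.run, Matrix.of_apply,
      sum_reg_sum' (a := Unit)]
    rw [Finset.sum_comm]
    exact Equiv.sum_comp (Equiv.funUnique Unit (ZMod 2)).symm
      fun x : Reg Unit => ∑ y, ρ (Sum.elim x y) (Sum.elim x y)
  | @seq a b c f g ihf ihg =>
    intro h _ _ ρ
    have := f.finite h
    let _ := Fintype.ofFinite (Reg b)
    exact (ihg (f.finite h) _).trans (ihf h ρ)

lemma completelyPositive_slice {c a : Type} (y : Reg c) :
    CompletelyPositive (slice y : Op (Reg (c ⊕ a)) → Op (Reg a)) :=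
  completelyPositive_submatrix _

lemma completelyPositive_put {c a : Type} [Fintype c] [Fintype a] [DecidableEq a]
    [DecidableEq c] (y : Reg c) :
    CompletelyPositive (put y : Op (Reg a) → Op (Reg (c ⊕ a))) := by
  intro γ _ ρ hρ
  exact posSemidef_mask hρ (fun x : Reg (c ⊕ a) × γ => x.1 ∘ Sum.inl = y)
    (fun x => (x.1 ∘ Sum.inr, x.2))

lemma sum_trace_slice {c a : Type} [Fintype c] [Fintype a] [DecidableEq a]
    [DecidableEq c] (ρ : Op (Reg (c ⊕ a))) : ∑ y, (slice y ρ).trace = ρ.trace := by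
  simp only [Matrix.trace, Matrix.diag_apply, sum_reg_sum']
  rfl

lemma trace_tens {c a : Type} [Fintype c] [Fintype a] [DecidableEq a]
    [DecidableEq c] (τ : Op (Reg c)) (ρ : Op (Reg a)) :
    (tens τ ρ).trace = τ.trace * ρ.trace := by
  simp only [Matrix.trace, Matrix.diag_apply, sum_reg_sum', tens, Matrix.of_apply,
    Sum.elim_comp_inl, Sum.elim_comp_inr, Finset.sum_mul_sum]

lemma trace_put {c a : Type} [Fintype c] [Fintype a] [DecidableEq a]
    [DecidableEq c] (y : Reg c) (ρ : Op (Reg a)) : (put y ρ).trace = ρ.trace := by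
  rw [← tens_ket, trace_tens]
  have : (ket y y).trace = 1 := by
    simp [Matrix.trace, ket]
  rw [this, one_mul]

lemma twirled_apply {ι : Type} [Fintype ι] [DecidableEq ι] (F : Clifford ι) (x u v : Reg ι) :
    twirled F x u v = F.unitaryᴴ u x * star (F.unitaryᴴ v x) := by
  rw [twirled, Matrix.mul_apply, Finset.sum_eq_single x]
  · rw [Matrix.mul_apply, Finset.sum_eq_single x, ket_apply_self, mul_one,
      Matrix.conjTranspose_apply, Matrix.conjTranspose_apply, star_star]
    · intro y _ hy
      rw [ket_apply_of_ne (fun h => hy h.1), mul_zero]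
    · simp
  · intro y _ hy
    rw [Matrix.mul_apply, Finset.sum_eq_zero, zero_mul]
    intro z _
    rw [ket_apply_of_ne (fun h => hy h.2), mul_zero]
  · simp

lemma completelyPositive_tens_twirled {ι a : Type} [Fintype ι] [DecidableEq ι] [Fintype a]
    [DecidableEq a] (F : Clifford ι) (x : Reg ι) :
    CompletelyPositive (tens (twirled F x) : Op (Reg a) → Op (Reg (ι ⊕ a))) := by
  intro γ _ ρ hρ
  convert posSemidef_weight hρ (fun z : Reg (ι ⊕ a) × γ => F.unitaryᴴ (z.1 ∘ Sum.inl) x)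
    (fun z => (z.1 ∘ Sum.inr, z.2)) using 1
  ext u v
  simp only [onFst_apply, tens, Matrix.of_apply, twirled_apply, cut]
  ring

lemma trace_twirled {ι : Type} [Fintype ι] [DecidableEq ι] (F : Clifford ι) (x : Reg ι) :
    (twirled F x).trace = 1 := by
  rw [twirled, Matrix.trace_mul_comm, ← Matrix.mul_assoc, unitary_mul_star F.mem_unitary,
    Matrix.one_mul]
  simp [Matrix.trace, ket]

end Positivity

section Tests

variable {α : Type} [Fintype α] [DecidableEq α]

lemma re_trace_mul_nonneg {T τ : Op α} (hT : T.PosSemidef) (hτ : τ.PosSemidef) :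
    0 ≤ (T * τ).trace.re := by
  obtain ⟨B, rfl⟩ : ∃ B : Op α, τ = B * Bᴴ := by
    obtain ⟨B, hB⟩ := CStarAlgebra.nonneg_iff_eq_star_mul_self.mp hτ.nonneg
    exact ⟨Bᴴ, by rw [hB, Matrix.conjTranspose_conjTranspose]; rfl⟩
  rw [← Matrix.mul_assoc, Matrix.trace_mul_comm, ← Matrix.mul_assoc]
  exact (Complex.le_def.1 (hT.conjTranspose_mul_mul_same B).trace_nonneg).1

lemma re_trace_mul_le {T τ : Op α} (hT : (1 - T).PosSemidef) (hτ : τ.PosSemidef) :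
    (T * τ).trace.re ≤ τ.trace.re := by
  have h := re_trace_mul_nonneg hT hτ
  rw [Matrix.sub_mul, Matrix.one_mul, Matrix.trace_sub, Complex.sub_re] at h
  linarith

lemma abs_sub_re_trace_mul_le {T T' τ : Op α} (hT : T.PosSemidef) (hT1 : (1 - T).PosSemidef)
    (hT' : T'.PosSemidef) (hT1' : (1 - T').PosSemidef) (hτ : τ.PosSemidef) :
    |(T * τ).trace.re - (T' * τ).trace.re| ≤ τ.trace.re := by
  have h1 := re_trace_mul_nonneg hT hτ
  have h2 := re_trace_mul_nonneg hT' hτ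
  have h3 := re_trace_mul_le hT1 hτ
  have h4 := re_trace_mul_le hT1' hτ
  rw [abs_le]
  constructor <;> linarith

end Tests

/-! ### The functionality is a quantum instrument -/

open scoped ComplexOrder

section Instrument

lemma tracePreserving_sandwich {α β : Type} [Fintype α] [Fintype β] [DecidableEq α]
    {K : Matrix β α ℂ} (h : Kᴴ * K = 1) : TracePreserving (sandwich K) := fun ρ => by
  rw [sandwich, Matrix.trace_mul_comm, ← Matrix.mul_assoc, h, Matrix.one_mul]

lemma Gate1.unitary (g : Gate1) (b b' : ZMod 2) :
    ∑ a, star (g.mat a b) * g.mat a b' = if b = b' then 1 else 0 := by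
  have hs : ((Real.sqrt 2 : ℝ) : ℂ) * (Real.sqrt 2 : ℝ) = 2 := by
    rw [← Complex.ofReal_mul, Real.mul_self_sqrt (by norm_num)]; norm_num
  have hs0 : ((Real.sqrt 2 : ℝ) : ℂ) ≠ 0 := by
    intro h; rw [h] at hs; norm_num at hs
  have hT : (starRingEnd ℂ) (Complex.exp (Complex.I * (Real.pi / 4 : ℝ))) *
      Complex.exp (Complex.I * (Real.pi / 4 : ℝ)) = 1 := by
    rw [← Complex.exp_conj, ← Complex.exp_add, map_mul, Complex.conj_I, Complex.conj_ofReal,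
      neg_mul, neg_add_cancel, Complex.exp_zero]
  have h1 : (1 : ZMod 2).val = 1 := rfl
  have h11 : (1 + 1 : ZMod 2) = 0 := rfl
  have hne : (1 : ZMod 2) ≠ 0 := by decide
  have hs' : ((Real.sqrt 2 : ℝ) : ℂ)⁻¹ * ((Real.sqrt 2 : ℝ) : ℂ)⁻¹ = 2⁻¹ := by
    rw [← mul_inv, hs]
  rw [sum_zmod_two]
  rcases zmod_two_cases b with rfl | rfl <;> rcases zmod_two_cases b' with rfl | rfl <;>
    cases g <;>
    simp [Gate1.mat, h1, h11, hne, hne.symm, div_eq_mul_inv (_ : ℂ) (Real.sqrt 2 : ℂ), hs', hT,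
      -Complex.ofReal_div] <;>
    norm_num

lemma active_congr {W : ℕ} {ctrl : Option (Fin W)} {x x' : Reg (Fin W)} {v : Fin W}
    (hv : ∀ l ∈ ctrl, l ≠ v) (h : ∀ u, u ≠ v → x u = x' u) : active ctrl x ↔ active ctrl x' :=
  forall₂_congr fun l hl => by rw [h l (hv l hl)]

open Classical in
/-- A controlled one-qubit gate is an isometry, as its control is another wire than its target. -/
lemma single_isometry {W : ℕ} (g : Gate1) {v : Fin W} {ctrl : Option (Fin W)}
    (hv : ∀ l ∈ ctrl, l ≠ v) (K : Op (Reg (Fin W))) (hK : ∀ y x, K y x =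
      if ∀ u, u ≠ v → y u = x u then
        (if active ctrl x then g.mat (y v) (x v) else if y v = x v then 1 else 0)
      else 0) : Kᴴ * K = 1 := by
  ext x x'
  rw [Matrix.mul_apply, Matrix.one_apply]
  simp only [Matrix.conjTranspose_apply]
  by_cases hx : ∀ u, u ≠ v → x u = x' u
  · have h0 : ∑ y, star (K y x) * K y x' =
        ∑ b, star (K (Function.update x v b) x) * K (Function.update x v b) x' := by
      refine (Finset.sum_subset (Finset.subset_univ
        (Finset.univ.image fun b => Function.update x v b)) fun y _ hy => ?_).symm.trans ?_
      · rw [hK y x, if_neg, star_zero, zero_mul]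
        intro h
        refine hy (Finset.mem_image.2 ⟨y v, Finset.mem_univ _, ?_⟩)
        funext u
        by_cases hu : u = v
        · subst hu; simp
        · rw [Function.update_of_ne hu, h u hu]
      · exact Finset.sum_image fun b _ b' _ h => by simpa using congrFun h v
    have h1 : ∀ b, K (Function.update x v b) x =
        if active ctrl x then g.mat b (x v) else if b = x v then 1 else 0 := fun b => by
      rw [hK, if_pos (fun u hu => Function.update_of_ne hu _ _), Function.update_self]
    have h2 : ∀ b, K (Function.update x v b) x' =
        if active ctrl x then g.mat b (x' v) else if b = x' v then 1 else 0 := fun b => by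
      rw [hK, if_pos (fun u hu => (Function.update_of_ne hu _ _).trans (hx u hu)),
        Function.update_self]
      by_cases h : active ctrl x
      · rw [if_pos h, if_pos ((active_congr hv hx).1 h)]
      · rw [if_neg h, if_neg (fun h' => h ((active_congr hv hx).2 h'))]
    have h3 : x = x' ↔ x v = x' v := ⟨fun h => by rw [h], fun h => funext fun u => by
      by_cases hu : u = v
      · rw [hu, h]
      · exact hx u hu⟩
    rw [h0]
    simp only [h1, h2]
    by_cases h : active ctrl x
    · simp only [if_pos h, Gate1.unitary]
      by_cases hxv : x v = x' v
      · rw [if_pos hxv, if_pos (h3.2 hxv)]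
      · rw [if_neg hxv, if_neg (fun e => hxv (h3.1 e))]
    · simp only [if_neg h]
      rw [Finset.sum_eq_single (x v)]
      · rw [if_pos rfl, star_one, one_mul]
        by_cases hxv : x v = x' v
        · rw [if_pos hxv, if_pos (h3.2 hxv)]
        · rw [if_neg hxv, if_neg (fun e => hxv (h3.1 e))]
      · intro b _ hb
        rw [if_neg hb, star_zero, zero_mul]
      · simp
  · rw [if_neg (fun h => hx (fun u _ => by rw [h]))]
    refine Finset.sum_eq_zero fun y _ => ?_
    by_cases h : ∀ u, u ≠ v → y u = x u
    · rw [hK y x', if_neg (fun h' => hx fun u hu => (h u hu).symm.trans (h' u hu)), mul_zero]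
    · rw [hK y x, if_neg h, star_zero, zero_mul]

lemma function_isometry {α : Type} [Fintype α] [DecidableEq α] {f : α → α}
    (hf : Function.Injective f) (K : Op α) (hK : ∀ y x, K y x = if y = f x then 1 else 0) :
    Kᴴ * K = 1 := by
  ext x x'
  rw [Matrix.mul_apply, Matrix.one_apply, Finset.sum_eq_single (f x)]
  · rw [Matrix.conjTranspose_apply, hK, hK, if_pos rfl, star_one, one_mul]
    by_cases h : x = x'
    · rw [if_pos h, if_pos (by rw [h])]
    · rw [if_neg h, if_neg (fun h' => h (hf h'))]
  · intro y _ hy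
    rw [Matrix.conjTranspose_apply, hK, if_neg hy, star_zero, zero_mul]
  · simp

lemma Gate.completelyPositive {W : ℕ} (g : Gate W) : CompletelyPositive g.apply := by
  cases g with
  | single g v ctrl => exact completelyPositive_sandwich _
  | cnot c t ctrl => exact completelyPositive_sandwich _
  | meas v =>
    intro γ _ ρ hρ
    have : onFst (Gate.meas v).apply ρ = ∑ m : ZMod 2, Matrix.of fun x y =>
        if x.1 v = m ∧ y.1 v = m then ρ x y else 0 := by
      ext x y
      rw [Matrix.sum_apply]
      simp only [onFst_apply, Gate.apply, Matrix.of_apply, cut]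
      rw [Finset.sum_eq_single (x.1 v)]
      · simp only [true_and, eq_comm]
      · intro m _ hm
        exact if_neg fun h => hm h.1.symm
      · simp
    rw [this]
    exact Matrix.posSemidef_sum _ fun m _ =>
      posSemidef_mask hρ (fun x : Reg (Fin W) × γ => x.1 v = m) id

lemma Circuit.run_cons {W : ℕ} (g : Gate W) (C : Circuit W) (ρ : Op (Reg (Fin W))) :
    Circuit.run (g :: C) ρ = C.run (g.apply ρ) := rfl

lemma Circuit.completelyPositive {W : ℕ} (C : Circuit W) : CompletelyPositive C.run := by
  induction C with
  | nil => exact fun γ _ ρ hρ => hρ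
  | cons g C ih => exact ih.comp g.completelyPositive

open Classical in
lemma cnot_injective {W : ℕ} {c t : Fin W} {ctrl : Option (Fin W)} (hct : c ≠ t)
    (ht : ∀ l ∈ ctrl, l ≠ t) : Function.Injective (fun x : Reg (Fin W) =>
      if active ctrl x then Function.update x t (x t + x c) else x) := by
  refine Function.Involutive.injective fun x => ?_
  by_cases h : active ctrl x
  · have h' : active ctrl (Function.update x t (x t + x c)) :=
      (active_congr (v := t) ht fun u hu => Function.update_of_ne hu _ _).2 h
    simp only [if_pos h, if_pos h', Function.update_self, Function.update_of_ne hct,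
      Function.update_idem, add_assoc, zmod_two_add_self, add_zero, Function.update_eq_self]
  · simp only [if_neg h]

lemma Circuit.tracePreserving {W : ℕ} (C : Circuit W) :
    ∀ M, C.WellFormed M → TracePreserving C.run := by
  induction C with
  | nil => exact fun _ _ ρ => rfl
  | cons g C ih =>
    intro M hM ρ
    rw [Circuit.run_cons]
    cases g with
    | single g v ctrl =>
      obtain ⟨h1, h2, h3⟩ := hM
      refine (ih M h3 _).trans (tracePreserving_sandwich (single_isometry g (v := v) (ctrl := ctrl)
        (fun l hl h => h1 (h ▸ h2 l hl)) _ fun y x => rfl) ρ)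
    | cnot c t ctrl =>
      obtain ⟨h0, h1, h2, h3, h4⟩ := hM
      classical
      refine (ih M h4 _).trans (tracePreserving_sandwich (function_isometry (cnot_injective h0
        (ctrl := ctrl) (fun l hl h => h2 (h ▸ h3 l hl))) _ fun y x => ?_) ρ)
      simp only [Matrix.of_apply]
    | meas v =>
      refine (ih _ hM.2 _).trans ?_
      simp [Matrix.trace, Gate.apply]

variable {P : Setup}

lemma collect_posSemidef {m d : ℕ} {ρ : Op (Reg (P.BadIn ⊕ Fin m) × (Reg P.GoodIn × Fin d))}
    (hρ : ρ.PosSemidef) : (collect ρ).PosSemidef :=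
  posSemidef_mask hρ (fun x : Reg (Fin P.W) × (Reg (Fin m) × Fin d) =>
      ∀ v, P.inp v = none → x.1 v = 0)
    (fun x => (Sum.elim (fun v => x.1 v.1) x.2.1, (fun v => x.1 v.1, x.2.2)))

/-- The ancillas are set to `0`, so that the diagonal entries of `collect ρ` are among those of
`ρ`, or vanish. -/
lemma collect_trace_le {m d : ℕ} {ρ : Op (Reg (P.BadIn ⊕ Fin m) × (Reg P.GoodIn × Fin d))}
    (hρ : ρ.PosSemidef) : (collect ρ).trace.re ≤ ρ.trace.re := by
  classical
  let f : Reg (Fin P.W) × (Reg (Fin m) × Fin d) → Reg (P.BadIn ⊕ Fin m) × (Reg P.GoodIn × Fin d) :=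
    fun x => (Sum.elim (fun v => x.1 v.1) x.2.1, (fun v => x.1 v.1, x.2.2))
  let s := Finset.univ.filter fun x : Reg (Fin P.W) × (Reg (Fin m) × Fin d) =>
    ∀ v, P.inp v = none → x.1 v = 0
  -- The values of all wires are determined by the inputs, since the ancillas are `0`.
  have hf : Set.InjOn f s := by
    intro x hx x' hx' h
    have hx0 := (Finset.mem_filter.1 hx).2
    have hx0' := (Finset.mem_filter.1 hx').2
    have h1 := congrArg Prod.fst h
    have h2 := congrArg (fun z => z.2.1) h
    have h3 := congrArg (fun z => z.2.2) h
    refine Prod.ext (funext fun v => ?_) (Prod.ext (funext fun l => congrFun h1 (.inr l)) h3)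
    cases hv : P.inp v with
    | none => rw [hx0 v hv, hx0' v hv]
    | some j =>
      by_cases hj : j ∈ P.corrupted
      · exact congrFun h1 (.inl ⟨v, j, hj, hv⟩)
      · exact congrFun h2 ⟨v, j, hj, hv⟩
  have h1 : (collect ρ).trace = ∑ x ∈ s, ρ (f x) (f x) := by
    rw [Finset.sum_filter]
    refine Finset.sum_congr rfl fun x _ => ?_
    simp only [Matrix.diag_apply, collect, Matrix.of_apply, and_self]
    rfl
  rw [h1, ← Finset.sum_image (f := fun y => ρ y y) hf, Complex.re_sum, Matrix.trace, Complex.re_sum]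
  exact Finset.sum_le_sum_of_subset_of_nonneg (Finset.subset_univ _) fun y _ _ =>
    (Complex.le_def.1 (hρ.diag_nonneg (i := y))).1

variable {n : ℕ} {M : Finset (Fin P.W)}

lemma sum_prod_curry {S B : Type} [Fintype S] [DecidableEq S] [Fintype B] [DecidableEq B]
    (f : S → Reg B → ℂ) :
    ∑ u : Reg (S × B), ∏ v, f v (fun q => u (v, q)) = ∏ v, ∑ t, f v t := by
  rw [Finset.prod_univ_sum, Fintype.piFinset_univ]
  exact Equiv.sum_comp (Equiv.curry S B (ZMod 2)) fun x => ∏ v, f v (x v)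

lemma encAmp_isometry (E : Clifford (Block n)) (b b' : ZMod 2) :
    ∑ t, star (encAmp E b t) * encAmp E b' t = if b = b' then 1 else 0 := by
  have h := congrFun (congrFun (unitary_star_mul E.mem_unitary)
    (fun q : Block n => q.elim b fun _ => 0)) (fun q : Block n => q.elim b' fun _ => 0)
  rw [Matrix.mul_apply, Matrix.one_apply] at h
  refine h.trans ?_
  by_cases hb : b = b'
  · rw [if_pos hb, if_pos (by rw [hb])]
  · rw [if_neg hb, if_neg (fun h' => hb (congrFun h' none))]

lemma prod_encAmp_isometry {S : Type} [Fintype S] [DecidableEq S] (E : S → Clifford (Block n))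
    (b b' : Reg S) : ∑ u : Reg (S × Block n), star (∏ v, encAmp (E v) (b v) fun q => u (v, q)) *
      ∏ v, encAmp (E v) (b' v) (fun q => u (v, q)) = if b = b' then 1 else 0 := by
  simp only [star_prod, ← Finset.prod_mul_distrib]
  rw [sum_prod_curry (fun v t => star (encAmp (E v) (b v) t) * encAmp (E v) (b' v) t)]
  simp only [encAmp_isometry]
  by_cases hb : b = b'
  · rw [if_pos hb]
    exact Finset.prod_eq_one fun v _ => if_pos (by rw [hb])
  · rw [if_neg hb]
    obtain ⟨v, hv⟩ := Function.ne_iff.1 hb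
    exact Finset.prod_eq_zero (Finset.mem_univ v) (if_neg hv)

/-- The Kraus operators of the encoding, one for each string `y` of measured outcomes and each
string `z` of discarded values, form an instrument. -/
lemma encode_isometry (E : Fin P.W → Clifford (Block n)) :
    ∑ y : Reg {v // v ∈ M}, ∑ z : Reg (P.Discard M), (encode E y z)ᴴ * encode E y z = 1 := by
  classical
  ext x x'
  simp only [Matrix.sum_apply, Matrix.mul_apply, Matrix.conjTranspose_apply]
  -- The operator for `y`, `z` is an isometry on the basis states that carry these values.
  have key : ∀ y z, ∑ u, star (encode E y z u x) * encode E y z u x' =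
      if ((∀ v : {v // v ∈ M}, x v.1 = y v) ∧ ∀ v : P.Discard M, x v.1 = z v) ∧
        x = x' then (1 : ℂ) else 0 := by
    intro y z
    by_cases h : (∀ v : {v // v ∈ M}, x v.1 = y v) ∧ ∀ v : P.Discard M, x v.1 = z v
    · by_cases h' : (∀ v : {v // v ∈ M}, x' v.1 = y v) ∧ ∀ v : P.Discard M, x' v.1 = z v
      · simp only [encode, Matrix.of_apply, if_pos h, if_pos h', star_mul]
        rw [Fintype.sum_prod_type]
        have e1 := prod_encAmp_isometry (fun v : P.BadOut M => E v.1) (fun v => x v.1)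
          (fun v => x' v.1)
        have e2 := prod_encAmp_isometry (fun v : P.GoodOut M => E v.1) (fun v => x v.1)
          (fun v => x' v.1)
        have e3 := congrArg₂ (· * ·) e1 e2
        simp only [Finset.sum_mul_sum] at e3
        refine (Finset.sum_congr rfl fun u _ => Finset.sum_congr rfl fun g _ => ?_).trans
          (e3.trans ?_)
        · ring
        · by_cases hx : x = x'
          · subst hx
            rw [if_pos rfl, if_pos rfl, if_pos ⟨h, rfl⟩, one_mul]
          · rw [if_neg (fun h'' : (_ ∧ _) ∧ x = x' => hx h''.2)]
            by_contra hne
            have hb : (fun v : P.BadOut M => x v.1) = fun v => x' v.1 := by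
              by_contra h''
              exact (mul_ne_zero_iff.1 hne).1 (if_neg h'')
            have hg : (fun v : P.GoodOut M => x v.1) = fun v => x' v.1 := by
              by_contra h''
              exact (mul_ne_zero_iff.1 hne).2 (if_neg h'')
            refine hx (funext fun v => ?_)
            by_cases hvM : v ∈ M
            · exact (h.1 ⟨v, hvM⟩).trans (h'.1 ⟨v, hvM⟩).symm
            cases hv : P.out v with
            | none => exact (h.2 ⟨v, hvM, hv⟩).trans (h'.2 ⟨v, hvM, hv⟩).symm
            | some j =>
              by_cases hj : j ∈ P.corrupted
              · exact congrFun hb ⟨v, hvM, j, hj, hv⟩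
              · exact congrFun hg ⟨v, hvM, j, hj, hv⟩
      · rw [if_neg (fun h'' : (_ ∧ _) ∧ x = x' => h' (h''.2 ▸ h))]
        refine Finset.sum_eq_zero fun u _ => ?_
        rw [encode, Matrix.of_apply, Matrix.of_apply, if_neg h', mul_zero]
    · rw [if_neg (fun h'' : (_ ∧ _) ∧ x = x' => h h''.1)]
      refine Finset.sum_eq_zero fun u _ => ?_
      rw [encode, Matrix.of_apply, Matrix.of_apply, if_neg h, star_zero, zero_mul]
  simp only [key]
  rw [Finset.sum_eq_single (fun v => x v.1), Finset.sum_eq_single (fun v => x v.1)]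
  · rw [Matrix.one_apply]
    by_cases hx : x = x'
    · rw [if_pos hx, if_pos ⟨⟨fun _ => rfl, fun _ => rfl⟩, hx⟩]
    · rw [if_neg hx, if_neg (fun h => hx h.2)]
  · intro z _ hz
    exact if_neg fun h => hz (funext fun v => (h.1.2 v).symm)
  · simp
  · intro y _ hy
    exact Finset.sum_eq_zero fun z _ => if_neg fun h => hy (funext fun v => (h.1.1 v).symm)
  · simp

end Instrument

/-! ### The operator of the measurement protocol -/

section MeasurementOperator

variable {ι : Type} [Fintype ι] [DecidableEq ι]

lemma isClifford_pauli (a b : Reg ι) : IsClifford (pauli a b) := by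
  refine ⟨pauli_mem_unitary a b, fun a' b' =>
    ⟨a + a' + a, b + b' + b, chi (a ⬝ᵥ b) * (chi (b ⬝ᵥ a') * chi ((b + b') ⬝ᵥ a)), ?_⟩⟩
  rw [pauli_conjTranspose, pauli_mul, Matrix.mul_smul, Matrix.smul_mul, pauli_mul, smul_smul,
    smul_smul, mul_assoc]

variable {n : ℕ}

/-- The string `(m, m · c)`. -/
def codeword (m : ZMod 2) (c : Reg (Fin n)) : Reg (Block n) := fun q => q.elim m fun j => m * c j

lemma codeword_add (m m' : ZMod 2) (c : Reg (Fin n)) :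
    codeword m c + codeword m' c = codeword (m + m') c := by
  funext q
  cases q with
  | none => rfl
  | some j => exact (add_mul m m' (c j)).symm

lemma codeword_injective (c : Reg (Fin n)) : Function.Injective fun m => codeword m c :=
  fun _ _ h => congrFun h none

/-- The linear map on labels that `cnotTraps` implements. -/
def cnotLabel (c : Reg (Fin n)) (x : Reg (Block n)) : Reg (Block n) :=
  x + fun q => q.elim 0 fun j => x none * c j

lemma cnotTraps_apply (c : Reg (Fin n)) (y x : Reg (Block n)) :
    cnotTraps c y x = if y = cnotLabel c x then 1 else 0 := rfl

lemma cnotLabel_add (c : Reg (Fin n)) (x y : Reg (Block n)) :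
    cnotLabel c (x + y) = cnotLabel c x + cnotLabel c y := by
  funext q
  cases q with
  | none => simp [cnotLabel]
  | some j => simp [cnotLabel]; ring

lemma cnotLabel_involutive (c : Reg (Fin n)) : Function.Involutive (cnotLabel c) := by
  intro x
  funext q
  cases q with
  | none => simp [cnotLabel]
  | some j => simp [cnotLabel, add_assoc, zmod_two_add_self]

/-- The transpose of `cnotLabel`. -/
def cnotDual (c : Reg (Fin n)) (b : Reg (Block n)) : Reg (Block n) :=
  b + fun q => q.elim (∑ j, b (some j) * c j) fun _ => 0

lemma cnotDual_dotProduct (c : Reg (Fin n)) (b x : Reg (Block n)) :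
    cnotDual c b ⬝ᵥ x = b ⬝ᵥ cnotLabel c x := by
  simp only [dotProduct, cnotDual, cnotLabel, Fintype.sum_option, Pi.add_apply, Option.elim_none,
    Option.elim_some, add_mul, mul_add, Finset.sum_add_distrib, Finset.sum_mul, zero_mul,
    mul_zero, Finset.sum_const_zero, add_zero]
  have h : ∑ j, b (some j) * c j * x none = ∑ j, b (some j) * (x none * c j) :=
    Finset.sum_congr rfl fun j _ => by ring
  rw [h]
  ring

/-- The circuit permutes the basis states linearly; hence it maps `X`-labels by this linear map,
and `Z`-labels by its transpose. -/
lemma isClifford_cnotTraps (c : Reg (Fin n)) : IsClifford (cnotTraps c) := by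
  have hu : (cnotTraps c)ᴴ * cnotTraps c = 1 :=
    function_isometry (cnotLabel_involutive c).injective _ (cnotTraps_apply c)
  have hmem : cnotTraps c ∈ Matrix.unitaryGroup (Reg (Block n)) ℂ :=
    Matrix.mem_unitaryGroup_iff'.2 hu
  refine ⟨hmem, fun a b => ⟨cnotLabel c a, cnotDual c b, 1, ?_⟩⟩
  have h : cnotTraps c * pauli a b = pauli (cnotLabel c a) (cnotDual c b) * cnotTraps c := by
    ext y x
    rw [Matrix.mul_apply, Matrix.mul_apply, Finset.sum_eq_single (x + a),
      Finset.sum_eq_single (cnotLabel c x)]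
    · rw [pauli_apply, pauli_apply, cnotTraps_apply, cnotTraps_apply, if_pos rfl, if_pos rfl,
        cnotLabel_add, cnotDual_dotProduct, cnotLabel_involutive c x]
      split_ifs <;> simp
    · intro z _ hz
      rw [cnotTraps_apply, if_neg hz, mul_zero]
    · simp
    · intro z _ hz
      rw [pauli_apply, if_neg hz, mul_zero]
    · simp
  rw [one_smul, h, Matrix.mul_assoc, unitary_mul_star hmem, Matrix.mul_one]

/-- The Clifford operator `X^r Z^s CNOT_{1,c}`. -/
def measOp (r s : Reg (Block n)) (c : Reg (Fin n)) : Op (Reg (Block n)) :=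
  pauli r s * cnotTraps c

lemma isClifford_measOp (r s : Reg (Block n)) (c : Reg (Fin n)) : IsClifford (measOp r s c) :=
  (isClifford_pauli r s).mul (isClifford_cnotTraps c)

lemma cnotLabel_data (c : Reg (Fin n)) (m : ZMod 2) :
    cnotLabel c (fun q => q.elim m fun _ => 0) = codeword m c := by
  funext q
  cases q with
  | none => exact add_zero m
  | some j => exact zero_add (m * c j)

/-- A data qubit `|m⟩` with traps `|0⟩` is mapped to a multiple of `|r + (m, m · c)⟩`. -/
lemma measOp_data (r s : Reg (Block n)) (c : Reg (Fin n)) (m : ZMod 2) (y : Reg (Block n)) :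
    measOp r s c y (fun q => q.elim m fun _ => 0) =
      if y = r + codeword m c then chi (s ⬝ᵥ codeword m c) else 0 := by
  rw [measOp, Matrix.mul_apply, Finset.sum_eq_single (codeword m c)]
  · rw [cnotTraps_apply, cnotLabel_data, if_pos rfl, mul_one, pauli_apply, add_comm r]
  · intro z _ hz
    rw [cnotTraps_apply, cnotLabel_data, if_neg hz, mul_zero]
  · simp

/-- A nontrivial character of the group of phase keys sums to `0`. -/
lemma sum_chi_dotProduct {t : Reg ι} (ht : t ≠ 0) :
    ∑ s : Reg ι, chi (s ⬝ᵥ t) = 0 := by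
  obtain ⟨j, hj⟩ := Function.ne_iff.1 ht
  have hj1 : t j = 1 := (zmod_two_cases _).resolve_left hj
  have h : ∑ s : Reg ι, chi (s ⬝ᵥ t) = - ∑ s : Reg ι, chi (s ⬝ᵥ t) := by
    rw [← Finset.sum_neg_distrib]
    refine Fintype.sum_equiv (Equiv.addRight (Pi.single j 1)) _ _ fun s => ?_
    rw [Equiv.coe_addRight, add_dotProduct, single_dotProduct, one_mul, hj1, chi_add, chi_one]
    ring
  exact self_eq_neg.1 h

/-- The key that is uniformly distributed for uniform `F`, and for which the player receives
`F` as the operator `V`. -/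
def substKey (F : Clifford (Block n)) (r s : Reg (Block n)) (c : Reg (Fin n)) :
    Clifford (Block n) :=
  F⁻¹ * toClifford (measOp r s c) (isClifford_measOp r s c)

lemma substKey_unitary (F : Clifford (Block n)) (r s : Reg (Block n)) (c : Reg (Fin n)) :
    ∃ φ : ℂ, φ * star φ = 1 ∧
      (substKey F r s c).unitary = φ • (F.unitaryᴴ * measOp r s c) := by
  obtain ⟨φ, hφ, h⟩ := toClifford_unitary_phase
    (F.isClifford.conjTranspose.mul (isClifford_measOp r s c))
  refine ⟨φ, hφ, ?_⟩
  rw [← h, toClifford_mul F.isClifford.conjTranspose, toClifford_conjTranspose F.isClifford,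
    toClifford_unitary]
  rfl

/-- With the substituted key, the operator `V` is `F` up to a phase. -/
lemma description_instruction (F : Clifford (Block n)) (r s : Reg (Block n)) (c : Reg (Fin n)) :
    description (pauli r s * cnotTraps c * (substKey F r s c).unitaryᴴ) = F.1 := by
  obtain ⟨φ, hφ, h⟩ := substKey_unitary F r s c
  have h1 : pauli r s * cnotTraps c * (substKey F r s c).unitaryᴴ = star φ • F.unitary := by
    rw [h, Matrix.conjTranspose_smul, Matrix.conjTranspose_mul, Matrix.conjTranspose_conjTranspose,
      Matrix.mul_smul, ← Matrix.mul_assoc]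
    change star φ • (measOp r s c * (measOp r s c)ᴴ * F.unitary) = _
    rw [unitary_mul_star (isClifford_measOp r s c).1, Matrix.one_mul]
  have h2 : Describes F.1 (star φ • F.unitary) :=
    describes_smul (by rw [star_star, mul_comm, hφ]) F.describes
  have hex : ∃ t, Describes t (star φ • F.unitary) := ⟨_, h2⟩
  rw [h1, description, dif_pos hex]
  exact describes_unique (Classical.choose_spec hex) h2

/-- With the substituted key, `m` is encoded as `F†|r + (m, m · c)⟩`; the phase key `s`
contributes only a sign. -/
lemma encAmp_substKey (F : Clifford (Block n)) (r s : Reg (Block n)) (c : Reg (Fin n)) :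
    ∃ φ : ℂ, φ * star φ = 1 ∧ ∀ m u, encAmp (substKey F r s c) m u =
      φ * (chi (s ⬝ᵥ codeword m c) * F.unitaryᴴ u (r + codeword m c)) := by
  obtain ⟨φ, hφ, h⟩ := substKey_unitary F r s c
  refine ⟨φ, hφ, fun m u => ?_⟩
  rw [encAmp, h, Matrix.smul_apply, smul_eq_mul, Matrix.mul_apply,
    Finset.sum_eq_single (r + codeword m c)]
  · rw [measOp_data, if_pos rfl, mul_comm (chi _)]
  · intro z _ hz
    rw [measOp_data, if_neg hz, mul_zero]
  · simp

/-- The average over the phase key `s` removes the coherence between the two outcomes. -/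
lemma sum_encAmp_substKey (F : Clifford (Block n)) (r : Reg (Block n)) (c : Reg (Fin n))
    (m m' : ZMod 2) (u v : Reg (Block n)) :
    ∑ s, encAmp (substKey F r s c) m u * star (encAmp (substKey F r s c) m' v) =
      if m = m' then Fintype.card (Reg (Block n)) * twirled F (r + codeword m c) u v else 0 := by
  have h : ∀ s, encAmp (substKey F r s c) m u * star (encAmp (substKey F r s c) m' v) =
      chi (s ⬝ᵥ (codeword m c + codeword m' c)) *
        (F.unitaryᴴ u (r + codeword m c) * star (F.unitaryᴴ v (r + codeword m' c))) := by
    intro s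
    obtain ⟨φ, hφ, h⟩ := encAmp_substKey F r s c
    rw [h, h, dotProduct_add, chi_add, star_mul, star_mul, star_chi]
    linear_combination (chi (s ⬝ᵥ codeword m c) * chi (s ⬝ᵥ codeword m' c) *
      (F.unitaryᴴ u (r + codeword m c) * star (F.unitaryᴴ v (r + codeword m' c)))) * hφ
  simp only [h, ← Finset.sum_mul]
  by_cases hm : m = m'
  · subst hm
    rw [if_pos rfl, twirled_apply, reg_add_self]
    simp
  · rw [if_neg hm, sum_chi_dotProduct, zero_mul]
    rw [codeword_add]
    intro h0
    have := congrFun h0 none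
    exact hm (CharTwo.add_eq_zero.1 this)

/-- The amplitudes with which an honest player, who holds the key `E`, measures `h`. -/
lemma honest_amplitude (E : Clifford (Block n)) (r s : Reg (Block n)) (c : Reg (Fin n))
    (m : ZMod 2) (h : Reg (Block n)) :
    ∑ p, (pauli r s * cnotTraps c * E.unitaryᴴ) h p * encAmp E m p =
      if h = r + codeword m c then chi (s ⬝ᵥ codeword m c) else 0 := by
  rw [← measOp_data]
  simp only [encAmp]
  rw [← Matrix.mul_apply, Matrix.mul_assoc, unitary_star_mul E.mem_unitary, Matrix.mul_one]
  rfl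

end MeasurementOperator

/-! ### Removing one output wire -/

section Wires

variable {W : ℕ} {M M' : Finset (Fin W)} {w : Fin W} {p : Fin W → Prop}

/-- Wires that are not measured by the larger circuit are not measured by the smaller one. -/
def incl (h : M ⊆ M') (v : {v // v ∉ M' ∧ p v}) : {v // v ∉ M ∧ p v} :=
  ⟨v.1, fun hv => v.2.1 (h hv), v.2.2⟩

lemma incl_bijective (hM : M' = insert w M) (h : M ⊆ M') (hp : ¬ p w) :
    Function.Bijective (incl (p := p) h) := by
  refine ⟨fun v v' hv => Subtype.ext (congrArg (fun z => z.1) hv), fun v => ?_⟩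
  refine ⟨⟨v.1, fun hv => ?_, v.2.2⟩, rfl⟩
  rw [hM, Finset.mem_insert] at hv
  exact hv.elim (fun e => hp (e ▸ v.2.2)) v.2.1

/-- The wires on which `w` is added. -/
def optIncl (h : M ⊆ M') (hw : w ∉ M ∧ p w) (v : Option {v // v ∉ M' ∧ p v}) :
    {v // v ∉ M ∧ p v} := v.elim ⟨w, hw⟩ (incl h)

lemma optIncl_bijective (hM : M' = insert w M) (h : M ⊆ M') (hw : w ∉ M ∧ p w) :
    Function.Bijective (optIncl (p := p) h hw) := by
  have hwM : w ∈ M' := by rw [hM]; exact Finset.mem_insert_self _ _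
  constructor
  · rintro (_ | v) (_ | v') hv
    · rfl
    · have : w = v'.1 := congrArg (fun z => z.1) hv
      exact absurd (this ▸ hwM) v'.2.1
    · have : v.1 = w := congrArg (fun z => z.1) hv
      exact absurd (this ▸ hwM) v.2.1
    · exact congrArg some (Subtype.ext (congrArg (fun z => z.1) hv))
  · intro v
    by_cases hv : v.1 = w
    · exact ⟨none, Subtype.ext hv.symm⟩
    · refine ⟨some ⟨v.1, fun hv' => ?_, v.2.2⟩, rfl⟩
      rw [hM, Finset.mem_insert] at hv'
      exact hv'.elim hv v.2.1

/-- The qubits of the encodings of the output wires, if `w` is not among them. -/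
def inclEquiv (hM : M' = insert w M) (h : M ⊆ M') (hp : ¬ p w) (B : Type) :
    {v // v ∉ M' ∧ p v} × B ≃ {v // v ∉ M ∧ p v} × B :=
  Equiv.prodCongr (Equiv.ofBijective _ (incl_bijective hM h hp)) (Equiv.refl B)

/-- The qubits of the encodings of the output wires, where those of `w` are listed separately. -/
def optEquiv (hM : M' = insert w M) (h : M ⊆ M') (hw : w ∉ M ∧ p w) (B : Type) :
    B ⊕ ({v // v ∉ M' ∧ p v} × B) ≃ {v // v ∉ M ∧ p v} × B :=
  Equiv.ofBijective (Sum.elim (fun q => (⟨w, hw⟩, q)) fun vq => (incl h vq.1, vq.2)) (by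
    have hb := optIncl_bijective hM h hw
    constructor
    · rintro (q | ⟨v, q⟩) (q' | ⟨v', q'⟩) e
      · exact congrArg Sum.inl (congrArg Prod.snd e)
      · exact absurd (hb.1 (a₁ := none) (a₂ := some v') (congrArg Prod.fst e)) (by simp)
      · exact absurd (hb.1 (a₁ := some v) (a₂ := none) (congrArg Prod.fst e)) (by simp)
      · have h1 := Option.some_injective _
          (hb.1 (a₁ := some v) (a₂ := some v') (congrArg Prod.fst e))
        have h2 : q = q' := congrArg Prod.snd e
        rw [h1, h2]
    · rintro ⟨v, q⟩
      obtain ⟨_ | v', e⟩ := hb.2 v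
      · exact ⟨.inl q, Prod.ext e rfl⟩
      · exact ⟨.inr (v', q), Prod.ext e rfl⟩)

lemma prod_incl [Fintype {v // v ∉ M ∧ p v}] [Fintype {v // v ∉ M' ∧ p v}]
    (hM : M' = insert w M) (h : M ⊆ M') (hp : ¬ p w) (f : {v // v ∉ M ∧ p v} → ℂ) :
    ∏ v, f v = ∏ v, f (incl h v) :=
  ((incl_bijective hM h hp).prod_comp f).symm

lemma prod_optIncl [Fintype {v // v ∉ M ∧ p v}] [Fintype {v // v ∉ M' ∧ p v}]
    (hM : M' = insert w M) (h : M ⊆ M') (hw : w ∉ M ∧ p w) (f : {v // v ∉ M ∧ p v} → ℂ) :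
    ∏ v, f v = f ⟨w, hw⟩ * ∏ v, f (incl h v) := by
  rw [← (optIncl_bijective hM h hw).prod_comp f, Fintype.prod_option]
  rfl

/-- The outcomes `y` of the wires `M`, and the outcome `m` of the wire `w`. -/
def addOutcome (M' : Finset (Fin W)) (y : Reg {v // v ∈ M}) (m : ZMod 2) : Reg {v // v ∈ M'} :=
  fun v => if h : v.1 ∈ M then y ⟨v.1, h⟩ else m

lemma addOutcome_of_mem {y : Reg {v // v ∈ M}} {m : ZMod 2} {v : {v // v ∈ M'}} (h : v.1 ∈ M) :
    addOutcome M' y m v = y ⟨v.1, h⟩ := dif_pos h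

lemma addOutcome_of_notMem {y : Reg {v // v ∈ M}} {m : ZMod 2} {v : {v // v ∈ M'}}
    (h : v.1 ∉ M) : addOutcome M' y m v = m := dif_neg h

lemma eq_of_mem_of_notMem (hM : M' = insert w M) {v : Fin W} (h : v ∈ M') (hv : v ∉ M) : v = w :=
  (Finset.mem_insert.1 (hM ▸ h)).resolve_right hv

lemma addOutcome_bijective (hM : M' = insert w M) (hw : w ∉ M) :
    Function.Bijective fun z : Reg {v // v ∈ M} × ZMod 2 => addOutcome M' z.1 z.2 := by
  have hwM : w ∈ M' := by rw [hM]; exact Finset.mem_insert_self _ _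
  have hsub : ∀ v, v ∈ M → v ∈ M' := fun v hv => by rw [hM]; exact Finset.mem_insert_of_mem hv
  constructor
  · rintro ⟨y, m⟩ ⟨y', m'⟩ e
    refine Prod.ext (funext fun v => ?_) ?_
    · have := congrFun e ⟨v.1, hsub _ v.2⟩
      simpa [addOutcome] using this
    · have := congrFun e ⟨w, hwM⟩
      simpa [addOutcome, hw] using this
  · intro z
    refine ⟨(fun v => z ⟨v.1, hsub _ v.2⟩, z ⟨w, hwM⟩), funext fun v => ?_⟩
    by_cases hv : v.1 ∈ M
    · exact dif_pos hv
    · refine (addOutcome_of_notMem hv).trans (congrArg z ?_)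
      exact Subtype.ext (eq_of_mem_of_notMem hM v.2 hv).symm

lemma eq_addOutcome_iff (hM : M' = insert w M) (hw : w ∉ M) (y : Reg {v // v ∈ M}) (m : ZMod 2)
    (x : Reg (Fin W)) : (∀ v : {v // v ∈ M'}, x v.1 = addOutcome M' y m v) ↔
      (∀ v : {v // v ∈ M}, x v.1 = y v) ∧ x w = m := by
  have hwM : w ∈ M' := by rw [hM]; exact Finset.mem_insert_self _ _
  have hsub : ∀ v, v ∈ M → v ∈ M' := fun v hv => by rw [hM]; exact Finset.mem_insert_of_mem hv
  constructor
  · intro h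
    refine ⟨fun v => (h ⟨v.1, hsub _ v.2⟩).trans (dif_pos v.2), ?_⟩
    exact (h ⟨w, hwM⟩).trans (dif_neg hw)
  · rintro ⟨h1, h2⟩ v
    by_cases hv : v.1 ∈ M
    · rw [addOutcome_of_mem hv, h1 ⟨v.1, hv⟩]
    · rw [addOutcome_of_notMem hv, eq_of_mem_of_notMem hM v.2 hv, h2]

end Wires

section Encode

variable {P : Setup} {n : ℕ} {M M' : Finset (Fin P.W)} {w : Fin P.W} {i : Fin P.k}

lemma forall_discard_iff (hM : M' = insert w M) (h : M ⊆ M') (hi : P.out w = some i)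
    (z : Reg (P.Discard M)) (x : Reg (Fin P.W)) :
    (∀ v : P.Discard M, x v.1 = z v) ↔ ∀ v : P.Discard M', x v.1 = (z ∘ incl h) v := by
  have hp : ¬ (fun v => P.out v = none) w := by simp [hi]
  have hb := incl_bijective (p := fun v => P.out v = none) hM h hp
  constructor
  · exact fun hx v => hx (incl h v)
  · intro hx v
    obtain ⟨v', rfl⟩ := hb.2 v
    exact hx v'

/-- Separating the wire `w` from the encoding of the outputs, for an arbitrary splitting of the
amplitudes. -/
lemma encode_split (hM : M' = insert w M) (h : M ⊆ M') (hw : w ∉ M) (hi : P.out w = some i)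
    (E : Fin P.W → Clifford (Block n)) (y : Reg {v // v ∈ M}) (z : Reg (P.Discard M))
    {u : Reg (P.BadOut M × Block n) × Reg (P.GoodOut M × Block n)}
    {u' : Reg (P.BadOut M' × Block n) × Reg (P.GoodOut M' × Block n)} {a : ZMod 2 → ℂ}
    (x : Reg (Fin P.W))
    (hu : (∏ v : P.BadOut M, encAmp (E v.1) (x v.1) (fun q => u.1 (v, q))) *
        (∏ v : P.GoodOut M, encAmp (E v.1) (x v.1) (fun q => u.2 (v, q))) = a (x w) *
      ((∏ v : P.BadOut M', encAmp (E v.1) (x v.1) (fun q => u'.1 (v, q))) *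
        ∏ v : P.GoodOut M', encAmp (E v.1) (x v.1) (fun q => u'.2 (v, q)))) :
    encode E y z u x = ∑ m, a m * encode E (addOutcome M' y m) (z ∘ incl h) u' x := by
  rw [Finset.sum_eq_single (x w)]
  · by_cases hx : (∀ v : {v // v ∈ M}, x v.1 = y v) ∧ ∀ v : P.Discard M, x v.1 = z v
    · have hx' : (∀ v : {v // v ∈ M'}, x v.1 = addOutcome M' y (x w) v) ∧
          ∀ v : P.Discard M', x v.1 = (z ∘ incl h) v :=
        ⟨(eq_addOutcome_iff hM hw y _ x).2 ⟨hx.1, rfl⟩, (forall_discard_iff hM h hi z x).1 hx.2⟩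
      rw [encode, encode, Matrix.of_apply, Matrix.of_apply, if_pos hx, if_pos hx', hu]
    · have hx' : ¬ ((∀ v : {v // v ∈ M'}, x v.1 = addOutcome M' y (x w) v) ∧
          ∀ v : P.Discard M', x v.1 = (z ∘ incl h) v) := fun hx' =>
        hx ⟨((eq_addOutcome_iff hM hw y _ x).1 hx'.1).1, (forall_discard_iff hM h hi z x).2 hx'.2⟩
      rw [encode, encode, Matrix.of_apply, Matrix.of_apply, if_neg hx, if_neg hx', mul_zero]
  · intro m _ hm
    rw [encode, Matrix.of_apply, if_neg, mul_zero]
    exact fun hx => hm ((eq_addOutcome_iff hM hw y _ x).1 hx.1).2.symm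
  · simp

lemma encode_split_bad (hM : M' = insert w M) (h : M ⊆ M') (hw : w ∉ M) (hi : P.out w = some i)
    (hc : i ∈ P.corrupted) (E : Fin P.W → Clifford (Block n)) (y : Reg {v // v ∈ M})
    (z : Reg (P.Discard M)) (u : Reg (P.BadOut M × Block n) × Reg (P.GoodOut M × Block n))
    (x : Reg (Fin P.W)) :
    encode E y z u x = ∑ m, encAmp (E w) m (fun q => u.1 (⟨w, hw, i, hc, hi⟩, q)) *
      encode E (addOutcome M' y m) (z ∘ incl h) (fun vq => u.1 (incl h vq.1, vq.2),
        fun vq => u.2 (incl h vq.1, vq.2)) x := by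
  refine encode_split hM h hw hi E y z x ?_
  have hp : ¬ ∃ j ∉ P.corrupted, P.out w = some j := by
    rintro ⟨j, hj, hj'⟩
    rw [hi, Option.some_inj] at hj'
    exact hj (hj' ▸ hc)
  rw [prod_optIncl (p := fun v => ∃ j ∈ P.corrupted, P.out v = some j) hM h ⟨hw, i, hc, hi⟩,
    prod_incl (p := fun v => ∃ j ∉ P.corrupted, P.out v = some j) hM h hp, mul_assoc]
  rfl

lemma encode_split_good (hM : M' = insert w M) (h : M ⊆ M') (hw : w ∉ M) (hi : P.out w = some i)
    (hc : i ∉ P.corrupted) (E : Fin P.W → Clifford (Block n)) (y : Reg {v // v ∈ M})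
    (z : Reg (P.Discard M)) (u : Reg (P.BadOut M × Block n) × Reg (P.GoodOut M × Block n))
    (x : Reg (Fin P.W)) :
    encode E y z u x = ∑ m, encAmp (E w) m (fun q => u.2 (⟨w, hw, i, hc, hi⟩, q)) *
      encode E (addOutcome M' y m) (z ∘ incl h) (fun vq => u.1 (incl h vq.1, vq.2),
        fun vq => u.2 (incl h vq.1, vq.2)) x := by
  refine encode_split hM h hw hi E y z x ?_
  have hp : ¬ ∃ j ∈ P.corrupted, P.out w = some j := by
    rintro ⟨j, hj, hj'⟩
    rw [hi, Option.some_inj] at hj'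
    exact hc (hj' ▸ hj)
  rw [prod_optIncl (p := fun v => ∃ j ∉ P.corrupted, P.out v = some j) hM h ⟨hw, i, hc, hi⟩,
    prod_incl (p := fun v => ∃ j ∈ P.corrupted, P.out v = some j) hM h hp, mul_left_comm]
  rfl

lemma mul_mul_conjTranspose_split {α β β' : Type} [Fintype α] {κ : Type} [Fintype κ]
    {K L : Matrix β α ℂ} {K' L' : κ → Matrix β' α ℂ} {a b : κ → ℂ} {u v : β} {u' v' : β'}
    (hK : ∀ x, K u x = ∑ m, a m * K' m u' x) (hL : ∀ x, L v x = ∑ m, b m * L' m v' x)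
    (ρ : Op α) : (K * ρ * Lᴴ) u v = ∑ m, ∑ m', a m * star (b m') *
      (K' m * ρ * (L' m')ᴴ) u' v' := by
  simp only [Matrix.mul_apply, Matrix.conjTranspose_apply, hK, hL, star_sum, star_mul,
    Finset.sum_mul, Finset.mul_sum]
  rw [Finset.sum_comm]
  rw [Finset.sum_congr rfl fun m' _ => Finset.sum_congr rfl fun x _ => Finset.sum_comm]
  rw [Finset.sum_congr rfl fun m' _ => Finset.sum_comm]
  rw [Finset.sum_comm]
  refine Finset.sum_congr rfl fun m _ => Finset.sum_congr rfl fun m' _ =>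
    Finset.sum_congr rfl fun x _ => Finset.sum_congr rfl fun x' _ => ?_
  ring

/-- The state after the functionality has sent the outputs, in the branch with keys `E`; off the
diagonal `y = y'` this is the coherence between two strings of measurement outcomes. -/
def received (M : Finset (Fin P.W)) {m d : ℕ} (E : Fin P.W → Clifford (Block n))
    (y y' : Reg {v // v ∈ M}) (σ : Op (Reg (Fin P.W) × (Reg (Fin m) × Fin d))) :
    Op (Reg ((P.BadOut M × Block n) ⊕ Fin m) × (Reg (P.GoodOut M × Block n) × Fin d)) :=
  (∑ z : Reg (P.Discard M), onFst (fun ρ => encode E y z * ρ * (encode E y' z)ᴴ) σ).submatrix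
    (fun x => ((x.1 ∘ Sum.inl, x.2.1), (x.1 ∘ Sum.inr, x.2.2)))
    (fun x => ((x.1 ∘ Sum.inl, x.2.1), (x.1 ∘ Sum.inr, x.2.2)))

lemma received_apply {m d : ℕ} (E : Fin P.W → Clifford (Block n))
    (y y' : Reg {v // v ∈ M}) (σ : Op (Reg (Fin P.W) × (Reg (Fin m) × Fin d)))
    (X X' : Reg ((P.BadOut M × Block n) ⊕ Fin m)) (g g' : Reg (P.GoodOut M × Block n))
    (e e' : Fin d) : received M E y y' σ (X, (g, e)) (X', (g', e')) =
      ∑ z : Reg (P.Discard M), (encode E y z * cut σ (X ∘ Sum.inr, e) (X' ∘ Sum.inr, e') *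
        (encode E y' z)ᴴ) (X ∘ Sum.inl, g) (X' ∘ Sum.inl, g') := by
  simp only [received, Matrix.submatrix_apply, Matrix.sum_apply]
  rfl

/-- The wire `w` of a corrupted player is split off. -/
lemma received_split_bad (hM : M' = insert w M) (h : M ⊆ M') (hw : w ∉ M)
    (hi : P.out w = some i) (hc : i ∈ P.corrupted) {m d : ℕ} (E : Fin P.W → Clifford (Block n))
    (y : Reg {v // v ∈ M}) (σ : Op (Reg (Fin P.W) × (Reg (Fin m) × Fin d)))
    (X X' : Reg ((P.BadOut M × Block n) ⊕ Fin m)) (g g' : Reg (P.GoodOut M × Block n))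
    (e e' : Fin d) : received M E y y σ (X, (g, e)) (X', (g', e')) =
      ∑ b, ∑ b', encAmp (E w) b (fun q => X (.inl (⟨w, hw, i, hc, hi⟩, q))) *
        star (encAmp (E w) b' (fun q => X' (.inl (⟨w, hw, i, hc, hi⟩, q)))) *
        received M' E (addOutcome M' y b) (addOutcome M' y b') σ
          (Sum.elim (fun vq => X (.inl (incl h vq.1, vq.2))) (X ∘ Sum.inr),
            (fun vq => g (incl h vq.1, vq.2), e))
          (Sum.elim (fun vq => X' (.inl (incl h vq.1, vq.2))) (X' ∘ Sum.inr),
            (fun vq => g' (incl h vq.1, vq.2), e')) := by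
  have hp : ¬ (fun v => P.out v = none) w := by simp [hi]
  have hb := incl_bijective (p := fun v => P.out v = none) hM h hp
  rw [received_apply]
  simp only [received_apply, Finset.mul_sum, Sum.elim_comp_inl, Sum.elim_comp_inr]
  rw [Finset.sum_congr rfl fun z _ => mul_mul_conjTranspose_split
    (encode_split_bad hM h hw hi hc E y z _) (encode_split_bad hM h hw hi hc E y z _) _]
  rw [Finset.sum_comm]
  refine Finset.sum_congr rfl fun b _ => ?_
  rw [Finset.sum_comm]
  refine Finset.sum_congr rfl fun b' _ => ?_
  exact Fintype.sum_equiv (Equiv.arrowCongr (Equiv.ofBijective _ hb).symm (Equiv.refl (ZMod 2)))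
    _ _ fun z => rfl

/-- The wire `w` of an honest player is split off. -/
lemma received_split_good (hM : M' = insert w M) (h : M ⊆ M') (hw : w ∉ M)
    (hi : P.out w = some i) (hc : i ∉ P.corrupted) {m d : ℕ} (E : Fin P.W → Clifford (Block n))
    (y : Reg {v // v ∈ M}) (σ : Op (Reg (Fin P.W) × (Reg (Fin m) × Fin d)))
    (X X' : Reg ((P.BadOut M × Block n) ⊕ Fin m)) (g g' : Reg (P.GoodOut M × Block n))
    (e e' : Fin d) : received M E y y σ (X, (g, e)) (X', (g', e')) =
      ∑ b, ∑ b', encAmp (E w) b (fun q => g (⟨w, hw, i, hc, hi⟩, q)) *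
        star (encAmp (E w) b' (fun q => g' (⟨w, hw, i, hc, hi⟩, q))) *
        received M' E (addOutcome M' y b) (addOutcome M' y b') σ
          (Sum.elim (fun vq => X (.inl (incl h vq.1, vq.2))) (X ∘ Sum.inr),
            (fun vq => g (incl h vq.1, vq.2), e))
          (Sum.elim (fun vq => X' (.inl (incl h vq.1, vq.2))) (X' ∘ Sum.inr),
            (fun vq => g' (incl h vq.1, vq.2), e')) := by
  have hp : ¬ (fun v => P.out v = none) w := by simp [hi]
  have hb := incl_bijective (p := fun v => P.out v = none) hM h hp
  rw [received_apply]
  simp only [received_apply, Finset.mul_sum, Sum.elim_comp_inl, Sum.elim_comp_inr]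
  rw [Finset.sum_congr rfl fun z _ => mul_mul_conjTranspose_split
    (encode_split_good hM h hw hi hc E y z _) (encode_split_good hM h hw hi hc E y z _) _]
  rw [Finset.sum_comm]
  refine Finset.sum_congr rfl fun b _ => ?_
  rw [Finset.sum_comm]
  refine Finset.sum_congr rfl fun b' _ => ?_
  exact Fintype.sum_equiv (Equiv.arrowCongr (Equiv.ofBijective _ hb).symm (Equiv.refl (ZMod 2)))
    _ _ fun z => rfl

end Encode

/-! ### The states sent by the functionality and the maps applied by the adversary -/

section Received

variable {P : Setup} {n : ℕ} {M M' : Finset (Fin P.W)} {w : Fin P.W} {i : Fin P.k}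

lemma Circuit.measured_append {W : ℕ} (C : Circuit W) (w : Fin W) :
    Circuit.measured (C ++ [Gate.meas w]) = insert w (Circuit.measured C) := by
  induction C with
  | nil => rfl
  | cons g C ih =>
    cases g with
    | single g v ctrl => exact ih
    | cnot c t ctrl => exact ih
    | meas v =>
      change insert v (Circuit.measured (C ++ [Gate.meas w])) =
        insert w (insert v (Circuit.measured C))
      rw [ih, Finset.insert_comm]

lemma Circuit.run_append_meas {W : ℕ} (C : Circuit W) (w : Fin W) :
    Circuit.run (C ++ [Gate.meas w]) = fun ρ => (Gate.meas w).apply (C.run ρ) := by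
  funext ρ
  simp [Circuit.run, List.foldl_append]

/-- The functionality reads the wire `w` in the computational basis. -/
lemma received_meas (hw : w ∈ M') {m d : ℕ} (E : Fin P.W → Clifford (Block n))
    (y : Reg {v // v ∈ M'}) (σ : Op (Reg (Fin P.W) × (Reg (Fin m) × Fin d))) :
    received M' E y y (onFst (Gate.meas w).apply σ) = received M' E y y σ := by
  have h0 : ∀ z u x, x w ≠ y ⟨w, hw⟩ → encode E y z u x = 0 := fun z u x hx => by
    rw [encode, Matrix.of_apply, if_neg fun h => hx (h.1 ⟨w, hw⟩)]
  ext ⟨X, g, e⟩ ⟨X', g', e'⟩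
  rw [received_apply, received_apply]
  refine Finset.sum_congr rfl fun z _ => ?_
  simp only [Matrix.mul_apply, Matrix.conjTranspose_apply]
  refine Finset.sum_congr rfl fun x' _ => ?_
  by_cases hx' : x' w = y ⟨w, hw⟩
  · congr 1
    refine Finset.sum_congr rfl fun x _ => ?_
    by_cases hx : x w = y ⟨w, hw⟩
    · congr 1
      rw [cut_onFst]
      exact if_pos (hx.trans hx'.symm)
    · rw [h0 _ _ _ hx, zero_mul, zero_mul]
  · rw [h0 _ _ _ hx', star_zero, mul_zero, mul_zero]

lemma received_posSemidef {m d : ℕ} (E : Fin P.W → Clifford (Block n))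
    (y : Reg {v // v ∈ M}) {σ : Op (Reg (Fin P.W) × (Reg (Fin m) × Fin d))}
    (hσ : σ.PosSemidef) : (received M E y y σ).PosSemidef := by
  refine Matrix.PosSemidef.submatrix (Matrix.posSemidef_sum _ fun z _ => ?_) _
  exact completelyPositive_sandwich (encode E y z) _ σ hσ

lemma sum_trace_received {m d : ℕ} (E : Fin P.W → Clifford (Block n))
    (σ : Op (Reg (Fin P.W) × (Reg (Fin m) × Fin d))) :
    ∑ y : Reg {v // v ∈ M}, (received M E y y σ).trace = σ.trace := by
  have h1 : ∀ y : Reg {v // v ∈ M}, (received M E y y σ).trace =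
      ∑ z : Reg (P.Discard M), (onFst (sandwich (encode E y z)) σ).trace := by
    intro y
    rw [← Matrix.trace_sum]
    let e : Reg ((P.BadOut M × Block n) ⊕ Fin m) × (Reg (P.GoodOut M × Block n) × Fin d) ≃
        (Reg (P.BadOut M × Block n) × Reg (P.GoodOut M × Block n)) × (Reg (Fin m) × Fin d) :=
      { toFun := fun x => ((x.1 ∘ Sum.inl, x.2.1), (x.1 ∘ Sum.inr, x.2.2))
        invFun := fun x => (Sum.elim x.1.1 x.2.1, (x.1.2, x.2.2))
        left_inv := fun x => Prod.ext (Sum.elim_comp_inl_inr x.1) rfl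
        right_inv := fun x => rfl }
    exact Equiv.sum_comp e fun x => (∑ z : Reg (P.Discard M),
      onFst (sandwich (encode E y z)) σ) x x
  simp only [h1]
  rw [← Fintype.sum_prod_type']
  refine trace_onFst_sum (Φ := fun yz : Reg {v // v ∈ M} × Reg (P.Discard M) =>
    sandwich (encode E yz.1 yz.2)) Finset.univ (fun ρ => ?_) σ
  have h2 : ∀ yz : Reg {v // v ∈ M} × Reg (P.Discard M),
      (sandwich (encode E yz.1 yz.2) ρ).trace =
        ((encode E yz.1 yz.2)ᴴ * encode E yz.1 yz.2 * ρ).trace := fun yz => by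
    rw [sandwich, Matrix.trace_mul_comm, ← Matrix.mul_assoc]
  simp only [h2]
  rw [← Matrix.trace_sum, ← Finset.sum_mul, Fintype.sum_prod_type, encode_isometry, Matrix.one_mul]

/-- The key of a measured wire is never used. -/
lemma received_update (hw : w ∈ M') {m d : ℕ} (E : Fin P.W → Clifford (Block n))
    (G : Clifford (Block n)) (y y' : Reg {v // v ∈ M'})
    (σ : Op (Reg (Fin P.W) × (Reg (Fin m) × Fin d))) :
    received M' (Function.update E w G) y y' σ = received M' E y y' σ := by
  have h : ∀ (y : Reg {v // v ∈ M'}) z, encode (Function.update E w G) y z = encode E y z := by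
    intro y z
    have h1 : ∀ v : P.BadOut M', Function.update E w G v.1 = E v.1 := fun v =>
      Function.update_of_ne (fun e : v.1 = w => v.2.1 (e ▸ hw)) _ _
    have h2 : ∀ v : P.GoodOut M', Function.update E w G v.1 = E v.1 := fun v =>
      Function.update_of_ne (fun e : v.1 = w => v.2.1 (e ▸ hw)) _ _
    ext u x
    simp only [encode, Matrix.of_apply, h1, h2]
  simp only [received, h]

/-- The action of the adversary on the corrupted outputs and its memory, in the branch with abort
bits `b`, message `t`, reported result `a` and second abort bits `b'`. -/
def attackMap {side fin : ℕ} (A : Adversary P n M i side fin)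
    (t : Reg {_q : TabIdx (Block n) // i ∈ P.corrupted}) (b : Reg P.Bad)
    (a : Reg {_q : Block n // i ∈ P.corrupted}) (b' : Reg P.Bad) :
    Op (Reg ((P.BadOut M × Block n) ⊕ Fin A.first.mem)) →ₗ[ℂ] Op (Reg (Fin fin)) where
  toFun ρ := slice (Sum.elim a b') (A.attack.run (put t (slice b (A.first.respond.run ρ))))
  map_add' ρ ρ' := by
    have h : put t (slice b (A.first.respond.run (ρ + ρ'))) =
        put t (slice b (A.first.respond.run ρ)) + put t (slice b (A.first.respond.run ρ')) := by
      rw [QCirc.run_add]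
      ext u v
      simp only [put, slice, Matrix.of_apply, Matrix.add_apply, Matrix.submatrix_apply]
      split_ifs <;> simp
    rw [h, QCirc.run_add]
    rfl
  map_smul' c ρ := by
    rw [QCirc.run_smul, slice_smul, put_smul, QCirc.run_smul, slice_smul]
    rfl

lemma attackMap_apply {side fin : ℕ} (A : Adversary P n M i side fin)
    (t : Reg {_q : TabIdx (Block n) // i ∈ P.corrupted}) (b : Reg P.Bad)
    (a : Reg {_q : Block n // i ∈ P.corrupted}) (b' : Reg P.Bad)
    (ρ : Op (Reg ((P.BadOut M × Block n) ⊕ Fin A.first.mem))) : attackMap A t b a b' ρ =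
      slice (Sum.elim a b') (A.attack.run (put t (slice b (A.first.respond.run ρ)))) := rfl

lemma completelyPositive_attackMap {side fin : ℕ} (A : Adversary P n M i side fin)
    (t : Reg {_q : TabIdx (Block n) // i ∈ P.corrupted}) (b : Reg P.Bad)
    (a : Reg {_q : Block n // i ∈ P.corrupted}) (b' : Reg P.Bad) :
    CompletelyPositive (attackMap A t b a b') :=
  (completelyPositive_slice _).comp ((A.attack.completelyPositive inferInstance).comp
    ((completelyPositive_put t).comp ((completelyPositive_slice b).comp
      (A.first.respond.completelyPositive inferInstance))))

/-- The branches of the attack add up to a trace-preserving map, also if the message depends on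
the first abort bits. -/
lemma sum_trace_attackMap {side fin : ℕ} (A : Adversary P n M i side fin)
    (t : Reg P.Bad → Reg {_q : TabIdx (Block n) // i ∈ P.corrupted})
    (ρ : Op (Reg ((P.BadOut M × Block n) ⊕ Fin A.first.mem))) :
    ∑ b, ∑ a, ∑ b', (attackMap A (t b) b a b' ρ).trace = ρ.trace := by
  have h : ∀ b, ∑ a, ∑ b', (attackMap A (t b) b a b' ρ).trace =
      (slice b (A.first.respond.run ρ)).trace := by
    intro b
    simp only [attackMap_apply]
    rw [← sum_reg_sum (fun z => (slice z (A.attack.run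
      (put (t b) (slice b (A.first.respond.run ρ))))).trace), sum_trace_slice,
      A.attack.tracePreserving inferInstance, trace_put]
  simp only [h]
  rw [sum_trace_slice, A.first.respond.tracePreserving inferInstance]

/-- The ideal functionality in terms of the state that it sends. -/
lemma idealRun_eq (C : Circuit P.W) {side fin d : ℕ} (A : Party P n C.measured side fin)
    (ρ : Op (Reg (P.BadIn ⊕ Fin side) × (Reg P.GoodIn × Fin d)))
    (E : Fin P.W → Clifford (Block n)) (y : Reg {v // v ∈ C.measured}) (b : Reg P.Bad) :
    idealRun C A ρ E y b = onFst (fun σ => slice b (A.respond.run σ))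
      (received C.measured E y y (onFst C.run (collect (onFst A.submit.run ρ)))) := rfl

lemma feed_eq {α β γ : Type} [Fintype α] (t : Reg α) (ρ : Op (Reg β × γ)) :
    feed t ρ = onFst (put t) ρ := by
  ext x y
  simp only [feed, onFst_apply, put, cut, Matrix.of_apply]

lemma attacked_eq {side fin d : ℕ} (A : Adversary P n M i side fin)
    (t : Reg {_q : TabIdx (Block n) // i ∈ P.corrupted}) (b : Reg P.Bad)
    (a : Reg {_q : Block n // i ∈ P.corrupted}) (b' : Reg P.Bad)
    (R : Op (Reg ((P.BadOut M × Block n) ⊕ Fin A.first.mem) ×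
      (Reg (P.GoodOut M × Block n) × Fin d))) :
    readOff (Sum.elim a b') (onFst A.attack.run (feed t
      (onFst (fun σ => slice b (A.first.respond.run σ)) R))) =
      onFst (attackMap A t b a b') R := by
  rw [feed_eq]
  rfl

end Received

/-! ### The measurement of the wire -/

section Measurement

variable {P : Setup} {n : ℕ} {M M' : Finset (Fin P.W)} {w : Fin P.W} {i : Fin P.k}

lemma subset_of_insert (hM : M' = insert w M) : M ⊆ M' := hM ▸ Finset.subset_insert w M

lemma mem_of_insert (hM : M' = insert w M) : w ∈ M' := hM ▸ Finset.mem_insert_self w M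

lemma not_good (hi : P.out w = some i) (hc : i ∈ P.corrupted) :
    ¬ ∃ j ∉ P.corrupted, P.out w = some j := by
  rintro ⟨j, hj, hj'⟩
  rw [hi, Option.some_inj] at hj'
  exact hj (hj' ▸ hc)

lemma not_bad (hi : P.out w = some i) (hc : i ∉ P.corrupted) :
    ¬ ∃ j ∈ P.corrupted, P.out w = some j := by
  rintro ⟨j, hj, hj'⟩
  rw [hi, Option.some_inj] at hj'
  exact hc (hj' ▸ hj)

/-- The registers of the corrupted players, if the encoding of `w` is listed separately. -/
def badEquiv (hM : M' = insert w M) (hw : w ∉ M) (hi : P.out w = some i) (hc : i ∈ P.corrupted)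
    (n m : ℕ) : Block n ⊕ ((P.BadOut M' × Block n) ⊕ Fin m) ≃ (P.BadOut M × Block n) ⊕ Fin m :=
  (Equiv.sumAssoc _ _ _).symm.trans (Equiv.sumCongr
    (optEquiv (p := fun v => ∃ j ∈ P.corrupted, P.out v = some j) hM (subset_of_insert hM)
      ⟨hw, i, hc, hi⟩ (Block n)) (Equiv.refl _))

/-- The registers of the corrupted players, if `w` belongs to an honest player. -/
def badEquivHonest (hM : M' = insert w M) (hi : P.out w = some i) (hc : i ∉ P.corrupted)
    (n m : ℕ) : (P.BadOut M' × Block n) ⊕ Fin m ≃ (P.BadOut M × Block n) ⊕ Fin m :=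
  Equiv.sumCongr (inclEquiv (p := fun v => ∃ j ∈ P.corrupted, P.out v = some j) hM
    (subset_of_insert hM) (not_bad hi hc) (Block n)) (Equiv.refl _)

/-- The registers of the honest players, if `w` belongs to a corrupted player. -/
def goodEquiv (hM : M' = insert w M) (hi : P.out w = some i) (hc : i ∈ P.corrupted)
    (n : ℕ) : P.GoodOut M' × Block n ≃ P.GoodOut M × Block n :=
  inclEquiv (p := fun v => ∃ j ∉ P.corrupted, P.out v = some j) hM (subset_of_insert hM)
    (not_good hi hc) (Block n)

/-- The registers of the honest players, if the encoding of `w` is listed separately. -/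
def goodEquivHonest (hM : M' = insert w M) (hw : w ∉ M) (hi : P.out w = some i)
    (hc : i ∉ P.corrupted) (n : ℕ) :
    Block n ⊕ (P.GoodOut M' × Block n) ≃ P.GoodOut M × Block n :=
  optEquiv (p := fun v => ∃ j ∉ P.corrupted, P.out v = some j) hM (subset_of_insert hM)
    ⟨hw, i, hc, hi⟩ (Block n)

/-- The simulated encoding of `w`: the state `F†|x⟩`, next to the other registers. -/
def simulated (hM : M' = insert w M) (hw : w ∉ M) (hi : P.out w = some i) (hc : i ∈ P.corrupted)
    {m : ℕ} (F : Clifford (Block n)) (x : Reg (Block n))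
    (ρ : Op (Reg ((P.BadOut M' × Block n) ⊕ Fin m))) :
    Op (Reg ((P.BadOut M × Block n) ⊕ Fin m)) :=
  (QCirc.relabel (badEquiv hM hw hi hc n m)).run (tens (twirled F x) ρ)

lemma completelyPositive_simulated (hM : M' = insert w M) (hw : w ∉ M) (hi : P.out w = some i)
    (hc : i ∈ P.corrupted) {m : ℕ} (F : Clifford (Block n)) (x : Reg (Block n)) :
    CompletelyPositive (simulated hM hw hi hc (m := m) F x) :=
  ((QCirc.relabel (badEquiv hM hw hi hc n m)).completelyPositive inferInstance).comp
    (completelyPositive_tens_twirled F x)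

lemma trace_simulated (hM : M' = insert w M) (hw : w ∉ M) (hi : P.out w = some i)
    (hc : i ∈ P.corrupted) {m : ℕ} (F : Clifford (Block n)) (x : Reg (Block n))
    (ρ : Op (Reg ((P.BadOut M' × Block n) ⊕ Fin m))) :
    (simulated hM hw hi hc F x ρ).trace = ρ.trace := by
  rw [simulated, (QCirc.relabel (badEquiv hM hw hi hc n m)).tracePreserving inferInstance,
    trace_tens, trace_twirled, one_mul]

/-- If the player who measures is corrupted, then the honest players do nothing. -/
lemma honestMeas_corrupted (hM : M' = insert w M) (hi : P.out w = some i) (hc : i ∈ P.corrupted)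
    (V : Op (Reg (Block n))) (h : Reg {_q : Block n // i ∉ P.corrupted})
    (u' : Reg (P.GoodOut M' × Block n)) (u : Reg (P.GoodOut M × Block n)) :
    honestMeas M M' w i V h u' u = if u = u' ∘ (goodEquiv hM hi hc n).symm then 1 else 0 := by
  have hiff : (∀ (v : Fin P.W) (hv : v ∉ M ∧ ∃ j ∉ P.corrupted, P.out v = some j)
      (hv' : v ∉ M' ∧ ∃ j ∉ P.corrupted, P.out v = some j) (q : Block n),
        u (⟨v, hv⟩, q) = u' (⟨v, hv'⟩, q)) ↔ u = u' ∘ (goodEquiv hM hi hc n).symm := by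
    rw [← Equiv.comp_symm_eq, Equiv.symm_symm]
    constructor
    · intro H
      funext ⟨v, q⟩
      exact H v.1 (incl (subset_of_insert hM) v).2 v.2 q
    · intro H v hv hv' q
      exact congrFun H (⟨v, hv'⟩, q)
  rw [honestMeas, Matrix.of_apply]
  by_cases hu : u = u' ∘ (goodEquiv hM hi hc n).symm
  · rw [if_pos hu, if_pos (hiff.2 hu), dif_neg (fun h => h.1 hc)]
  · rw [if_neg hu, if_neg (fun h => hu (hiff.1 h))]

lemma onMid_honestMeas_corrupted (hM : M' = insert w M) (hi : P.out w = some i)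
    (hc : i ∈ P.corrupted) (V : Op (Reg (Block n))) (h : Reg {_q : Block n // i ∉ P.corrupted})
    {α δ : Type} (ρ : Op (α × (Reg (P.GoodOut M × Block n) × δ))) :
    onMid (sandwich (honestMeas M M' w i V h)) ρ = ρ.submatrix
      (fun x => (x.1, (x.2.1 ∘ (goodEquiv hM hi hc n).symm, x.2.2)))
      (fun x => (x.1, (x.2.1 ∘ (goodEquiv hM hi hc n).symm, x.2.2))) := by
  ext x y
  simp only [onMid, sandwich, Matrix.of_apply, Matrix.mul_apply, Matrix.conjTranspose_apply,
    Matrix.submatrix_apply]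
  rw [Finset.sum_eq_single (y.2.1 ∘ (goodEquiv hM hi hc n).symm),
    Finset.sum_eq_single (x.2.1 ∘ (goodEquiv hM hi hc n).symm)]
  · rw [honestMeas_corrupted hM hi hc, honestMeas_corrupted hM hi hc, if_pos rfl, if_pos rfl,
      star_one, mul_one, one_mul]
  · intro g _ hg
    rw [honestMeas_corrupted hM hi hc, if_neg hg, zero_mul]
  · simp
  · intro g _ hg
    rw [honestMeas_corrupted hM hi hc _ _ y.2.1, if_neg hg, star_zero, mul_zero]
  · simp

/-- Averaged over the phase key, the encoding of `w` with the key `F⁻¹ X^r Z^s CNOT_{1,c}` is the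
state `F†|r + (m, m · c)⟩`, where `m` is the outcome of a measurement of `w`. -/
lemma sum_received_substKey (hM : M' = insert w M) (hw : w ∉ M) (hi : P.out w = some i)
    (hc : i ∈ P.corrupted) {m d : ℕ} (E : Fin P.W → Clifford (Block n))
    (y : Reg {v // v ∈ M}) (σ : Op (Reg (Fin P.W) × (Reg (Fin m) × Fin d)))
    (F : Clifford (Block n)) (r : Reg (Block n)) (c : Reg (Fin n))
    (u u' : Reg (P.GoodOut M' × Block n)) (e e' : Fin d) :
    ∑ s, cut (received M (Function.update E w (substKey F r s c)) y y σ)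
      (u ∘ (goodEquiv hM hi hc n).symm, e) (u' ∘ (goodEquiv hM hi hc n).symm, e') =
    (Fintype.card (Reg (Block n)) : ℂ) • ∑ b, simulated hM hw hi hc F (r + codeword b c)
      (cut (received M' E (addOutcome M' y b) (addOutcome M' y b) σ) (u, e) (u', e')) := by
  have hg : ∀ u : Reg (P.GoodOut M' × Block n),
      (fun vq : P.GoodOut M' × Block n => (u ∘ (goodEquiv hM hi hc n).symm)
        (incl (subset_of_insert hM) vq.1, vq.2)) = u := fun u => funext fun vq =>
    congrArg u ((goodEquiv hM hi hc n).symm_apply_apply vq)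
  ext X X'
  simp only [Matrix.sum_apply, Matrix.smul_apply, smul_eq_mul]
  simp only [cut, Matrix.of_apply]
  simp only [received_split_bad hM (subset_of_insert hM) hw hi hc, Function.update_self,
    received_update (mem_of_insert hM)]
  rw [Finset.sum_comm, Finset.mul_sum]
  refine Finset.sum_congr rfl fun b _ => ?_
  rw [Finset.sum_comm]
  simp only [← Finset.sum_mul, sum_encAmp_substKey]
  rw [Finset.sum_eq_single b]
  · rw [if_pos rfl, mul_assoc, hg, hg]
    rfl
  · intro b' _ hb'
    rw [if_neg (Ne.symm hb'), zero_mul]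
  · simp

/-- What the adversary does to the encoding, averaged over the phase key, is what it does to
`F†|x⟩` for `x = r + (m, m · c)`, where `m` is the outcome of a measurement of `w`. -/
lemma sum_onMid_substKey (hM : M' = insert w M) (hw : w ∉ M) (hi : P.out w = some i)
    (hc : i ∈ P.corrupted) {m d : ℕ} {β : Type} (E : Fin P.W → Clifford (Block n))
    (y : Reg {v // v ∈ M}) (σ : Op (Reg (Fin P.W) × (Reg (Fin m) × Fin d)))
    (F : Clifford (Block n)) (r : Reg (Block n)) (c : Reg (Fin n))
    (V : Reg (Block n) → Op (Reg (Block n))) (h : Reg {_q : Block n // i ∉ P.corrupted})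
    (Φ : Op (Reg ((P.BadOut M × Block n) ⊕ Fin m)) →ₗ[ℂ] Op β) :
    ∑ s, onMid (sandwich (honestMeas M M' w i (V s) h)) (onFst Φ
      (received M (Function.update E w (substKey F r s c)) y y σ)) =
    (Fintype.card (Reg (Block n)) : ℂ) • ∑ b,
      onFst (fun ρ => Φ (simulated hM hw hi hc F (r + codeword b c) ρ))
        (received M' E (addOutcome M' y b) (addOutcome M' y b) σ) := by
  simp only [onMid_honestMeas_corrupted hM hi hc]
  refine op_ext_cut fun ⟨u, e⟩ ⟨u', e'⟩ => ?_
  rw [cut_sum, cut_smul, cut_sum]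
  simp only [cut_onFst]
  rw [← map_sum, ← map_smul, ← sum_received_substKey hM hw hi hc, map_sum]
  rfl

lemma sum_comm_four {α β γ δ : Type} [Fintype α] [Fintype β] [Fintype γ] [Fintype δ]
    (f : α → β → γ → δ → ℂ) :
    ∑ a, ∑ b, ∑ c, ∑ d, f a b c d = ∑ c, ∑ d, ∑ a, ∑ b, f a b c d := by
  have h1 : ∀ a, ∑ b, ∑ c, ∑ d, f a b c d = ∑ c, ∑ d, ∑ b, f a b c d := fun a => by
    rw [Finset.sum_comm]
    exact Finset.sum_congr rfl fun c _ => Finset.sum_comm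
  simp only [h1]
  rw [Finset.sum_comm]
  exact Finset.sum_congr rfl fun c _ => Finset.sum_comm

/-- The measurement of an honest player who holds the wire `w`. -/
lemma honestMeas_honest (hM : M' = insert w M) (hw : w ∉ M) (hi : P.out w = some i)
    (hc : i ∉ P.corrupted) (V : Op (Reg (Block n))) (h : Reg {_q : Block n // i ∉ P.corrupted})
    (u' : Reg (P.GoodOut M' × Block n)) (p : Reg (Block n)) (u : Reg (P.GoodOut M' × Block n)) :
    honestMeas M M' w i V h u' (Sum.elim p u ∘ (goodEquivHonest hM hw hi hc n).symm) =
      if u = u' then V (fun q => h ⟨q, hc⟩) p else 0 := by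
  have hu : ∀ z, (Sum.elim p u ∘ (goodEquivHonest hM hw hi hc n).symm)
      (goodEquivHonest hM hw hi hc n z) = Sum.elim p u z := fun z =>
    congrArg (Sum.elim p u) ((goodEquivHonest hM hw hi hc n).symm_apply_apply z)
  have hp : (fun q => (Sum.elim p u ∘ (goodEquivHonest hM hw hi hc n).symm)
      (⟨w, hw, i, hc, hi⟩, q)) = p := funext fun q => hu (.inl q)
  have hiff : (∀ (v : Fin P.W) (hv : v ∉ M ∧ ∃ j ∉ P.corrupted, P.out v = some j)
      (hv' : v ∉ M' ∧ ∃ j ∉ P.corrupted, P.out v = some j) (q : Block n),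
        (Sum.elim p u ∘ (goodEquivHonest hM hw hi hc n).symm) (⟨v, hv⟩, q) =
          u' (⟨v, hv'⟩, q)) ↔ u = u' := by
    constructor
    · intro H
      funext ⟨v, q⟩
      exact (hu (.inr (v, q))).symm.trans
        (H v.1 (incl (subset_of_insert hM) v).2 v.2 q)
    · rintro rfl v hv hv' q
      exact hu (.inr (⟨v, hv'⟩, q))
  rw [honestMeas, Matrix.of_apply]
  by_cases h0 : u = u'
  · rw [if_pos h0, if_pos (hiff.2 h0), dif_pos ⟨hc, hw, i, hc, hi⟩, hp]
  · rw [if_neg h0, if_neg (fun h => h0 (hiff.1 h))]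

/-- If the player who measures is honest, then the other players see the state of the functionality
that measures `w`, weighted with the amplitudes of the reported result. -/
lemma onMid_honest (hM : M' = insert w M) (hw : w ∉ M) (hi : P.out w = some i)
    (hc : i ∉ P.corrupted) {m d : ℕ} {β : Type} (E : Fin P.W → Clifford (Block n))
    (y : Reg {v // v ∈ M}) (σ : Op (Reg (Fin P.W) × (Reg (Fin m) × Fin d)))
    (V : Op (Reg (Block n))) (h : Reg {_q : Block n // i ∉ P.corrupted})
    (Φ : Op (Reg ((P.BadOut M × Block n) ⊕ Fin m)) →ₗ[ℂ] Op β) :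
    onMid (sandwich (honestMeas M M' w i V h)) (onFst Φ (received M E y y σ)) =
      ∑ b, ∑ b', ((∑ p, V (fun q => h ⟨q, hc⟩) p * encAmp (E w) b p) *
        star (∑ p, V (fun q => h ⟨q, hc⟩) p * encAmp (E w) b' p)) •
        onFst (fun ρ => Φ ((QCirc.relabel (badEquivHonest hM hi hc n m)).run ρ))
          (received M' E (addOutcome M' y b) (addOutcome M' y b') σ) := by
  have hsum : ∀ (f : Reg (P.GoodOut M × Block n) → ℂ), ∑ g, f g = ∑ p, ∑ u,
      f (Sum.elim p u ∘ (goodEquivHonest hM hw hi hc n).symm) := by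
    intro f
    rw [← sum_reg_sum fun z => f (z ∘ (goodEquivHonest hM hw hi hc n).symm)]
    exact (Equiv.sum_comp (Equiv.arrowCongr (goodEquivHonest hM hw hi hc n)
      (Equiv.refl (ZMod 2))) f).symm
  have hcut : ∀ p p' u u' e e', cut (received M E y y σ)
      (Sum.elim p u ∘ (goodEquivHonest hM hw hi hc n).symm, e)
      (Sum.elim p' u' ∘ (goodEquivHonest hM hw hi hc n).symm, e') =
      ∑ b, ∑ b', (encAmp (E w) b p * star (encAmp (E w) b' p')) •
        (QCirc.relabel (badEquivHonest hM hi hc n m)).run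
          (cut (received M' E (addOutcome M' y b) (addOutcome M' y b') σ) (u, e) (u', e')) := by
    intro p p' u u' e e'
    have hu : ∀ (p : Reg (Block n)) (u : Reg (P.GoodOut M' × Block n)) z,
        (Sum.elim p u ∘ (goodEquivHonest hM hw hi hc n).symm)
        (goodEquivHonest hM hw hi hc n z) = Sum.elim p u z := fun p u z =>
      congrArg (Sum.elim p u) ((goodEquivHonest hM hw hi hc n).symm_apply_apply z)
    have h1 : ∀ (p : Reg (Block n)) (u : Reg (P.GoodOut M' × Block n)),
        (fun q => (Sum.elim p u ∘ (goodEquivHonest hM hw hi hc n).symm)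
      (⟨w, hw, i, hc, hi⟩, q)) = p := fun p u => funext fun q => hu p u (.inl q)
    have h2 : ∀ (p : Reg (Block n)) (u : Reg (P.GoodOut M' × Block n)),
        (fun vq : P.GoodOut M' × Block n =>
        (Sum.elim p u ∘ (goodEquivHonest hM hw hi hc n).symm)
        (incl (subset_of_insert hM) vq.1, vq.2)) = u := fun p u => funext fun vq =>
          hu p u (.inr vq)
    ext X X'
    have h3 := received_split_good hM (subset_of_insert hM) hw hi hc E y σ X X'
      (Sum.elim p u ∘ (goodEquivHonest hM hw hi hc n).symm)
      (Sum.elim p' u' ∘ (goodEquivHonest hM hw hi hc n).symm) e e'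
    rw [h1, h1, h2, h2] at h3
    refine h3.trans ?_
    simp only [Matrix.sum_apply, Matrix.smul_apply, smul_eq_mul]
    refine Finset.sum_congr rfl fun b _ => Finset.sum_congr rfl fun b' _ => ?_
    simp only [QCirc.run_relabel, Matrix.submatrix_apply, cut, Matrix.of_apply]
    congr 2 <;> (refine Prod.ext (funext fun z => ?_) rfl; rcases z with z | z <;> rfl)
  ext ⟨f, u, e⟩ ⟨f', u', e'⟩
  have hK := honestMeas_honest hM hw hi hc V h
  have h4 : onMid (sandwich (honestMeas M M' w i V h)) (onFst Φ (received M E y y σ))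
      (f, u, e) (f', u', e') = ∑ p', ∑ p, V (fun q => h ⟨q, hc⟩) p * Φ (cut (received M E y y σ)
        (Sum.elim p u ∘ (goodEquivHonest hM hw hi hc n).symm, e)
        (Sum.elim p' u' ∘ (goodEquivHonest hM hw hi hc n).symm, e')) f f' *
          star (V (fun q => h ⟨q, hc⟩) p') := by
    simp only [onMid, sandwich, Matrix.of_apply, Matrix.mul_apply, Matrix.conjTranspose_apply]
    rw [hsum]
    refine Finset.sum_congr rfl fun p' _ => ?_
    rw [Finset.sum_eq_single u']
    · rw [hsum, ← Finset.sum_mul, hK, if_pos rfl]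
      congr 1
      refine Finset.sum_congr rfl fun p _ => ?_
      rw [Finset.sum_eq_single u]
      · rw [hK, if_pos rfl]
        rfl
      · intro v _ hv
        rw [hK, if_neg hv, zero_mul]
      · simp
    · intro v _ hv
      rw [hK, if_neg hv, star_zero, mul_zero]
    · simp
  rw [h4]
  simp only [hcut, map_sum, map_smul, Matrix.sum_apply, Matrix.smul_apply, smul_eq_mul,
    Finset.mul_sum, Finset.sum_mul]
  rw [sum_comm_four]
  refine Finset.sum_congr rfl fun b _ => Finset.sum_congr rfl fun b' _ => ?_
  rw [star_sum, Finset.sum_comm]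
  refine Finset.sum_congr rfl fun p _ => ?_
  rw [Finset.mul_sum, Finset.sum_mul]
  refine Finset.sum_congr rfl fun p' _ => ?_
  rw [star_mul, onFst_apply]
  ring

end Measurement

/-! ### The experiments and the state register -/

section Experiments

variable {P : Setup} {n : ℕ} {M M' : Finset (Fin P.W)} {w : Fin P.W} {i : Fin P.k}

/-- The result that is reported to the classical MPC. -/
def reported (a : Reg {_q : Block n // i ∈ P.corrupted})
    (h : Reg {_q : Block n // i ∉ P.corrupted}) : Reg (Block n) :=
  fun q => if hi : i ∈ P.corrupted then a ⟨q, hi⟩ else h ⟨q, hi⟩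

/-- The message of the MPC to a corrupted player. -/
def message (V : Option (Op (Reg (Block n)))) : Reg {_q : TabIdx (Block n) // i ∈ P.corrupted} :=
  fun q => (V.elim 0 description : Reg (TabIdx (Block n))) q.1

/-- The probability of the output `1` in the real experiment, if `σ` is the state after the
circuit was applied to the submitted inputs. -/
def realValue {side fin d : ℕ} (w : Fin P.W) (A : Adversary P n M i side fin)
    (test : Store n P.W → Op (Reg (Fin fin) × (Reg (P.GoodOut M' × Block n) × Fin d)))
    (σ : Op (Reg (Fin P.W) × (Reg (Fin A.first.mem) × Fin d))) : ℝ :=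
  Finset.expect Finset.univ fun E : Fin P.W → Clifford (Block n) =>
    ∑ y : Reg {v // v ∈ M}, ∑ b : Reg P.Bad,
      Finset.expect Finset.univ fun k : Reg (Block n) × Reg (Block n) × Reg (Fin n) =>
        ∑ a : Reg {_q : Block n // i ∈ P.corrupted}, ∑ b' : Reg P.Bad,
          ∑ h : Reg {_q : Block n // i ∉ P.corrupted},
            (Matrix.trace (test (measStore (idealStore E y b) w k.1 k.2.2 (reported a h) b') *
              onMid (sandwich (honestMeas M M' w i
                ((instruction (idealStore E y b) w k.1 k.2.1 k.2.2).getD 1) h))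
                (onFst (attackMap A (message (instruction (idealStore E y b) w k.1 k.2.1 k.2.2))
                  b a b') (received M E y y σ)))).re

/-- The probability of the output `1` in the ideal experiment, if `σ` is the state after the
circuit was applied to the submitted inputs. -/
def idealValue {m fin d : ℕ} (q : QCirc ((P.BadOut M' × Block n) ⊕ Fin m) (P.Bad ⊕ Fin fin))
    (test : Store n P.W → Op (Reg (Fin fin) × (Reg (P.GoodOut M' × Block n) × Fin d)))
    (σ : Op (Reg (Fin P.W) × (Reg (Fin m) × Fin d))) : ℝ :=
  Finset.expect Finset.univ fun E : Fin P.W → Clifford (Block n) =>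
    ∑ y : Reg {v // v ∈ M'}, ∑ b : Reg P.Bad,
      (Matrix.trace (test (idealStore E y b) *
        onFst (fun ρ => slice b (q.run ρ)) (received M' E y y σ))).re

lemma realProb_eq (C : Circuit P.W) (w : Fin P.W) (i : Fin P.k) {side fin : ℕ}
    (A : Adversary P n C.measured i side fin)
    (Z : Environment P n (Circuit.measured (C ++ [Gate.meas w])) side fin) :
    realProb C w i A Z = realValue w A Z.test
      (onFst C.run (collect (onFst A.first.submit.run Z.state))) := by
  simp only [realProb, idealRun_eq, attacked_eq]
  rfl

lemma idealProb_eq (C : Circuit P.W) (w : Fin P.W) {side fin : ℕ}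
    (S : Party P n (Circuit.measured (C ++ [Gate.meas w])) side fin)
    (Z : Environment P n (Circuit.measured (C ++ [Gate.meas w])) side fin) :
    idealProb (C ++ [Gate.meas w]) S Z = idealValue S.respond Z.test
      (onFst C.run (collect (onFst S.submit.run Z.state))) := by
  have hw : w ∈ Circuit.measured (C ++ [Gate.meas w]) := by
    rw [Circuit.measured_append]; exact Finset.mem_insert_self _ _
  have h : ∀ E y ρ, received (Circuit.measured (C ++ [Gate.meas w])) (n := n) (m := S.mem)
      (d := Z.dim) E y y (onFst (Circuit.run (C ++ [Gate.meas w])) ρ) =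
        received (Circuit.measured (C ++ [Gate.meas w])) E y y (onFst C.run ρ) := by
    intro E y ρ
    rw [Circuit.run_append_meas]
    exact received_meas hw E y (onFst C.run ρ)
  simp only [idealProb, idealRun_eq, h]
  rfl

lemma decodeOutcome_eq_some {r r' : Reg (Block n)} {c : Reg (Fin n)} {m : ZMod 2} :
    decodeOutcome r c r' = some m ↔ r' = r + codeword m c := by
  have h0 : ∀ m, r' = r + codeword m c → r' none + r none = m := by
    rintro m rfl
    change r none + m + r none = m
    rw [add_comm (r none), add_assoc, zmod_two_add_self, add_zero]
  have h1 : decodeOutcome r c r' = if r' = r + codeword (r' none + r none) c then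
      some (r' none + r none) else none := rfl
  rw [h1]
  constructor
  · intro h
    split_ifs at h with h2
    rw [Option.some_inj] at h
    rw [← h]
    exact h2
  · intro h
    rw [h0 m h, if_pos h]

lemma instruction_idealStore (hw : w ∉ M) (hi : P.out w = some i)
    (E : Fin P.W → Clifford (Block n)) (y : Reg {v // v ∈ M}) (b : Reg P.Bad)
    (r s : Reg (Block n)) (c : Reg (Fin n)) : instruction (idealStore E y b) w r s c =
      if b = 0 then some (pauli r s * cnotTraps c * (E w).unitaryᴴ) else none := by
  by_cases hb : b = 0
  · rw [if_pos hb, idealStore, if_pos hb]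
    simp only [instruction, Option.bind_some, dif_neg hw, hi]
    rfl
  · rw [if_neg hb, idealStore, if_neg hb]
    rfl

open Classical in
/-- The content of the state register of the ideal functionality that measures `w`, or `⊥`. -/
def storeIf (E : Fin P.W → Clifford (Block n)) (y : Reg {v // v ∈ M'}) (ok : Prop) :
    Store n P.W := if ok then idealStore E y 0 else none

/-- The state register of the protocol is that of the functionality that measures `w`, up to the
check of the reported result. It does not contain the key of `w`. -/
lemma measStore_idealStore (hM : M' = insert w M) (hw : w ∉ M) (E E' : Fin P.W → Clifford (Block n))
    (hE : ∀ v, v ≠ w → E v = E' v) (y : Reg {v // v ∈ M}) (b b' : Reg P.Bad)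
    (r r' : Reg (Block n)) (c : Reg (Fin n)) : measStore (idealStore E y b) w r c r' b' =
      if b = 0 ∧ b' = 0 then (decodeOutcome r c r').bind fun m =>
        idealStore E' (addOutcome M' y m) 0 else none := by
  rw [measStore]
  by_cases hb' : b' = 0
  · by_cases hb : b = 0
    · rw [if_pos hb', if_pos ⟨hb, hb'⟩, idealStore, if_pos hb, Option.bind_some]
      cases decodeOutcome r c r' with
      | none => rfl
      | some m =>
        rw [Option.map_some, Option.bind_some, idealStore, if_pos rfl]
        congr 1
        funext v
        by_cases hvw : v = w
        · subst hvw
          rw [Function.update_self, dif_pos (mem_of_insert hM)]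
          rw [addOutcome_of_notMem (by exact hw)]
        · rw [Function.update_of_ne hvw]
          by_cases hv : v ∈ M
          · rw [dif_pos hv, dif_pos (subset_of_insert hM hv), addOutcome_of_mem (by exact hv)]
          · have hv' : v ∉ M' := fun h => hvw (eq_of_mem_of_notMem hM h hv)
            rw [dif_neg hv, dif_neg hv', hE v hvw]
    · rw [if_pos hb', if_neg (fun h => hb h.1), idealStore, if_neg hb]
      rfl
  · rw [if_neg hb', if_neg (fun h => hb' h.2)]

/-- With the substituted key, the message to a corrupted player is the description of `F`. -/
lemma message_instruction (hw : w ∉ M) (hi : P.out w = some i) (F : Clifford (Block n))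
    (E : Fin P.W → Clifford (Block n)) (y : Reg {v // v ∈ M}) (b : Reg P.Bad)
    (r s : Reg (Block n)) (c : Reg (Fin n)) :
    (message (instruction (idealStore (Function.update E w (substKey F r s c)) y b) w r s c) :
      Reg {_q : TabIdx (Block n) // i ∈ P.corrupted}) =
        if b = 0 then (fun q => F.1 q.1) else
          (0 : Reg {_q : TabIdx (Block n) // i ∈ P.corrupted}) := by
  rw [instruction_idealStore hw hi]
  by_cases hb : b = 0
  · rw [if_pos hb, if_pos hb, Function.update_self]
    funext q
    rw [message, Option.elim_some, description_instruction]
  · rw [if_neg hb, if_neg hb]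
    rfl

lemma expect_prod {α β : Type} [Fintype α] [Fintype β] (f : α × β → ℝ) :
    Finset.expect Finset.univ f =
      Finset.expect Finset.univ fun a => Finset.expect Finset.univ fun b => f (a, b) := by
  rw [← Finset.univ_product_univ, Finset.expect_product]

/-- One value of a uniformly random function can be sampled separately. -/
lemma expect_update {κ G : Type} [Fintype κ] [DecidableEq κ] [Fintype G] (w : κ)
    (f : (κ → G) → ℝ) : Finset.expect Finset.univ f =
      Finset.expect Finset.univ fun E => Finset.expect Finset.univ fun g =>
        f (Function.update E w g) := by
  cases isEmpty_or_nonempty G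
  · have : IsEmpty (κ → G) := ⟨fun h => isEmptyElim (h w)⟩
    simp
  -- Exchanging the value at `w` with a second, independent one is a bijection.
  let e : ((κ → G) × G) ≃ ((κ → G) × G) :=
    { toFun := fun z => (Function.update z.1 w z.2, z.1 w)
      invFun := fun z => (Function.update z.1 w z.2, z.1 w)
      left_inv := fun z => by simp
      right_inv := fun z => by simp }
  rw [← expect_prod fun z : (κ → G) × G => f (Function.update z.1 w z.2),
    Fintype.expect_equiv e (fun z => f (Function.update z.1 w z.2)) (fun z => f z.1)
      (fun z => rfl), expect_prod]
  refine Finset.expect_congr rfl fun E _ => ?_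
  exact (Fintype.expect_const (f E)).symm

end Experiments

/-! ### The simulation of a corrupted player -/

section Corrupted

variable {P : Setup} {n : ℕ} {M M' : Finset (Fin P.W)} {w : Fin P.W} {i : Fin P.k}

lemma codeword_add_self (m : ZMod 2) (c : Reg (Fin n)) : codeword m c + codeword m c = 0 :=
  funext fun _ => zmod_two_add_self _

/-- What a corrupted player learns from the MPC: the description of `F`, unless some corrupted
player has aborted. -/
def keyMessage (F : Clifford (Block n)) (b : Reg P.Bad) :
    Reg {_q : TabIdx (Block n) // i ∈ P.corrupted} := if b = 0 then (fun q => F.1 q.1) else 0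

/-- The state after the attack, if the adversary holds `F†|x⟩` instead of the encoding of `w`. -/
def branch (hM : M' = insert w M) (hw : w ∉ M) (hi : P.out w = some i) (hc : i ∈ P.corrupted)
    {side fin d : ℕ} (A : Adversary P n M i side fin)
    (σ : Op (Reg (Fin P.W) × (Reg (Fin A.first.mem) × Fin d))) (E : Fin P.W → Clifford (Block n))
    (F : Clifford (Block n)) (x : Reg (Block n)) (y : Reg {v // v ∈ M'}) (b : Reg P.Bad)
    (a : Reg {_q : Block n // i ∈ P.corrupted}) (b' : Reg P.Bad) :
    Op (Reg (Fin fin) × (Reg (P.GoodOut M' × Block n) × Fin d)) :=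
  onFst (fun ρ => attackMap A (keyMessage F b) b a b' (simulated hM hw hi hc F x ρ))
    (received M' E y y σ)

lemma branch_posSemidef (hM : M' = insert w M) (hw : w ∉ M) (hi : P.out w = some i)
    (hc : i ∈ P.corrupted) {side fin d : ℕ} (A : Adversary P n M i side fin)
    {σ : Op (Reg (Fin P.W) × (Reg (Fin A.first.mem) × Fin d))} (hσ : σ.PosSemidef)
    (E : Fin P.W → Clifford (Block n)) (F : Clifford (Block n)) (x : Reg (Block n))
    (y : Reg {v // v ∈ M'}) (b : Reg P.Bad) (a : Reg {_q : Block n // i ∈ P.corrupted})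
    (b' : Reg P.Bad) : (branch hM hw hi hc A σ E F x y b a b').PosSemidef :=
  (completelyPositive_attackMap A (keyMessage F b) b a b').comp
    (completelyPositive_simulated hM hw hi hc F x) _ _ (received_posSemidef E y hσ)

lemma sum_trace_branch (hM : M' = insert w M) (hw : w ∉ M) (hi : P.out w = some i)
    (hc : i ∈ P.corrupted) {side fin d : ℕ} (A : Adversary P n M i side fin)
    (σ : Op (Reg (Fin P.W) × (Reg (Fin A.first.mem) × Fin d)))
    (E : Fin P.W → Clifford (Block n)) (F : Clifford (Block n)) (x : Reg (Block n)) :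
    ∑ y, ∑ b, ∑ a, ∑ b', (branch hM hw hi hc A σ E F x y b a b').trace = σ.trace := by
  have h : ∀ y, ∑ b, ∑ a, ∑ b', (branch hM hw hi hc A σ E F x y b a b').trace =
      (received M' E y y σ).trace := by
    intro y
    simp only [← Fintype.sum_prod_type']
    refine trace_onFst_sum (Φ := fun z : Reg P.Bad × Reg {_q : Block n // i ∈ P.corrupted} ×
      Reg P.Bad => fun ρ => attackMap A (keyMessage F z.1) z.1 z.2.1 z.2.2
        (simulated hM hw hi hc F x ρ)) Finset.univ (fun ρ => ?_) (received M' E y y σ)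
    simp only [Fintype.sum_prod_type]
    rw [sum_trace_attackMap A (keyMessage F), trace_simulated]
  simp only [h]
  exact sum_trace_received E σ

lemma re_trace_mul_sum {α κ : Type} [Fintype α] (T : Op α) (s : Finset κ) (X : κ → Op α) :
    (T * ∑ k ∈ s, X k).trace.re = ∑ k ∈ s, (T * X k).trace.re := by
  rw [Matrix.mul_sum, Matrix.trace_sum, Complex.re_sum]

lemma expect_phase_key (hM : M' = insert w M) (hw : w ∉ M) (hi : P.out w = some i)
    (hc : i ∈ P.corrupted) {side fin d : ℕ} (A : Adversary P n M i side fin)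
    (σ : Op (Reg (Fin P.W) × (Reg (Fin A.first.mem) × Fin d)))
    (E : Fin P.W → Clifford (Block n)) (F : Clifford (Block n)) (r : Reg (Block n))
    (c : Reg (Fin n)) (y : Reg {v // v ∈ M}) (b : Reg P.Bad)
    (a : Reg {_q : Block n // i ∈ P.corrupted}) (b' : Reg P.Bad)
    (h : Reg {_q : Block n // i ∉ P.corrupted}) (V : Reg (Block n) → Op (Reg (Block n)))
    (T : Op (Reg (Fin fin) × (Reg (P.GoodOut M' × Block n) × Fin d))) :
    (Finset.expect Finset.univ fun s => (T * onMid (sandwich (honestMeas M M' w i (V s) h))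
      (onFst (attackMap A (keyMessage F b) b a b')
        (received M (Function.update E w (substKey F r s c)) y y σ))).trace.re) =
    ∑ m, (T * branch hM hw hi hc A σ E F (r + codeword m c)
      (addOutcome M' y m) b a b').trace.re := by
  rw [Fintype.expect_eq_sum_div_card, ← re_trace_mul_sum,
    sum_onMid_substKey hM hw hi hc E y σ F r c V h, Matrix.mul_smul, Matrix.trace_smul,
    ← re_trace_mul_sum, smul_eq_mul, ← Complex.ofReal_natCast, Complex.re_ofReal_mul,
    mul_div_cancel_left₀ _ (Nat.cast_ne_zero.2 Fintype.card_ne_zero)]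
  rfl

/-- The experiment in the variables of the simulation. The uniform key of `w` is replaced by
`F⁻¹ X^r Z^s CNOT_{1,c}`, with `F` uniform; the average over `s` measures `w`; and instead of
`r`, the label `x = r + (m, m · c)` is uniform, so that the state of the adversary does not depend
on `c`. -/
lemma realValue_corrupted (hM : M' = insert w M) (hw : w ∉ M) (hi : P.out w = some i)
    (hc : i ∈ P.corrupted) {side fin d : ℕ} (A : Adversary P n M i side fin)
    (test : Store n P.W → Op (Reg (Fin fin) × (Reg (P.GoodOut M' × Block n) × Fin d)))
    (σ : Op (Reg (Fin P.W) × (Reg (Fin A.first.mem) × Fin d))) :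
    realValue w A test σ = Finset.expect Finset.univ fun E : Fin P.W → Clifford (Block n) =>
      Finset.expect Finset.univ fun F : Clifford (Block n) =>
      Finset.expect Finset.univ fun c : Reg (Fin n) =>
      Finset.expect Finset.univ fun x : Reg (Block n) =>
        ∑ y : Reg {v // v ∈ M}, ∑ m, ∑ b, ∑ a, ∑ b',
          (test (measStore (idealStore E y b) w (x + codeword m c) c (reported (i := i) a 0) b') *
            branch hM hw hi hc A σ E F x (addOutcome M' y m) b a b').trace.re := by
  have hempty : IsEmpty {_q : Block n // i ∉ P.corrupted} := ⟨fun q => q.2 hc⟩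
  have h1 : ∀ f : Reg {_q : Block n // i ∉ P.corrupted} → ℝ, ∑ h, f h = f 0 := fun f =>
    Fintype.sum_subsingleton _ 0
  -- For fixed `r`, `s`, `c` the map from `F` to the key is a bijection of the group.
  have hG : ∀ (r s : Reg (Block n)) (c : Reg (Fin n)) (f : Clifford (Block n) → ℝ),
      Finset.expect Finset.univ f = Finset.expect Finset.univ fun F => f (substKey F r s c) := by
    intro r s c f
    let e : Clifford (Block n) ≃ Clifford (Block n) :=
      (Equiv.inv _).trans (Equiv.mulRight (toClifford (measOp r s c) (isClifford_measOp r s c)))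
    exact (Fintype.expect_equiv e (fun F => f (substKey F r s c)) f fun F => rfl).symm
  -- the contribution of the keys `E` and the randomness `k` of the MPC
  let f (E : Fin P.W → Clifford (Block n)) (k : Reg (Block n) × Reg (Block n) × Reg (Fin n)) : ℝ :=
    ∑ y : Reg {v // v ∈ M}, ∑ b : Reg P.Bad, ∑ a : Reg {_q : Block n // i ∈ P.corrupted},
      ∑ b' : Reg P.Bad,
        (Matrix.trace (test (measStore (idealStore E y b) w k.1 k.2.2 (reported a 0) b') *
          onMid (sandwich (honestMeas M M' w i
            ((instruction (idealStore E y b) w k.1 k.2.1 k.2.2).getD 1) 0))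
            (onFst (attackMap A (message (instruction (idealStore E y b) w k.1 k.2.1 k.2.2))
              b a b') (received M E y y σ)))).re
  have h2 : realValue w A test σ = Finset.expect Finset.univ fun E =>
      Finset.expect Finset.univ fun k => f E k := by
    simp only [realValue, h1, f, Finset.expect_sum_comm]
  have h3 : ∀ E F c, (Finset.expect Finset.univ fun r => Finset.expect Finset.univ fun s =>
      f (Function.update E w (substKey F r s c)) (r, s, c)) =
      Finset.expect Finset.univ fun x : Reg (Block n) =>
        ∑ y : Reg {v // v ∈ M}, ∑ m, ∑ b, ∑ a, ∑ b',
          (test (measStore (idealStore E y b) w (x + codeword m c) c (reported (i := i) a 0) b') *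
            branch hM hw hi hc A σ E F x (addOutcome M' y m) b a b').trace.re := by
    intro E F c
    -- The state register after the protocol does not contain the key of `w`.
    have hS : ∀ r s (y : Reg {v // v ∈ M}) b (a : Reg {_q : Block n // i ∈ P.corrupted}) b',
        measStore (idealStore
        (Function.update E w (substKey F r s c)) y b) w r c (reported a 0) b' =
        measStore (idealStore E y b) w r c (reported (i := i) a 0) b' := by
      intro r s y b a b'
      rw [measStore_idealStore hM hw _ E fun v hv => Function.update_of_ne hv _ _,
        measStore_idealStore hM hw E E fun _ _ => rfl]
    have hm : ∀ r s (y : Reg {v // v ∈ M}) b,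
        (message (instruction (idealStore (Function.update E w
        (substKey F r s c)) y b) w r s c) : Reg {_q : TabIdx (Block n) // i ∈ P.corrupted}) =
        keyMessage F b := fun r s y b => message_instruction hw hi F E y b r s c
    simp only [f, hS, hm, Finset.expect_sum_comm]
    refine Finset.sum_congr rfl fun y _ => ?_
    have h4 : ∀ b (a : Reg {_q : Block n // i ∈ P.corrupted}) b' r,
        (Finset.expect Finset.univ fun s =>
          (test (measStore (idealStore E y b) w r c (reported a 0) b') *
            onMid (sandwich (honestMeas M M' w i ((instruction (idealStore
              (Function.update E w (substKey F r s c)) y b) w r s c).getD 1) 0))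
              (onFst (attackMap A (keyMessage F b) b a b')
                (received M (Function.update E w (substKey F r s c)) y y σ))).trace.re) =
          ∑ m, (test (measStore (idealStore E y b) w r c (reported a 0) b') *
            branch hM hw hi hc A σ E F (r + codeword m c) (addOutcome M' y m) b a b').trace.re :=
      fun b a b' r => expect_phase_key hM hw hi hc A σ E F r c y b a b' 0
        (fun s => (instruction (idealStore
              (Function.update E w (substKey F r s c)) y b) w r s c).getD 1) _
    simp only [h4, Finset.expect_sum_comm]
    have h5 : ∀ (g : Reg P.Bad → Reg {_q : Block n // i ∈ P.corrupted} → Reg P.Bad → ZMod 2 → ℝ),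
        ∑ b, ∑ a, ∑ b', ∑ m, g b a b' m = ∑ m, ∑ b, ∑ a, ∑ b', g b a b' m := by
      intro g
      have e1 : ∀ b a, ∑ b', ∑ m, g b a b' m = ∑ m, ∑ b', g b a b' m := fun _ _ => Finset.sum_comm
      have e2 : ∀ b, ∑ a, ∑ m, ∑ b', g b a b' m = ∑ m, ∑ a, ∑ b', g b a b' m := fun _ =>
        Finset.sum_comm
      simp only [e1, e2]
      exact Finset.sum_comm
    rw [h5]
    refine Finset.sum_congr rfl fun m _ => Finset.sum_congr rfl fun b _ =>
      Finset.sum_congr rfl fun a _ => Finset.sum_congr rfl fun b' _ => ?_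
    -- The substitution of `x` for `r`.
    refine Fintype.expect_equiv (Equiv.addRight (codeword m c)) _ _ fun r => ?_
    change _ = (test (measStore (idealStore E y b) w (r + codeword m c + codeword m c) c _ b') *
      branch hM hw hi hc A σ E F (r + codeword m c) (addOutcome M' y m) b a b').trace.re
    rw [add_assoc, codeword_add_self, add_zero]
  clear_value f
  have h6 : ∀ g : Reg (Block n) × Reg (Block n) × Reg (Fin n) → ℝ, Finset.expect Finset.univ g =
      Finset.expect Finset.univ fun c => Finset.expect Finset.univ fun r =>
        Finset.expect Finset.univ fun s => g (r, s, c) := by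
    intro g
    have h8 : ∀ r, (Finset.expect Finset.univ fun z => g (r, z)) = Finset.expect Finset.univ
        fun c => Finset.expect Finset.univ fun s => g (r, s, c) := fun r => by
      rw [expect_prod, Finset.expect_comm]
    rw [expect_prod]
    simp only [h8]
    rw [Finset.expect_comm]
  rw [h2, Finset.expect_comm]
  have h7 : ∀ k : Reg (Block n) × Reg (Block n) × Reg (Fin n), (Finset.expect Finset.univ fun E =>
      f E k) = Finset.expect Finset.univ fun E => Finset.expect Finset.univ fun F =>
        f (Function.update E w (substKey F k.1 k.2.1 k.2.2)) k := by
    intro k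
    rw [expect_update w]
    refine Finset.expect_congr rfl fun E _ => ?_
    rw [hG k.1 k.2.1 k.2.2]
  simp only [h7]
  rw [Finset.expect_comm]
  refine Finset.expect_congr rfl fun E _ => ?_
  rw [Finset.expect_comm]
  refine Finset.expect_congr rfl fun F _ => ?_
  rw [h6]
  exact Finset.expect_congr rfl fun c _ => h3 E F c

end Corrupted

/-! ### The soundness of the check -/

section Hybrid

variable {P : Setup} {n : ℕ} {M M' : Finset (Fin P.W)} {w : Fin P.W} {i : Fin P.k}

/-- A reported result is either the simulated label `x`, or it is rejected, or it hits the one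
other codeword. -/
lemma measStore_eq_or (hM : M' = insert w M) (hw : w ∉ M) (E : Fin P.W → Clifford (Block n))
    (y : Reg {v // v ∈ M}) (m : ZMod 2) (b b' : Reg P.Bad) (x r' : Reg (Block n))
    (c : Reg (Fin n)) :
    measStore (idealStore E y b) w (x + codeword m c) c r' b' =
      storeIf E (addOutcome M' y m) (b = 0 ∧ b' = 0 ∧ r' = x) ∨ r' = x + codeword 1 c := by
  have hx : x + codeword m c + codeword m c = x := by rw [add_assoc, codeword_add_self, add_zero]
  rw [measStore_idealStore hM hw E E fun _ _ => rfl, storeIf]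
  by_cases hb : b = 0 ∧ b' = 0
  · rw [if_pos hb]
    cases hd : decodeOutcome (x + codeword m c) c r' with
    | none =>
      left
      rw [if_neg]
      · rfl
      · rintro ⟨-, -, h⟩
        have := decodeOutcome_eq_some.2 ((h.trans hx.symm : r' = x + codeword m c + codeword m c))
        rw [hd] at this
        exact absurd this (by simp)
    | some m' =>
      have h := decodeOutcome_eq_some.1 hd
      by_cases hm : m' = m
      · left
        rw [hm, hx] at h
        rw [if_pos ⟨hb.1, hb.2, h⟩, hm]
        rfl
      · right
        rw [h, add_assoc, codeword_add]
        have h1 : ∀ m m' : ZMod 2, m' ≠ m → m + m' = 1 := by decide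
        rw [h1 m m' hm]
  · left
    rw [if_neg hb, if_neg fun h => hb ⟨h.1, h.2.1⟩]

/-- A fixed label is hit by the random codeword with probability at most `2^{-n}`. -/
lemma expect_hit_le (p x : Reg (Block n)) {t : ℝ} (ht : 0 ≤ t) :
    (Finset.expect Finset.univ fun c : Reg (Fin n) => if p = x + codeword 1 c then t else 0) ≤
      1 / 2 ^ n * t := by
  rw [Fintype.expect_eq_sum_div_card]
  have hcard : ((Fintype.card (Reg (Fin n)) : ℕ) : ℝ) = 2 ^ n := by simp [ZMod.card]
  rw [hcard, one_div, inv_mul_eq_div]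
  gcongr
  by_cases h : ∃ c : Reg (Fin n), p = x + codeword 1 c
  · obtain ⟨c, hc⟩ := h
    rw [Finset.sum_eq_single c]
    · rw [if_pos hc]
    · intro c' _ hc'
      rw [if_neg]
      intro h
      refine hc' (funext fun j => ?_)
      have h1 := congrFun (add_left_cancel (hc.symm.trans h)) (some j)
      simpa [codeword] using h1.symm
    · simp
  · rw [Finset.sum_eq_zero]
    · exact ht
    · intro c _
      rw [if_neg fun h' => h ⟨c, h'⟩]

/-- The probability of the output `1` if the adversary holds `F†|x⟩` for a random `x`, and only the
result `x` is accepted. -/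
def hybridValue (hM : M' = insert w M) (hw : w ∉ M) (hi : P.out w = some i) (hc : i ∈ P.corrupted)
    {side fin d : ℕ} (A : Adversary P n M i side fin)
    (test : Store n P.W → Op (Reg (Fin fin) × (Reg (P.GoodOut M' × Block n) × Fin d)))
    (σ : Op (Reg (Fin P.W) × (Reg (Fin A.first.mem) × Fin d))) (F : Clifford (Block n)) : ℝ :=
  Finset.expect Finset.univ fun E : Fin P.W → Clifford (Block n) =>
    Finset.expect Finset.univ fun x : Reg (Block n) =>
      ∑ y, ∑ b, ∑ a, ∑ b',
        (test (storeIf E y (b = 0 ∧ b' = 0 ∧ reported (i := i) a 0 = x)) *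
          branch hM hw hi hc A σ E F x y b a b').trace.re

/-- The branches are positive with total trace at most `1`, and so the value is a probability. -/
lemma abs_hybridValue_le (hM : M' = insert w M) (hw : w ∉ M) (hi : P.out w = some i)
    (hc : i ∈ P.corrupted) {side fin d : ℕ} (A : Adversary P n M i side fin)
    {test : Store n P.W → Op (Reg (Fin fin) × (Reg (P.GoodOut M' × Block n) × Fin d))}
    (hT : ∀ s, (test s).PosSemidef) (hT1 : ∀ s, (1 - test s).PosSemidef)
    {σ : Op (Reg (Fin P.W) × (Reg (Fin A.first.mem) × Fin d))} (hσ : σ.PosSemidef)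
    (hσ1 : σ.trace.re ≤ 1)
    (F : Clifford (Block n)) :
    |hybridValue hM hw hi hc A test σ F| ≤ 1 := by
  have h0 : ∀ E x, |∑ y, ∑ b, ∑ a, ∑ b',
        (test (storeIf E y (b = 0 ∧ b' = 0 ∧ reported (i := i) a 0 = x)) *
          branch hM hw hi hc A σ E F x y b a b').trace.re| ≤ 1 := by
    intro E x
    have h1 : ∀ y b (a : Reg {_q : Block n // i ∈ P.corrupted}) b',
        |(test (storeIf E y (b = 0 ∧ b' = 0 ∧ reported a 0 = x)) *
          branch hM hw hi hc A σ E F x y b a b').trace.re| ≤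
          (branch hM hw hi hc A σ E F x y b a b').trace.re := by
      intro y b a b'
      have hb := branch_posSemidef hM hw hi hc A hσ E F x y b a b'
      rw [abs_of_nonneg (re_trace_mul_nonneg (hT _) hb)]
      exact re_trace_mul_le (hT1 _) hb
    have h2 := congrArg Complex.re (sum_trace_branch hM hw hi hc A σ E F x)
    simp only [Complex.re_sum] at h2
    rw [← h2] at hσ1
    refine le_trans ?_ hσ1
    refine (Finset.abs_sum_le_sum_abs _ _).trans (Finset.sum_le_sum fun y _ => ?_)
    refine (Finset.abs_sum_le_sum_abs _ _).trans (Finset.sum_le_sum fun b _ => ?_)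
    refine (Finset.abs_sum_le_sum_abs _ _).trans (Finset.sum_le_sum fun a _ => ?_)
    exact (Finset.abs_sum_le_sum_abs _ _).trans (Finset.sum_le_sum fun b' _ => h1 y b a b')
  refine (Finset.abs_expect_le _ _).trans (Finset.expect_le Finset.univ_nonempty fun E _ => ?_)
  exact (Finset.abs_expect_le _ _).trans (Finset.expect_le Finset.univ_nonempty fun x _ => h0 E x)

/-- The experiment differs from the one in which only the result `x` is accepted if the adversary
guesses the other codeword. -/
lemma abs_realValue_sub_hybridValue_le (hM : M' = insert w M) (hw : w ∉ M)
    (hi : P.out w = some i) (hc : i ∈ P.corrupted) {side fin d : ℕ} (A : Adversary P n M i side fin)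
    {test : Store n P.W → Op (Reg (Fin fin) × (Reg (P.GoodOut M' × Block n) × Fin d))}
    (hT : ∀ s, (test s).PosSemidef) (hT1 : ∀ s, (1 - test s).PosSemidef)
    {σ : Op (Reg (Fin P.W) × (Reg (Fin A.first.mem) × Fin d))} (hσ : σ.PosSemidef)
    (hσ1 : σ.trace.re ≤ 1) :
    |realValue w A test σ - Finset.expect Finset.univ fun F : Clifford (Block n) =>
      hybridValue hM hw hi hc A test σ F| ≤ 1 / 2 ^ n := by
  have h0 : ∀ E F x, |(Finset.expect Finset.univ fun c : Reg (Fin n) =>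
        ∑ y : Reg {v // v ∈ M}, ∑ m, ∑ b, ∑ a, ∑ b',
          (test (measStore (idealStore E y b) w (x + codeword m c) c (reported (i := i) a 0) b') *
            branch hM hw hi hc A σ E F x (addOutcome M' y m) b a b').trace.re) -
      ∑ y, ∑ b, ∑ a, ∑ b',
        (test (storeIf E y (b = 0 ∧ b' = 0 ∧ reported (i := i) a 0 = x)) *
          branch hM hw hi hc A σ E F x y b a b').trace.re| ≤ 1 / 2 ^ n := by
    intro E F x
    have hsum : ∀ g : Reg {v // v ∈ M'} → ℝ,
        ∑ y, g y = ∑ y : Reg {v // v ∈ M}, ∑ m, g (addOutcome M' y m) := by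
      intro g
      rw [← Fintype.sum_prod_type']
      exact ((addOutcome_bijective hM hw).sum_comp g).symm
    -- A branch contributes to the difference only if its result is the other codeword, and then
    -- at most its trace.
    have h1 : ∀ (y : Reg {v // v ∈ M}) m b (a : Reg {_q : Block n // i ∈ P.corrupted}) b' c,
        |(test (measStore (idealStore E y b) w (x + codeword m c) c (reported a 0) b') *
            branch hM hw hi hc A σ E F x (addOutcome M' y m) b a b').trace.re -
          (test (storeIf E (addOutcome M' y m) (b = 0 ∧ b' = 0 ∧ reported a 0 = x)) *
            branch hM hw hi hc A σ E F x (addOutcome M' y m) b a b').trace.re| ≤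
        if reported a 0 = x + codeword 1 c then
          (branch hM hw hi hc A σ E F x (addOutcome M' y m) b a b').trace.re else 0 := by
      intro y m b a b' c
      rcases measStore_eq_or hM hw E y m b b' x (reported a 0) c with h | h
      · rw [h, sub_self, abs_zero]
        split_ifs
        · simpa using re_trace_mul_nonneg (T := 1) Matrix.PosSemidef.one
            (branch_posSemidef hM hw hi hc A hσ E F x (addOutcome M' y m) b a b')
        · exact le_rfl
      · rw [if_pos h]
        exact abs_sub_re_trace_mul_le (hT _) (hT1 _) (hT _) (hT1 _)
          (branch_posSemidef hM hw hi hc A hσ E F x (addOutcome M' y m) b a b')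
    rw [hsum, ← Fintype.expect_const (ι := Reg (Fin n)) (∑ y : Reg {v // v ∈ M}, ∑ m, ∑ b, ∑ a,
      ∑ b', (test (storeIf E (addOutcome M' y m) (b = 0 ∧ b' = 0 ∧ reported (i := i) a 0 = x)) *
          branch hM hw hi hc A σ E F x (addOutcome M' y m) b a b').trace.re),
      ← Finset.expect_sub_distrib]
    simp only [← Finset.sum_sub_distrib]
    have h2 := congrArg Complex.re (sum_trace_branch hM hw hi hc A σ E F x)
    simp only [Complex.re_sum] at h2
    rw [hsum] at h2
    rw [← h2] at hσ1
    refine (Finset.abs_expect_le _ _).trans ?_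
    calc _ ≤ Finset.expect Finset.univ fun c : Reg (Fin n) => ∑ y : Reg {v // v ∈ M}, ∑ m, ∑ b,
          ∑ a, ∑ b', if reported (i := i) a 0 = x + codeword 1 c then
            (branch hM hw hi hc A σ E F x (addOutcome M' y m) b a b').trace.re else 0 := by
          refine Finset.expect_le_expect fun c _ => ?_
          refine (Finset.abs_sum_le_sum_abs _ _).trans (Finset.sum_le_sum fun y _ => ?_)
          refine (Finset.abs_sum_le_sum_abs _ _).trans (Finset.sum_le_sum fun m _ => ?_)
          refine (Finset.abs_sum_le_sum_abs _ _).trans (Finset.sum_le_sum fun b _ => ?_)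
          refine (Finset.abs_sum_le_sum_abs _ _).trans (Finset.sum_le_sum fun a _ => ?_)
          exact (Finset.abs_sum_le_sum_abs _ _).trans
            (Finset.sum_le_sum fun b' _ => h1 y m b a b' c)
      -- The branch and its reported result do not depend on `c`.
      _ ≤ 1 / 2 ^ n * ∑ y : Reg {v // v ∈ M}, ∑ m, ∑ b, ∑ a, ∑ b',
            (branch hM hw hi hc A σ E F x (addOutcome M' y m) b a b').trace.re := by
          simp only [Finset.expect_sum_comm, Finset.mul_sum]
          refine Finset.sum_le_sum fun y _ => Finset.sum_le_sum fun m _ =>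
            Finset.sum_le_sum fun b _ => Finset.sum_le_sum fun a _ =>
              Finset.sum_le_sum fun b' _ => expect_hit_le _ x ?_
          simpa using re_trace_mul_nonneg (T := 1) Matrix.PosSemidef.one
            (branch_posSemidef hM hw hi hc A hσ E F x (addOutcome M' y m) b a b')
      _ ≤ 1 / 2 ^ n * 1 := by gcongr
      _ = _ := mul_one _
  rw [realValue_corrupted hM hw hi hc]
  simp only [hybridValue]
  rw [Finset.expect_comm, ← Finset.expect_sub_distrib]
  refine (Finset.abs_expect_le _ _).trans (Finset.expect_le Finset.univ_nonempty fun F _ => ?_)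
  rw [← Finset.expect_sub_distrib]
  refine (Finset.abs_expect_le _ _).trans (Finset.expect_le Finset.univ_nonempty fun E _ => ?_)
  rw [Finset.expect_comm, ← Finset.expect_sub_distrib]
  exact (Finset.abs_expect_le _ _).trans (Finset.expect_le Finset.univ_nonempty fun x _ => h0 E F x)

end Hybrid

/-! ### The simulators -/

section Simulators

variable {P : Setup} {n : ℕ} {M M' : Finset (Fin P.W)} {w : Fin P.W} {i : Fin P.k}

/-- The experiment with a party that produces the abort bits `v j` in the branch `j`. -/
lemma sum_test_slice {B D J γ : Type} [Fintype B] [DecidableEq B] [Fintype J] [Fintype γ] {fin : ℕ}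
    (q : QCirc D (B ⊕ Fin fin)) (r : ℝ) (v : J → Reg B)
    (Φ : J → Op (Reg D) → Op (Reg (Fin fin)))
    (h : ∀ ρ, q.run ρ = (r : ℂ) • ∑ j, put (v j) (Φ j ρ))
    (T : Reg B → Op (Reg (Fin fin) × γ)) (R : Op (Reg D × γ)) :
    ∑ b, (T b * onFst (fun ρ => slice b (q.run ρ)) R).trace.re =
      r * ∑ j, (T (v j) * onFst (Φ j) R).trace.re := by
  have h1 : ∀ b, onFst (fun ρ => slice b (q.run ρ)) R =
      (r : ℂ) • ∑ j, if v j = b then onFst (Φ j) R else 0 := by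
    intro b
    refine op_ext_cut fun g g' => ?_
    rw [cut_smul, cut_sum, cut_onFst, h, slice_smul, slice_sum]
    congr 1
    refine Finset.sum_congr rfl fun j _ => ?_
    rw [slice_put]
    by_cases hj : v j = b
    · rw [if_pos hj, if_pos hj.symm]
      rfl
    · rw [if_neg hj, if_neg (Ne.symm hj)]
      rfl
  simp only [h1, Matrix.mul_smul, Matrix.trace_smul, smul_eq_mul, Complex.re_ofReal_mul,
    re_trace_mul_sum]
  rw [← Finset.mul_sum, Finset.sum_comm]
  congr 1
  refine Finset.sum_congr rfl fun j _ => ?_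
  rw [Finset.sum_eq_single (v j)]
  · rw [if_pos rfl]
  · intro b _ hb
    rw [if_neg (Ne.symm hb), Matrix.mul_zero, Matrix.trace_zero, Complex.zero_re]
  · simp

lemma relabel_sumCongr_put {c c' d d' a a' : Type} [Fintype c] [Fintype d] [Fintype c']
    [Fintype d'] (e : c ≃ c') (f : d ≃ d') (g : a ≃ a') (x : Reg c) (t : Reg d)
    (ρ : Op (Reg a)) :
    (QCirc.relabel (Equiv.sumCongr (Equiv.sumCongr e f) g)).run (put (Sum.elim x t) ρ) =
      put (Sum.elim (x ∘ e.symm) (t ∘ f.symm)) ((QCirc.relabel g).run ρ) := by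
  have h : ∀ u : Reg ((c' ⊕ d') ⊕ a'), ((u ∘ Equiv.sumCongr (Equiv.sumCongr e f) g) ∘ Sum.inl =
      Sum.elim x t) ↔ u ∘ Sum.inl = Sum.elim (x ∘ e.symm) (t ∘ f.symm) := by
    intro u
    constructor
    · intro H
      funext z
      rcases z with z | z
      · simpa using congrFun H (.inl (e.symm z))
      · simpa using congrFun H (.inr (f.symm z))
    · intro H
      funext z
      rcases z with z | z
      · simpa using congrFun H (.inl (e z))
      · simpa using congrFun H (.inr (f z))
  ext u v
  simp only [QCirc.run_relabel, Matrix.submatrix_apply, put, Matrix.of_apply]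
  by_cases hu : u ∘ Sum.inl = Sum.elim (x ∘ e.symm) (t ∘ f.symm) ∧
      v ∘ Sum.inl = Sum.elim (x ∘ e.symm) (t ∘ f.symm)
  · rw [if_pos hu, if_pos ⟨(h u).2 hu.1, (h v).2 hu.2⟩]
    rfl
  · rw [if_neg hu, if_neg fun H => hu ⟨(h u).1 H.1, (h v).1 H.2⟩]

/-- All abort bits are raised if one of the flags `v` is set. This needs a corrupted player:
without one there is no abort bit. -/
lemma idealStore_raise {κ : Type} (E : Fin P.W → Clifford (Block n)) (y : Reg {v // v ∈ M'})
    (v : Reg κ) (hv : v ≠ 0 → Nonempty P.Bad) :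
    idealStore E y (raise v) = storeIf E y (v = 0) := by
  by_cases h : v = 0
  · rw [storeIf, if_pos h, raise_eq_zero h]
  · have := hv h
    rw [storeIf, if_neg h, idealStore, if_neg fun h' => h (eq_zero_of_raise h')]

lemma expect_reg_sum {a b : Type} [Fintype a] [Fintype b] [DecidableEq a] [DecidableEq b]
    (f : Reg a → Reg b → ℝ) : 1 / 2 ^ Fintype.card (a ⊕ b) *
      ∑ z : Reg (a ⊕ b), f (z ∘ Sum.inl) (z ∘ Sum.inr) =
      Finset.expect Finset.univ fun x => Finset.expect Finset.univ fun y => f x y := by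
  rw [← expect_prod fun z : Reg a × Reg b => f z.1 z.2, Fintype.expect_eq_sum_div_card,
    sum_reg_sum, Fintype.sum_prod_type]
  simp only [Sum.elim_comp_inl, Sum.elim_comp_inr, Fintype.card_prod, Fintype.card_sum,
    Fintype.card_fun, ZMod.card]
  push_cast
  rw [pow_add, div_mul_eq_mul_div, one_mul]

lemma sumElim_eq_zero {a b : Type} (x : Reg a) (y : Reg b) :
    (Sum.elim x y : Reg (a ⊕ b)) = 0 ↔ x = 0 ∧ y = 0 := by
  constructor
  · intro h
    exact ⟨funext fun j => congrFun h (.inl j), funext fun j => congrFun h (.inr j)⟩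
  · rintro ⟨rfl, rfl⟩
    funext j
    rcases j with j | j <;> rfl

lemma reg_eq_iff_add_eq_zero {a : Type} (x y : Reg a) : x = y ↔ x + y = 0 := by
  have h : ∀ s t : ZMod 2, s = t ↔ s + t = 0 := by decide
  rw [funext_iff, funext_iff]
  exact forall_congr' fun j => h (x j) (y j)

/-- If the player `i` is corrupted, the simulator replaces the encoding of `w` by `F†|x⟩`, hands out
the description of `F`, and accepts only the result `x`. -/
theorem exists_simulator_corrupted (hM : M' = insert w M) (hw : w ∉ M) (hi : P.out w = some i)
    (hc : i ∈ P.corrupted) {side fin : ℕ} (A : Adversary P n M i side fin) :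
    ∃ q : QCirc ((P.BadOut M' × Block n) ⊕ Fin A.first.mem) (P.Bad ⊕ Fin fin),
      q.size ≤ samplingBound (Fintype.card (Block n)) (Fintype.card (TabIdx (Block n))) n +
        (A.first.respond.size + A.attack.size + tailBound (Fintype.card (Block n))
          (Fintype.card (TabIdx (Block n))) (Fintype.card P.Bad)) ∧
      ∀ {d : ℕ} {test : Store n P.W → Op (Reg (Fin fin) × (Reg (P.GoodOut M' × Block n) × Fin d))}
        (_hT : ∀ s, (test s).PosSemidef) (_hT1 : ∀ s, (1 - test s).PosSemidef)
        {σ : Op (Reg (Fin P.W) × (Reg (Fin A.first.mem) × Fin d))} (_hσ : σ.PosSemidef)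
        (_hσ1 : σ.trace.re ≤ 1),
        |realValue w A test σ - idealValue q test σ| ≤ 2 * (1 / 2 ^ n) := by
  obtain ⟨m, g, q1, s1, hg, r1⟩ := exists_sampling (Block n)
    ((P.BadOut M' × Block n) ⊕ Fin A.first.mem) n
  obtain ⟨q2, s2, r2⟩ := exists_tail A.first.respond A.attack
  let eX : Block n ≃ {_q : Block n // i ∈ P.corrupted} := (Equiv.subtypeUnivEquiv fun _ => hc).symm
  let eT : TabIdx (Block n) ≃ {_q : TabIdx (Block n) // i ∈ P.corrupted} :=
    (Equiv.subtypeUnivEquiv fun _ => hc).symm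
  let q := QCirc.seq (QCirc.seq q1 (.relabel (Equiv.sumCongr (Equiv.sumCongr eX eT)
    (badEquiv hM hw hi hc n A.first.mem)))) q2
  -- The branches of the simulator, for the random bits `β` and the label `x`, which `j.1`
  -- consists of, the abort bits `b`, the result `a` and the abort bits `b'`.
  have hrun : ∀ ρ, q.run ρ = ((1 / 2 ^ Fintype.card (Fin m ⊕ Block n) : ℝ) : ℂ) •
      ∑ j : Reg (Fin m ⊕ Block n) × (Reg P.Bad × Reg {_q : Block n // i ∈ P.corrupted} ×
        Reg P.Bad),
        put (raise (Sum.elim (j.1 ∘ Sum.inr ∘ eX.symm + j.2.2.1) (Sum.elim j.2.1 j.2.2.2)))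
          (attackMap A (keyMessage (subprod g (j.1 ∘ Sum.inl)) j.2.1) j.2.1 j.2.2.1 j.2.2.2
            (simulated hM hw hi hc (subprod g (j.1 ∘ Sum.inl)) (j.1 ∘ Sum.inr) ρ)) := by
    intro ρ
    simp only [q, QCirc.run_seq, r1, QCirc.run_smul, QCirc.run_sum, relabel_sumCongr_put, r2]
    rw [Fintype.sum_prod_type]
    simp only [Fintype.sum_prod_type]
    push_cast
    rfl
  refine ⟨q, ?_, fun {d test} hT hT1 {σ} hσ hσ1 => ?_⟩
  · have e1 : Fintype.card {_q : Block n // i ∈ P.corrupted} = Fintype.card (Block n) :=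
      (Fintype.card_congr eX).symm
    have e2 : Fintype.card {_q : TabIdx (Block n) // i ∈ P.corrupted} =
      Fintype.card (TabIdx (Block n)) := (Fintype.card_congr eT).symm
    rw [e1, e2] at s2
    simp only [q, QCirc.size]
    omega
  have hval : idealValue q test σ = Finset.expect Finset.univ fun β =>
      hybridValue hM hw hi hc A test σ (subprod g β) := by
    have h1 : ∀ E y, ∑ b, (test (idealStore E y b) * onFst (fun ρ => slice b (q.run ρ))
        (received M' E y y σ)).trace.re = Finset.expect Finset.univ fun β =>
          Finset.expect Finset.univ fun x => ∑ b, ∑ a, ∑ b',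
            (test (storeIf E y (b = 0 ∧ b' = 0 ∧ reported (i := i) a 0 = x)) *
              branch hM hw hi hc A σ E (subprod g β) x y b a b').trace.re := by
      intro E y
      rw [sum_test_slice q _ _ _ hrun fun b => test (idealStore E y b), Fintype.sum_prod_type,
        ← expect_reg_sum fun β x => ∑ b, ∑ a, ∑ b',
            (test (storeIf E y (b = 0 ∧ b' = 0 ∧ reported (i := i) a 0 = x)) *
              branch hM hw hi hc A σ E (subprod g β) x y b a b').trace.re]
      simp only [Fintype.sum_prod_type]
      refine congrArg _ ?_
      refine Finset.sum_congr rfl fun z _ => Finset.sum_congr rfl fun b _ =>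
        Finset.sum_congr rfl fun a _ => Finset.sum_congr rfl fun b' _ => ?_
      rw [idealStore_raise _ _ _ fun _ => ⟨⟨i, hc⟩⟩]
      have h2 : (Sum.elim (z ∘ Sum.inr ∘ eX.symm + a) (Sum.elim b b') :
          Reg ({_q : Block n // i ∈ P.corrupted} ⊕ (P.Bad ⊕ P.Bad))) = 0 ↔
          b = 0 ∧ b' = 0 ∧ reported (i := i) a 0 = z ∘ Sum.inr := by
        rw [sumElim_eq_zero, sumElim_eq_zero, ← reg_eq_iff_add_eq_zero]
        constructor
        · rintro ⟨h, hb, hb'⟩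
          refine ⟨hb, hb', ?_⟩
          rw [← h]
          funext q
          exact dif_pos hc
        · rintro ⟨hb, hb', h⟩
          refine ⟨?_, hb, hb'⟩
          funext q
          exact (congrFun h (eX.symm q)).symm.trans (dif_pos hc)
      rw [h2]
      rfl
    simp only [idealValue, h1, hybridValue, Finset.expect_sum_comm]
    refine Finset.sum_congr rfl fun y _ => Finset.sum_congr rfl fun b _ =>
      Finset.sum_congr rfl fun a _ => Finset.sum_congr rfl fun b' _ => ?_
    rw [Finset.expect_comm]
  rw [hval]
  have h1 := abs_realValue_sub_hybridValue_le hM hw hi hc A hT hT1 hσ hσ1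
  -- The hybrid value is a bounded function of `F`, and the subproducts are almost uniform.
  have h2 := hg _ (abs_hybridValue_le hM hw hi hc A hT hT1 hσ hσ1)
  calc _ ≤ _ := abs_sub_le _ (Finset.expect Finset.univ fun F : Clifford (Block n) =>
          hybridValue hM hw hi hc A test σ F) _
    _ ≤ _ := by linarith

end Simulators

/-! ### An honest player who measures -/

section Honest

variable {P : Setup} {n : ℕ} {M M' : Finset (Fin P.W)} {w : Fin P.W} {i : Fin P.k}

/-- The state after the attack, if the wire `w` is measured by the functionality. -/
def branchHonest (hM : M' = insert w M) (hi : P.out w = some i) (hc : i ∉ P.corrupted)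
    {side fin d : ℕ} (A : Adversary P n M i side fin)
    (σ : Op (Reg (Fin P.W) × (Reg (Fin A.first.mem) × Fin d))) (E : Fin P.W → Clifford (Block n))
    (y y' : Reg {v // v ∈ M'}) (b b' : Reg P.Bad) :
    Op (Reg (Fin fin) × (Reg (P.GoodOut M' × Block n) × Fin d)) :=
  onFst (fun ρ => attackMap A 0 b 0 b'
    ((QCirc.relabel (badEquivHonest hM hi hc n A.first.mem)).run ρ)) (received M' E y y' σ)

lemma re_trace_mul_sum_smul {α : Type} [Fintype α] (T : Op α) (u : ZMod 2 → ℂ)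
    (X : ZMod 2 → ZMod 2 → Op α) :
    (T * ∑ m, ∑ m', (u m * star (u m')) • X m m').trace =
      ∑ m, ∑ m', (u m * star (u m')) * (T * X m m').trace := by
  simp only [Matrix.mul_sum, Matrix.trace_sum, Matrix.mul_smul, Matrix.trace_smul, smul_eq_mul]

/-- With the key of an honest player, exactly the results `r + (m, m · c)` occur. -/
lemma sum_honest_key {α : Type} [Fintype α] (T : Reg (Block n) → Op α)
    (X : ZMod 2 → ZMod 2 → Op α) (E : Clifford (Block n)) (r s : Reg (Block n))
    (c : Reg (Fin n)) :
    ∑ h, (T h * ∑ m, ∑ m',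
      ((∑ p, (pauli r s * cnotTraps c * E.unitaryᴴ) h p * encAmp E m p) *
        star (∑ p, (pauli r s * cnotTraps c * E.unitaryᴴ) h p * encAmp E m' p)) • X m m').trace =
      ∑ m, (T (r + codeword m c) * X m m).trace := by
  simp only [re_trace_mul_sum_smul]
  simp only [honest_amplitude]
  rw [Finset.sum_comm]
  refine Finset.sum_congr rfl fun m _ => ?_
  rw [Finset.sum_eq_single (r + codeword m c)]
  · rw [Finset.sum_eq_single m]
    · rw [if_pos rfl, star_chi, chi_mul_self, one_mul]
    · intro m' _ hm'
      rw [if_neg (fun h => hm' (codeword_injective c (add_left_cancel h)).symm), star_zero,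
        mul_zero, zero_mul]
    · simp
  · intro h _ hh
    refine Finset.sum_eq_zero fun m' _ => ?_
    rw [if_neg hh, zero_mul, zero_mul]
  · simp

/-- If no key is left, a measurement of the encoding and a measurement of the wire look the same
to the others. -/
lemma sum_honest_discard {α : Type} [Fintype α] (T : Op α) (X : ZMod 2 → ZMod 2 → Op α)
    (E : Clifford (Block n)) :
    ∑ h, (T * ∑ m, ∑ m', ((∑ p, (1 : Op (Reg (Block n))) h p * encAmp E m p) *
        star (∑ p, (1 : Op (Reg (Block n))) h p * encAmp E m' p)) • X m m').trace =
      ∑ m, (T * X m m).trace := by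
  have h1 : ∀ h m, ∑ p, (1 : Op (Reg (Block n))) h p * encAmp E m p = encAmp E m h := by
    intro h m
    rw [Finset.sum_eq_single h]
    · rw [Matrix.one_apply_eq, one_mul]
    · intro p _ hp
      rw [Matrix.one_apply_ne (Ne.symm hp), zero_mul]
    · simp
  simp only [h1, re_trace_mul_sum_smul]
  rw [Finset.sum_comm]
  refine Finset.sum_congr rfl fun m _ => ?_
  rw [Finset.sum_comm, Finset.sum_eq_single m]
  · have := encAmp_isometry E m m
    rw [if_pos rfl] at this
    rw [← Finset.sum_mul]
    simp only [mul_comm (encAmp E m _), this, one_mul]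
  · intro m' _ hm'
    have := encAmp_isometry E m' m
    rw [if_neg hm'] at this
    rw [← Finset.sum_mul]
    simp only [mul_comm (encAmp E m _), this, zero_mul]
  · simp

/-- The protocol of an honest player is perfect: the result passes the check, and the others see
a measurement of `w`. -/
lemma realValue_honest (hM : M' = insert w M) (hw : w ∉ M) (hi : P.out w = some i)
    (hc : i ∉ P.corrupted) {side fin d : ℕ} (A : Adversary P n M i side fin)
    (test : Store n P.W → Op (Reg (Fin fin) × (Reg (P.GoodOut M' × Block n) × Fin d)))
    (σ : Op (Reg (Fin P.W) × (Reg (Fin A.first.mem) × Fin d))) :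
    realValue w A test σ = Finset.expect Finset.univ fun E : Fin P.W → Clifford (Block n) =>
      ∑ y, ∑ b, ∑ b', (test (storeIf E y (b = 0 ∧ b' = 0)) *
        branchHonest hM hi hc A σ E y y b b').trace.re := by
  have hempty : IsEmpty {_q : Block n // i ∈ P.corrupted} := ⟨fun q => hc q.2⟩
  have hemptyT : IsEmpty {_q : TabIdx (Block n) // i ∈ P.corrupted} := ⟨fun q => hc q.2⟩
  have h1 : ∀ f : Reg {_q : Block n // i ∈ P.corrupted} → ℝ, ∑ h, f h = f 0 := fun f =>
    Fintype.sum_subsingleton _ 0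
  have hsum : ∀ g : Reg {v // v ∈ M'} → ℝ,
      ∑ y, g y = ∑ y : Reg {v // v ∈ M}, ∑ m, g (addOutcome M' y m) := by
    intro g
    rw [← Fintype.sum_prod_type']
    exact ((addOutcome_bijective hM hw).sum_comp g).symm
  have hh : ∀ f : Reg (Block n) → ℝ, ∑ h : Reg {_q : Block n // i ∉ P.corrupted},
      f (fun q => h ⟨q, hc⟩) = ∑ p, f p := by
    intro f
    exact Equiv.sum_comp (Equiv.arrowCongr (Equiv.subtypeUnivEquiv fun _ => hc)
      (Equiv.refl (ZMod 2))) f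
  have h2 : ∀ E (y : Reg {v // v ∈ M}) b b' (k : Reg (Block n) × Reg (Block n) × Reg (Fin n)),
      ∑ h : Reg {_q : Block n // i ∉ P.corrupted},
        (Matrix.trace (test (measStore (idealStore E y b) w k.1 k.2.2 (reported 0 h) b') *
          onMid (sandwich (honestMeas M M' w i
            ((instruction (idealStore E y b) w k.1 k.2.1 k.2.2).getD 1) h))
            (onFst (attackMap A (message (instruction (idealStore E y b) w k.1 k.2.1 k.2.2))
              b 0 b') (received M E y y σ)))).re =
      ∑ m, (test (storeIf E (addOutcome M' y m) (b = 0 ∧ b' = 0)) *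
        branchHonest hM hi hc A σ E (addOutcome M' y m) (addOutcome M' y m) b b').trace.re := by
    intro E y b b' k
    have h3 : (message (instruction (idealStore E y b) w k.1 k.2.1 k.2.2) :
      Reg {_q : TabIdx (Block n) // i ∈ P.corrupted}) = 0 := Subsingleton.elim _ _
    have h4 : ∀ h : Reg {_q : Block n // i ∉ P.corrupted}, reported 0 h = fun q => h ⟨q, hc⟩ :=
      fun h => funext fun q => dif_neg hc
    simp only [h3, h4, onMid_honest hM hw hi hc]
    refine (hh fun h => (test (measStore (idealStore E y b) w k.1 k.2.2 h b') *
      ∑ m, ∑ m', ((∑ p, (instruction (idealStore E y b) w k.1 k.2.1 k.2.2).getD 1 h p *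
        encAmp (E w) m p) * star (∑ p, (instruction (idealStore E y b) w k.1 k.2.1 k.2.2).getD 1
          h p * encAmp (E w) m' p)) • branchHonest hM hi hc A σ E (addOutcome M' y m)
            (addOutcome M' y m') b b').trace.re).trans ?_
    rw [← Complex.re_sum, ← Complex.re_sum]
    refine congrArg Complex.re ?_
    by_cases hb : b = 0
    · rw [instruction_idealStore hw hi, if_pos hb, Option.getD_some, sum_honest_key
        (fun h => test (measStore (idealStore E y b) w k.1 k.2.2 h b'))
        (fun m m' => branchHonest hM hi hc A σ E (addOutcome M' y m) (addOutcome M' y m') b b')]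
      refine Finset.sum_congr rfl fun m _ => ?_
      -- The reported result `r + (m, m · c)` is decoded to `m`.
      have h6 : measStore (idealStore E y b) w k.1 k.2.2 (k.1 + codeword m k.2.2) b' =
          storeIf E (addOutcome M' y m) (b = 0 ∧ b' = 0) := by
        rw [measStore_idealStore hM hw E E fun _ _ => rfl, decodeOutcome_eq_some.2 rfl,
          Option.bind_some, storeIf]
        by_cases h7 : b = 0 ∧ b' = 0
        · rw [if_pos h7, if_pos h7]
        · rw [if_neg h7, if_neg h7]
      rw [h6]
    · rw [instruction_idealStore hw hi, if_neg hb, Option.getD_none]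
      -- Some corrupted player has aborted: the register is `⊥`, whatever is reported.
      have h5 : ∀ h, measStore (idealStore E y b) w k.1 k.2.2 h b' = none := fun h => by
        rw [measStore_idealStore hM hw E E fun _ _ => rfl, if_neg fun h' => hb h'.1]
      simp only [h5]
      rw [sum_honest_discard (test none)
        (fun m m' => branchHonest hM hi hc A σ E (addOutcome M' y m) (addOutcome M' y m') b b')]
      refine Finset.sum_congr rfl fun m _ => ?_
      rw [storeIf, if_neg fun h' => hb h'.1]
  simp only [realValue, h1, h2, Fintype.expect_const]
  refine Finset.expect_congr rfl fun E _ => ?_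
  rw [hsum]
  refine Finset.sum_congr rfl fun y _ => ?_
  have e1 : ∀ b : Reg P.Bad, ∑ b' : Reg P.Bad, ∑ m,
      (test (storeIf E (addOutcome M' y m) (b = 0 ∧ b' = 0)) *
        branchHonest hM hi hc A σ E (addOutcome M' y m) (addOutcome M' y m) b b').trace.re =
      ∑ m, ∑ b' : Reg P.Bad,
      (test (storeIf E (addOutcome M' y m) (b = 0 ∧ b' = 0)) *
        branchHonest hM hi hc A σ E (addOutcome M' y m) (addOutcome M' y m) b b').trace.re :=
    fun b => Finset.sum_comm
  simp only [e1]
  exact Finset.sum_comm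

/-- If the player `i` is honest, the simulator runs the adversary, and raises all abort bits if one
of its abort bits is raised. -/
theorem exists_simulator_honest (hM : M' = insert w M) (hw : w ∉ M) (hi : P.out w = some i)
    (hc : i ∉ P.corrupted) {side fin : ℕ} (A : Adversary P n M i side fin) :
    ∃ q : QCirc ((P.BadOut M' × Block n) ⊕ Fin A.first.mem) (P.Bad ⊕ Fin fin),
      q.size ≤ A.first.respond.size + A.attack.size + tailBound 0 0 (Fintype.card P.Bad) ∧
      ∀ {d : ℕ} (test : Store n P.W → Op (Reg (Fin fin) × (Reg (P.GoodOut M' × Block n) × Fin d)))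
        (σ : Op (Reg (Fin P.W) × (Reg (Fin A.first.mem) × Fin d))),
        realValue w A test σ = idealValue q test σ := by
  have hX : IsEmpty {_q : Block n // i ∈ P.corrupted} := ⟨fun q => hc q.2⟩
  have hTe : IsEmpty {_q : TabIdx (Block n) // i ∈ P.corrupted} := ⟨fun q => hc q.2⟩
  obtain ⟨q2, s2, r2⟩ := exists_tail A.first.respond A.attack
  let q := QCirc.seq (.relabel ((badEquivHonest hM hi hc n A.first.mem).trans
    (Equiv.emptySum ({_q : Block n // i ∈ P.corrupted} ⊕ {_q : TabIdx (Block n) // i ∈ P.corrupted})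
      _).symm)) q2
  have hrun : ∀ ρ, q.run ρ = ((1 : ℝ) : ℂ) • ∑ j : Reg P.Bad × Reg P.Bad,
        put (raise (Sum.elim (0 : Reg {_q : Block n // i ∈ P.corrupted}) (Sum.elim j.1 j.2)))
          (attackMap A 0 j.1 0 j.2
            ((QCirc.relabel (badEquivHonest hM hi hc n A.first.mem)).run ρ)) := by
    intro ρ
    have h1 : (QCirc.relabel ((badEquivHonest hM hi hc n A.first.mem).trans
        (Equiv.emptySum ({_q : Block n // i ∈ P.corrupted} ⊕
          {_q : TabIdx (Block n) // i ∈ P.corrupted}) _).symm)).run ρ =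
        put (Sum.elim 0 0) ((QCirc.relabel (badEquivHonest hM hi hc n A.first.mem)).run ρ) := by
      ext u v
      rw [put, Matrix.of_apply, if_pos ⟨Subsingleton.elim _ _, Subsingleton.elim _ _⟩]
      rfl
    have h2 : ∀ f : Reg {_q : Block n // i ∈ P.corrupted} → Op (Reg (P.Bad ⊕ Fin fin)),
        ∑ h, f h = f 0 := fun f => Fintype.sum_subsingleton _ 0
    simp only [q, QCirc.run_seq]
    rw [h1, r2]
    simp only [h2]
    rw [Fintype.sum_prod_type, Complex.ofReal_one, one_smul]
    refine Finset.sum_congr rfl fun b _ => Finset.sum_congr rfl fun b' _ => ?_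
    rw [attackMap_apply, add_zero, ite_self]
  refine ⟨q, ?_, fun {d} test σ => ?_⟩
  · rw [Fintype.card_eq_zero, Fintype.card_eq_zero] at s2
    simp only [q, QCirc.size]
    omega
  · rw [realValue_honest hM hw hi hc, idealValue]
    refine Finset.expect_congr rfl fun E _ => Finset.sum_congr rfl fun y _ => ?_
    rw [sum_test_slice q _ _ _ hrun fun b => test (idealStore E y b), one_mul,
      Fintype.sum_prod_type]
    refine Finset.sum_congr rfl fun b _ => Finset.sum_congr rfl fun b' _ => ?_
    have h2 : (Sum.elim 0 (Sum.elim b b') :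
        Reg ({_q : Block n // i ∈ P.corrupted} ⊕ (P.Bad ⊕ P.Bad))) = 0 ↔ b = 0 ∧ b' = 0 := by
      rw [sumElim_eq_zero, sumElim_eq_zero]
      exact and_iff_right rfl
    rw [idealStore_raise]
    · rw [h2]
      rfl
    · intro h
      by_contra hne
      rw [not_nonempty_iff] at hne
      exact h (h2.2 ⟨Subsingleton.elim _ _, Subsingleton.elim _ _⟩)

end Honest

/-! ### The complexity of the simulator, and the conclusion -/

section Conclusion

variable {P : Setup} {n : ℕ} {M M' : Finset (Fin P.W)} {w : Fin P.W} {i : Fin P.k}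

/-- The number of elementary operations that the simulator adds to those of the adversary, for
security parameter `n` and at most `b` corrupted players. -/
def overhead (n b : ℕ) : ℕ :=
  samplingBound (n + 1) (2 * (n + 1) * (2 * (n + 1) + 1)) n +
    tailBound (n + 1) (2 * (n + 1) * (2 * (n + 1) + 1)) b

lemma tailBound_mono {x x' t t' b b' : ℕ} (hx : x ≤ x') (ht : t ≤ t') (hb : b ≤ b') :
    tailBound x t b ≤ tailBound x' t' b' := by
  unfold tailBound
  gcongr

lemma overhead_mono {n n' b b' : ℕ} (hn : n ≤ n') (hb : b ≤ b') :
    overhead n b ≤ overhead n' b' := by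
  unfold overhead samplingBound tailBound
  gcongr

/-- A polynomial that bounds the complexity of the simulator. -/
lemma exists_polynomial_overhead : ∃ p : Polynomial ℕ, ∀ x, p.eval x = overhead x x + 2 * x := by
  let X : Polynomial ℕ := Polynomial.X
  let T : Polynomial ℕ := 2 * (X + 1) * (2 * (X + 1) + 1)
  refine ⟨(10 * (T + 2 * X + (X + 1)) + 4 * (X + 1) +
    (T + 2 * X) * ((4 * (X + 1) + 2) * (2 * (X + 1) + 1)) +
    ((T + 2 * X) * ((4 * (X + 1) + 2) * (2 * (X + 1) + 1)) + 2) * ((2 * T + 2 * X) * 1409)) +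
    ((X + 1 + X + T) * (6 * X + 7) + (X + 1 + T + X) +
      (X * ((X + 1 + 2 * X) * 12 + 1) + 2 * (X + 1 + X))) + 2 * X, fun x => ?_⟩
  simp [overhead, samplingBound, tailBound, X, T]

/-- The simulator of the measurement protocol. -/
theorem exists_simulator (hM : M' = insert w M) (hw : w ∉ M) (hi : P.out w = some i)
    {side fin : ℕ} (A : Adversary P n M i side fin) :
    ∃ q : QCirc ((P.BadOut M' × Block n) ⊕ Fin A.first.mem) (P.Bad ⊕ Fin fin),
      q.size ≤ A.first.respond.size + A.attack.size + overhead n (Fintype.card P.Bad) ∧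
      ∀ {d : ℕ} {test : Store n P.W → Op (Reg (Fin fin) × (Reg (P.GoodOut M' × Block n) × Fin d))}
        (_hT : ∀ s, (test s).PosSemidef) (_hT1 : ∀ s, (1 - test s).PosSemidef)
        {σ : Op (Reg (Fin P.W) × (Reg (Fin A.first.mem) × Fin d))} (_hσ : σ.PosSemidef)
        (_hσ1 : σ.trace.re ≤ 1),
        |realValue w A test σ - idealValue q test σ| ≤ 2 * (1 / 2 ^ n) := by
  by_cases hc : i ∈ P.corrupted
  · obtain ⟨q, hq, h⟩ := exists_simulator_corrupted hM hw hi hc A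
    refine ⟨q, hq.trans (le_of_eq ?_), h⟩
    have h1 : Fintype.card (Block n) = n + 1 := by simp
    have h2 : Fintype.card (TabIdx (Block n)) = 2 * (n + 1) * (2 * (n + 1) + 1) := by
      simp only [TabIdx, Fintype.card_prod, Fintype.card_sum, h1, Fintype.card_unit]
      ring
    rw [h1, h2, overhead]
    ring
  · obtain ⟨q, hq, h⟩ := exists_simulator_honest hM hw hi hc A
    refine ⟨q, hq.trans ?_, fun {d test} _ _ {σ} _ _ => ?_⟩
    · have := tailBound_mono (Nat.zero_le (n + 1))
        (Nat.zero_le (2 * (n + 1) * (2 * (n + 1) + 1))) (le_refl (Fintype.card P.Bad))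
      rw [overhead]
      omega
    · rw [h test σ, sub_self, abs_zero]
      positivity

/-- The simulator receives no more qubits than the adversary, as one output wire less is encoded. -/
lemma card_received_le (hM : M' = insert w M) (hw : w ∉ M) (hi : P.out w = some i) (m : ℕ) :
    Nat.card ((P.BadOut M' × Block n) ⊕ Fin m) ≤ Nat.card ((P.BadOut M × Block n) ⊕ Fin m) := by
  by_cases hc : i ∈ P.corrupted
  · exact Nat.card_le_card_of_injective (fun z => badEquiv hM hw hi hc n m (.inr z))
      ((badEquiv hM hw hi hc n m).injective.comp Sum.inr_injective)
  · exact Nat.card_le_card_of_injective _ (badEquivHonest hM hi hc n m).injective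

/-- The simulator reads and writes no more qubits than the adversary, and runs its circuits once;
the number of corrupted players is at most the number of abort bits, hence at most the complexity
of the adversary. -/
lemma Party.cost_le (hM : M' = insert w M) (hw : w ∉ M) (hi : P.out w = some i)
    {side fin : ℕ} (A : Adversary P n M i side fin)
    (q : QCirc ((P.BadOut M' × Block n) ⊕ Fin A.first.mem) (P.Bad ⊕ Fin fin))
    (hq : q.size ≤ A.first.respond.size + A.attack.size + overhead n (Fintype.card P.Bad)) :
    Party.cost (⟨A.first.mem, A.first.submit, q⟩ : Party P n M' side fin) ≤
      overhead (n + A.cost) (n + A.cost) + 2 * (n + A.cost) := by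
  have h1 := card_received_le (n := n) hM hw hi A.first.mem
  have h2 : Nat.card (P.Bad ⊕ Fin fin) ≤
      Nat.card (({_q : Block n // i ∈ P.corrupted} ⊕ P.Bad) ⊕ Fin fin) :=
    Nat.card_le_card_of_injective (Sum.map Sum.inr id)
      (Sum.map_injective.2 ⟨Sum.inr_injective, Function.injective_id⟩)
  have h3 : Fintype.card P.Bad ≤ Nat.card (P.Bad ⊕ Fin fin) := by
    rw [← Nat.card_eq_fintype_card]
    exact Nat.card_le_card_of_injective Sum.inl Sum.inl_injective
  have h4 : Fintype.card P.Bad ≤ A.cost := by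
    simp only [Adversary.cost, Party.cost, QCirc.cost]
    omega
  have h5 := overhead_mono (Nat.le_add_right n A.cost) (h4.trans (Nat.le_add_left A.cost n))
  simp only [Adversary.cost, Party.cost, QCirc.cost] at h5 ⊢
  omega

/-- The computation of the functionality, applied to the inputs of the players, yields a state. -/
lemma posSemidef_computed {m : ℕ} {C : Circuit P.W} {side fin : ℕ}
    (Z : Environment P n M side fin) (q : QCirc (P.BadIn ⊕ Fin side) (P.BadIn ⊕ Fin m)) :
    (onFst C.run (collect (onFst q.run Z.state))).PosSemidef :=
  C.completelyPositive _ _ (collect_posSemidef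
    (q.completelyPositive inferInstance _ _ Z.state_pos))

lemma re_trace_computed_le {m : ℕ} {C : Circuit P.W} (hC : C.WellFormed ∅) {side fin : ℕ}
    (Z : Environment P n M side fin) (q : QCirc (P.BadIn ⊕ Fin side) (P.BadIn ⊕ Fin m)) :
    (onFst C.run (collect (onFst q.run Z.state))).trace.re ≤ 1 := by
  rw [(C.tracePreserving ∅ hC).onFst]
  refine (collect_trace_le (q.completelyPositive inferInstance _ _ Z.state_pos)).trans ?_
  rw [(q.tracePreserving inferInstance).onFst, Z.state_trace, Complex.one_re]

lemma superpolynomialDecay_two_pow :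
    Asymptotics.SuperpolynomialDecay Filter.atTop (fun n : ℕ => (n : ℝ))
      fun n : ℕ => 2 * (1 / 2 ^ n : ℝ) := by
  intro k
  have h := (tendsto_pow_const_div_const_pow_of_one_lt k (one_lt_two : (1 : ℝ) < 2)).const_mul 2
  rw [mul_zero] at h
  refine h.congr fun n => ?_
  ring

end Conclusion

end MPQC

end

theorem mainTheorem5 :
    ∃ (ε : ℕ → ℝ) (p : Polynomial ℕ),
      Asymptotics.SuperpolynomialDecay Filter.atTop (fun n : ℕ => (n : ℝ)) ε ∧
      ∀ (n : ℕ) (P : MPQC.Setup) (_hP : P.corrupted ⊂ Finset.univ)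
        (C : MPQC.Circuit P.W) (_hC : C.WellFormed ∅)
        (w : Fin P.W) (_hw : w ∉ C.measured) (i : Fin P.k) (_hi : P.out w = some i)
        (side fin : ℕ) (A : MPQC.Adversary P n C.measured i side fin),
        ∃ S : MPQC.Party P n (MPQC.Circuit.measured (C ++ [MPQC.Gate.meas w])) side fin,
          S.cost ≤ p.eval (n + A.cost) ∧
          ∀ Z : MPQC.Environment P n (MPQC.Circuit.measured (C ++ [MPQC.Gate.meas w])) side fin,
            |MPQC.realProb C w i A Z - MPQC.idealProb (C ++ [MPQC.Gate.meas w]) S Z| ≤ ε n := by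
  obtain ⟨p, hp⟩ := MPQC.exists_polynomial_overhead
  refine ⟨fun n => 2 * (1 / 2 ^ n), p, MPQC.superpolynomialDecay_two_pow, ?_⟩
  intro n P _ C hC w hw i hi side fin A
  have hM := MPQC.Circuit.measured_append C w
  obtain ⟨q, hq, h⟩ := MPQC.exists_simulator hM hw hi A
  refine ⟨⟨A.first.mem, A.first.submit, q⟩, ?_, fun Z => ?_⟩
  · rw [hp]
    exact MPQC.Party.cost_le hM hw hi A q hq
  · rw [MPQC.realProb_eq, MPQC.idealProb_eq]
    exact h Z.test_pos Z.test_le (MPQC.posSemidef_computed Z A.first.submit)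
      (MPQC.re_trace_computed_le hC Z A.first.submit)
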